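/- Let $n\ge 1$, let $G=\mathrm{Isom}^+(\mathbb H^{n+1})\cong SO^+(n+1,1)$ with Lie algebra $\mathfrak g$, and let $V=\mathfrak g$ with the adjoint representation $\rho=\mathrm{Ad}$. Fix a base point $O\in\mathbb H^{n+1}$ and a point $\xi\in\partial_\infty\mathbb H^{n+1}$. Let $P_\xi=\mathrm{Stab}_G(\xi)$, let $\mathcal H$ be the horosphere based at $\xi$ through $O$ (isometric to $\mathbb R^n$), and let $P_\xi(1)=N_\xi K_\xi\subset P_\xi$ be the subgroup preserving $\mathcal H$, where $N_\xi\cong\mathbb R^n$ is the unipotent radical of $P_\xi$ (the translations of $\mathcal H$) and $K_\xi$ is the stabilizer of $O$ in $P_\xi(1)$, so that $\mathcal H=P_\xi(1)/K_\xi$. Let $T\in\mathfrak g$ generate the translations along the geodesic from $O$ to $\xi$, normalized so that $[T,u]=2u$ for all $u$ in the Lie algebra $\mathfrak n_\xi$ of $N_\xi$; write $V_\ell=\{v\in\mathfrak g:[T,v]=\ell v\}$, so that $\mathfrak g=V_{-2}\oplus V_0\oplus V_2$ and $\mathfrak n_\xi=V_2$. Choose Euclidean coordinates $x_1,\dots,x_n$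 on $\mathcal H$ centered at $O$, let $u_i\in\mathfrak n_\xi$ be the vector that exponentiates to the unit translation along the $x_i$-axis, and let $u_1^*,\dots,u_n^*$ be the dual basis. A $V$-valued differential $k$-form $\eta$ on $\mathcal H$ is identified with the function $\psi:P_\xi(1)\to\mathrm{Hom}(\Lambda^k\mathfrak n_\xi,V)$, $$\psi(p)(X_1,\dots,X_k)=\rho(p^{-1})\,\eta_{pO}(p_*X_1,\dots,p_*X_k),\qquad p_*X=\tfrac{d}{dt}\Big|_{t=0}\,p\exp(tX)\,O ,$$ and $\eta$ is called invariant under a subgroup of $P_\xi(1)$ if $\psi$ is invariant under left translation by that subgroup. Let $\Gamma<G$ be a torsion-free discrete subgroup such that $\xi$ is a full-rank cusp point of $\Gamma$, that is, $\Gamma_\xi=\Gamma\cap P_\xi$ acts cocompactly on $\mathcal H$. The cusp need not be toric: $\Gamma_\xi$ need not be contained in $N_\xi$. A closed $\Gamma_\xi$-invariant $V$-valued $n$-form $\eta$ on $\mathcal H$ represents the class in $H^n(\Gamma_\xi,\mathrm{Ad})$ that corresponds to it under the de Rham isomorphism, namely the class of the inhomogeneous cocycle whose value at $(g_1,\dots,g_n)$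 is the integral of $\eta$ over the straight simplex in $\mathcal H\cong\mathbb R^n$ with vertices $O,\ g_1O,\ g_1g_2O,\ \dots,\ g_1\cdots g_nO$. Then for every $\alpha\in H^n(\Gamma_\xi,\mathrm{Ad})$ there is exactly one smooth closed $V$-valued $n$-form on $\mathcal H$ which is invariant under $N_\xi$ and under $\Gamma_\xi$, represents $\alpha$, and whose function $\psi$ satisfies $$\psi(1)=(u_1^*\wedge\dots\wedge u_n^*)\otimes v\qquad\text{for some } v\in V_{-2}.$$ Moreover, for this $v$, the vector $\Theta v$ is fixed by $\mathrm{Ad}(\gamma)$ for every $\gamma\in\Gamma_\xi$, where $\Theta:\mathfrak g\to\mathfrak g$ is the Cartan involution at $O$. -/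

import Mathlib

open scoped ContDiff

noncomputable section

namespace HypCusp

/-! ### Hyperbolic space, its orientation preserving isometry group, and the Lie algebra -/

/-- The vector space `ℝ^{n+1,1}` with its usual topology; the coordinate with index `0` is the time
coordinate. (Its default norm only serves to give the topology.) -/
abbrev LSpace (n : ℕ) : Type := Fin (n + 2) → ℝ

/-- The Lorentzian form `- x₀ y₀ + x₁ y₁ + ⋯ + x_{n+1} y_{n+1}`. -/
def lor (n : ℕ) : LinearMap.BilinForm ℝ (LSpace n) :=
  LinearMap.mk₂ ℝ (fun x y => - (x 0 * y 0) + ∑ i : Fin (n + 1), x i.succ * y i.succ)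
    (fun x x' y => by simp only [Pi.add_apply, add_mul, Finset.sum_add_distrib]; ring)
    (fun c x y => by
      simp only [Pi.smul_apply, smul_eq_mul, mul_add, Finset.mul_sum, mul_assoc]; ring)
    (fun x y y' => by simp only [Pi.add_apply, mul_add, Finset.sum_add_distrib]; ring)
    (fun c x y => by
      simp only [Pi.smul_apply, smul_eq_mul, mul_add, Finset.mul_sum, mul_left_comm]; ring)

theorem lor_apply {n : ℕ} (x y : LSpace n) :
    lor n x y = - (x 0 * y 0) + ∑ i : Fin (n + 1), x i.succ * y i.succ := rfl

theorem lor_comm {n : ℕ} (x y : LSpace n) : lor n x y = lor n y x := by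
  simp only [lor_apply, mul_comm]

/-- Hyperbolic space `ℍ^{n+1}` in the hyperboloid model. -/
def hyperboloid (n : ℕ) : Set (LSpace n) := {x | lor n x x = -1 ∧ 0 < x 0}

theorem time_ne_zero {n : ℕ} {x : LSpace n} (hx : lor n x x = -1) : x 0 ≠ 0 := by
  intro h
  have h2 : 0 ≤ ∑ i : Fin (n + 1), x i.succ * x i.succ :=
    Finset.sum_nonneg fun i _ => mul_self_nonneg _
  rw [lor_apply, h] at hx
  linarith

/-- `SO⁺(n+1,1)`, the group of orientation preserving isometries of `ℍ^{n+1}`: the linear maps of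
determinant one which preserve the Lorentzian form and the upper sheet of the hyperboloid.
It carries the subspace topology. -/
def SOPlus (n : ℕ) : Subgroup (LSpace n →L[ℝ] LSpace n)ˣ where
  carrier := {g | (∀ x y, lor n (g.1 x) (g.1 y) = lor n x y) ∧
    LinearMap.det (g.1 : LSpace n →ₗ[ℝ] LSpace n) = 1 ∧
    ∀ x ∈ hyperboloid n, g.1 x ∈ hyperboloid n}
  one_mem' := ⟨fun _ _ => rfl, by
    simp, fun x hx => hx⟩
  mul_mem' := by
    rintro a b ⟨ha, ha', ha''⟩ ⟨hb, hb', hb''⟩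
    refine ⟨fun x y => ?_, ?_, fun x hx => ha'' _ (hb'' x hx)⟩
    · exact (ha _ _).trans (hb x y)
    · have : ((a * b).1 : LSpace n →ₗ[ℝ] LSpace n) =
        (a.1 : LSpace n →ₗ[ℝ] LSpace n) ∘ₗ (b.1 : LSpace n →ₗ[ℝ] LSpace n) := rfl
      rw [this, LinearMap.det_comp, ha', hb', one_mul]
  inv_mem' := by
    rintro a ⟨ha, ha', ha''⟩
    have key : ∀ x, a.1 ((a⁻¹).1 x) = x := fun x => by
      have h := congrArg (fun f : LSpace n →L[ℝ] LSpace n => f x) a.mul_inv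
      exact h
    have hB : ∀ x y, lor n ((a⁻¹).1 x) ((a⁻¹).1 y) = lor n x y := fun x y => by
      rw [← ha, key, key]
    refine ⟨hB, ?_, fun x hx => ?_⟩
    · have h1 : (a.1 : LSpace n →ₗ[ℝ] LSpace n) ∘ₗ ((a⁻¹).1 : LSpace n →ₗ[ℝ] LSpace n) =
        LinearMap.id := LinearMap.ext key
      have h2 := congrArg LinearMap.det h1
      rw [LinearMap.det_comp, ha', one_mul, LinearMap.det_id] at h2
      exact h2
    · have h1 : lor n ((a⁻¹).1 x) ((a⁻¹).1 x) = -1 := (hB x x).trans hx.1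
      refine ⟨h1, ?_⟩
      by_contra hneg
      have hlt : ((a⁻¹).1 x) 0 < 0 := lt_of_le_of_ne (not_lt.mp hneg) (time_ne_zero h1)
      have h2 : -((a⁻¹).1 x) ∈ hyperboloid n := by
        refine ⟨?_, ?_⟩
        · simpa using h1
        · simpa using hlt
      have h3 := (ha'' _ h2).2
      rw [map_neg, key] at h3
      have h4 := hx.2
      simp only [Pi.neg_apply] at h3
      linarith

/-- The linear action of an isometry on `ℝ^{n+1,1}`, which restricts to its action on
hyperbolic space. -/
def act {n : ℕ} (g : SOPlus n) : LSpace n →L[ℝ] LSpace n := (g : (LSpace n →L[ℝ] LSpace n)ˣ).1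

theorem act_mul {n : ℕ} (g h : SOPlus n) (x : LSpace n) : act (g * h) x = act g (act h x) := rfl

theorem act_one {n : ℕ} (x : LSpace n) : act (1 : SOPlus n) x = x := rfl

theorem lor_act {n : ℕ} (g : SOPlus n) (x y : LSpace n) :
    lor n (act g x) (act g y) = lor n x y := g.2.1 x y

theorem act_inv_act {n : ℕ} (g : SOPlus n) (x : LSpace n) : act g⁻¹ (act g x) = x := by
  rw [← act_mul, inv_mul_cancel, act_one]

theorem act_act_inv {n : ℕ} (g : SOPlus n) (x : LSpace n) : act g (act g⁻¹ x) = x := by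
  rw [← act_mul, mul_inv_cancel, act_one]

/-- The endomorphisms of `ℝ^{n+1,1}` which are skew for the Lorentzian form. -/
def skew (n : ℕ) : Submodule ℝ (LSpace n →L[ℝ] LSpace n) where
  carrier := {X | ∀ x y, lor n (X x) y + lor n x (X y) = 0}
  zero_mem' := fun x y => by simp
  add_mem' := by
    intro X Y hX hY x y
    have h1 := hX x y
    have h2 := hY x y
    simp only [add_apply, map_add, LinearMap.add_apply]
    linarith
  smul_mem' := by
    intro c X hX x y
    have h1 := hX x y
    simp only [smul_apply, map_smul, LinearMap.smul_apply, smul_eq_mul]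
    rw [← mul_add, h1, mul_zero]

/-- The Lie algebra `𝔤 = 𝔰𝔬(n+1,1)` of the skew endomorphisms, as a finite dimensional normed space.
Its bracket is the commutator. -/
def so (n : ℕ) : Type := skew n

instance (n : ℕ) : NormedAddCommGroup (so n) := inferInstanceAs (NormedAddCommGroup (skew n))

instance (n : ℕ) : NormedSpace ℝ (so n) := inferInstanceAs (NormedSpace ℝ (skew n))

/-- An element of `𝔤`, as an endomorphism of `ℝ^{n+1,1}`. -/
def toEnd {n : ℕ} : so n →ₗ[ℝ] (LSpace n →L[ℝ] LSpace n) := (skew n).subtype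

/-- A skew endomorphism, as an element of `𝔤`. -/
def so.mk {n : ℕ} (X : LSpace n →L[ℝ] LSpace n)
    (hX : ∀ x y, lor n (X x) y + lor n x (X y) = 0) : so n := (⟨X, hX⟩ : skew n)

theorem toEnd_mk {n : ℕ} (X : LSpace n →L[ℝ] LSpace n)
    (hX : ∀ x y, lor n (X x) y + lor n x (X y) = 0) : toEnd (so.mk X hX) = X := rfl

theorem toEnd_skew {n : ℕ} (X : so n) (x y : LSpace n) :
    lor n (toEnd X x) y + lor n x (toEnd X y) = 0 := Subtype.prop (p := (· ∈ skew n)) X x y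

theorem toEnd_injective {n : ℕ} : Function.Injective (toEnd (n := n)) := Subtype.val_injective

/-- The linear map `X ↦ g X g⁻¹` of the Lie algebra. -/
def conj {n : ℕ} (g : SOPlus n) : so n →ₗ[ℝ] so n where
  toFun X := so.mk (act g * toEnd X * act g⁻¹) fun x y => by
    simp only [mul_apply_eq_comp]
    rw [← lor_act g⁻¹, ← lor_act g⁻¹ x, act_inv_act, act_inv_act]
    exact toEnd_skew X _ _
  map_add' X Y := toEnd_injective (by
    simp only [map_add, toEnd_mk, mul_add, add_mul])
  map_smul' c X := toEnd_injective (by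
    simp only [map_smul, toEnd_mk, mul_smul_comm, smul_mul_assoc, RingHom.id_apply])

theorem conj_apply {n : ℕ} (g : SOPlus n) (X : so n) (x : LSpace n) :
    toEnd (conj g X) x = act g (toEnd X (act g⁻¹ x)) := rfl

theorem so_ext {n : ℕ} {X Y : so n} (h : ∀ x, toEnd X x = toEnd Y x) : X = Y :=
  toEnd_injective (ContinuousLinearMap.ext h)

/-- The adjoint representation `Ad g X = g X g⁻¹` of `SO⁺(n+1,1)` on its Lie algebra. -/
def Ad (n : ℕ) : Representation ℝ (SOPlus n) (so n) where
  toFun := conj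
  map_one' := LinearMap.ext fun X => so_ext fun x => by
    rw [conj_apply, inv_one, act_one, act_one, Module.End.one_apply]
  map_mul' g h := LinearMap.ext fun X => so_ext fun x => by
    rw [Module.End.mul_apply, conj_apply, conj_apply, conj_apply, mul_inv_rev, act_mul, act_mul]

theorem Ad_apply {n : ℕ} (g : SOPlus n) (X : so n) (x : LSpace n) :
    toEnd (Ad n g X) x = act g (toEnd X (act g⁻¹ x)) := rfl

/-- The infinitesimal isometry `a ∧ b`, that is `x ↦ ⟨b, x⟩ a - ⟨a, x⟩ b`. -/
def wedge {n : ℕ} (a b : LSpace n) : so n :=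
  so.mk (LinearMap.toContinuousLinearMap ((lor n b).smulRight a - (lor n a).smulRight b))
    fun x y => by
      change lor n (lor n b x • a - lor n a x • b) y + lor n x (lor n b y • a - lor n a y • b) = 0
      simp only [map_sub, map_smul, LinearMap.sub_apply, LinearMap.smul_apply, smul_eq_mul]
      rw [lor_comm x a, lor_comm x b]
      ring

theorem wedge_apply {n : ℕ} (a b x : LSpace n) :
    toEnd (wedge a b) x = lor n b x • a - lor n a x • b := rfl

/-! ### A point at infinity, its horosphere and its parabolic subgroup -/

/-- A base point `O` of `ℍ^{n+1}`, a point `ξ` at infinity, represented by the null vector on its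
ray with `⟨ξ, O⟩ = -1`, and orthonormal coordinate directions `w₁, …, wₙ` at `O` tangent to the
horosphere through `O` based at `ξ`. -/
structure Frame (n : ℕ) where
  O : LSpace n
  ξ : LSpace n
  w : Fin n → LSpace n
  O_mem : O ∈ hyperboloid n
  ξ_null : lor n ξ ξ = 0
  ξ_O : lor n ξ O = -1
  w_w : ∀ i j, lor n (w i) (w j) = if i = j then 1 else 0
  w_O : ∀ i, lor n (w i) O = 0
  w_ξ : ∀ i, lor n (w i) ξ = 0

namespace Frame

variable {n : ℕ} (F : Frame n)

/-- The horosphere `ℋ_ξ(1)` based at `ξ` and passing through `O`. -/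
def horosphere : Set (LSpace n) := {x | x ∈ hyperboloid n ∧ lor n F.ξ x = -1}

/-- The linear map `ℝ^{n+1,1} → ℝⁿ`, `x ↦ (⟨w₁, x⟩, …, ⟨wₙ, x⟩)`. Its restriction to the horosphere
is an isometry onto Euclidean space, which sends `O` to the origin; being linear it is its own
derivative, so it also gives the coordinates of vectors tangent to the horosphere. -/
def chart : LSpace n →ₗ[ℝ] EuclideanSpace ℝ (Fin n) :=
  (WithLp.linearEquiv 2 ℝ (Fin n → ℝ)).symm.toLinearMap ∘ₗ LinearMap.pi fun i => lor n (F.w i)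

theorem chart_apply (x : LSpace n) (i : Fin n) : F.chart x i = lor n (F.w i) x := rfl

/-- The parabolic subgroup `P_ξ`: the stabilizer of `ξ` as a point at infinity. -/
def P : Subgroup (SOPlus n) where
  carrier := {g | ∃ c : ℝ, 0 < c ∧ act g F.ξ = c • F.ξ}
  one_mem' := ⟨1, one_pos, by rw [act_one, one_smul]⟩
  mul_mem' := by
    rintro a b ⟨c, hc, ha⟩ ⟨d, hd, hb⟩
    exact ⟨d * c, mul_pos hd hc, by rw [act_mul, hb, map_smul, ha, smul_smul]⟩
  inv_mem' := by
    rintro a ⟨c, hc, ha⟩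
    refine ⟨c⁻¹, inv_pos.mpr hc, ?_⟩
    have h := act_inv_act a F.ξ
    rw [ha, map_smul] at h
    rw [← h, smul_smul, inv_mul_cancel₀ hc.ne', one_smul, h]

/-- The subgroup `P_ξ(1) = N_ξ K_ξ` of the elements of `P_ξ` which preserve the horosphere,
that is, which fix the null vector `ξ`. -/
def P1 : Subgroup (SOPlus n) where
  carrier := {g | act g F.ξ = F.ξ}
  one_mem' := act_one _
  mul_mem' := by
    intro a b ha hb
    change act (a * b) F.ξ = F.ξ
    rw [act_mul, hb, ha]
  inv_mem' := by
    intro a ha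
    have h := act_inv_act a F.ξ
    rwa [ha] at h

/-- The unipotent radical `N_ξ` of `P_ξ`: the elements which fix `ξ` and act trivially on
`ξ^⊥ / ℝ ξ`. It acts simply transitively on the horosphere, by the translations. -/
def N : Subgroup (SOPlus n) where
  carrier := {g | act g F.ξ = F.ξ ∧ ∀ x, lor n F.ξ x = 0 → ∃ c : ℝ, act g x = x + c • F.ξ}
  one_mem' := ⟨act_one _, fun x _ => ⟨0, by rw [act_one, zero_smul, add_zero]⟩⟩
  mul_mem' := by
    rintro a b ⟨ha, ha'⟩ ⟨hb, hb'⟩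
    refine ⟨by rw [act_mul, hb, ha], fun x hx => ?_⟩
    obtain ⟨c, hc⟩ := hb' x hx
    obtain ⟨d, hd⟩ := ha' x hx
    exact ⟨d + c, by rw [act_mul, hc, map_add, map_smul, ha, hd, add_smul, add_assoc]⟩
  inv_mem' := by
    rintro a ⟨ha, ha'⟩
    have h0 : act a⁻¹ F.ξ = F.ξ := by
      have h := act_inv_act a F.ξ
      rwa [ha] at h
    refine ⟨h0, fun x hx => ?_⟩
    obtain ⟨c, hc⟩ := ha' x hx
    refine ⟨-c, ?_⟩
    have h := act_inv_act a x
    rw [hc, map_add, map_smul, h0] at h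
    rw [neg_smul, ← sub_eq_add_neg, eq_sub_iff_add_eq]
    exact h

/-- The generator of the Lie algebra of `A_ξ` with `T ξ = 2 ξ`, so that `[T, u] = 2 u` for every
`u` in the Lie algebra of `N_ξ`. -/
def T : so n := (2 : ℝ) • wedge F.O F.ξ

/-- The restricted root space `V_ℓ = {v ∈ 𝔤 : [T, v] = ℓ v}` of the adjoint representation. -/
def V (l : ℝ) : Submodule ℝ (so n) where
  carrier := {v | toEnd F.T * toEnd v - toEnd v * toEnd F.T = l • toEnd v}
  zero_mem' := by simp
  add_mem' := by
    intro v v' hv hv'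
    simp only [Set.mem_ofPred_eq, map_add, mul_add, add_mul, smul_add] at hv hv' ⊢
    rw [← hv, ← hv']
    abel
  smul_mem' := by
    intro c v hv
    simp only [Set.mem_ofPred_eq, map_smul] at hv ⊢
    rw [mul_smul_comm, smul_mul_assoc, smul_comm l c, ← hv, smul_sub]

/-- The Lie algebra `𝔫_ξ` of `N_ξ`, which is `V₂`. -/
abbrev 𝔫 : Submodule ℝ (so n) := F.V 2

/-- The vector `u_i` of `𝔫_ξ`, which exponentiates to the unit translation of the horosphere in
the `i`-th coordinate direction. -/
def u (i : Fin n) : 𝔫 F :=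
  ⟨wedge F.ξ (F.w i), by
    change toEnd F.T * toEnd (wedge F.ξ (F.w i)) - toEnd (wedge F.ξ (F.w i)) * toEnd F.T =
      (2 : ℝ) • toEnd (wedge F.ξ (F.w i))
    ext1 x
    have h1 := F.w_ξ i
    have h2 := F.w_O i
    have h3 := F.ξ_null
    have h4 := F.ξ_O
    have h5 : lor n F.O F.ξ = -1 := by rw [lor_comm]; exact h4
    have h6 : lor n F.ξ (F.w i) = 0 := by rw [lor_comm]; exact h1
    have h7 : lor n F.O (F.w i) = 0 := by rw [lor_comm]; exact h2
    have hT : ∀ y, toEnd F.T y = (2 : ℝ) • (lor n F.ξ y • F.O - lor n F.O y • F.ξ) := fun y => rfl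
    rw [sub_apply, mul_apply_eq_comp,
      mul_apply_eq_comp, smul_apply, hT x]
    simp only [map_sub, map_smul, hT, wedge_apply, h1, h2, h3, h4, h5, h6, h7]
    module⟩

/-- The dual vector `u_i^*`. As `X O` is the velocity at `O` of the one-parameter group of `X`, it
is the `i`-th coordinate of this velocity. -/
def uDual (i : Fin n) : 𝔫 F →ₗ[ℝ] ℝ where
  toFun X := lor n (F.w i) (toEnd X.1 F.O)
  map_add' X Y := by simp only [Submodule.coe_add, map_add, add_apply]
  map_smul' c X := by
    simp only [Submodule.coe_smul, map_smul, smul_apply, smul_eq_mul, RingHom.id_apply]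

theorem uDual_u (i j : Fin n) : F.uDual i (F.u j) = if i = j then 1 else 0 := by
  change lor n (F.w i) (toEnd (wedge F.ξ (F.w j)) F.O) = _
  rw [wedge_apply, F.w_O, F.ξ_O, ← F.w_w i j]
  simp

/-- The multilinear form `u_1^* ∧ ⋯ ∧ u_n^*`, normalized by the value one on `(u_1, …, u_n)`. -/
def vol : (𝔫 F) [⋀^Fin n]→ₗ[ℝ] ℝ :=
  Matrix.detRowAlternating.compLinearMap (LinearMap.pi F.uDual)

theorem vol_u : F.vol F.u = 1 := by
  have h : (fun i => LinearMap.pi F.uDual (F.u i)) = (1 : Matrix (Fin n) (Fin n) ℝ) := by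
    ext i j
    rw [LinearMap.pi_apply, F.uDual_u, Matrix.one_apply]
    simp only [eq_comm]
  change Matrix.det (fun i => LinearMap.pi F.uDual (F.u i)) = 1
  rw [h, Matrix.det_one]

/-- The element `(u_1^* ∧ ⋯ ∧ u_n^*) ⊗ v` of `Hom(Λⁿ 𝔫_ξ, V)`. -/
def volTensor (v : so n) : (𝔫 F) [⋀^Fin n]→ₗ[ℝ] (so n) :=
  (LinearMap.toSpanSingleton ℝ (so n) v).compAlternatingMap F.vol

/-- The geodesic symmetry at `O`, as a linear map of `ℝ^{n+1,1}`. -/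
def sym : LSpace n →L[ℝ] LSpace n :=
  LinearMap.toContinuousLinearMap (-LinearMap.id - (2 : ℝ) • (lor n F.O).smulRight F.O)

theorem sym_apply (x : LSpace n) : F.sym x = -x - (2 : ℝ) • lor n F.O x • F.O := rfl

theorem lor_sym (x y : LSpace n) : lor n (F.sym x) y = lor n x (F.sym y) := by
  simp only [sym_apply, map_sub, map_neg, map_smul, LinearMap.sub_apply, LinearMap.neg_apply,
    LinearMap.smul_apply, smul_eq_mul]
  rw [lor_comm x F.O]
  ring

/-- The Cartan involution of `𝔤` at `O`: conjugation by the geodesic symmetry at `O` (which is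
its own inverse). -/
def Θ : so n →ₗ[ℝ] so n where
  toFun X := so.mk (F.sym * toEnd X * F.sym) fun x y => by
    simp only [mul_apply_eq_comp]
    rw [lor_sym, ← lor_sym F x]
    exact toEnd_skew X _ _
  map_add' X Y := toEnd_injective (by
    simp only [map_add, toEnd_mk, mul_add, add_mul])
  map_smul' c X := toEnd_injective (by
    simp only [map_smul, toEnd_mk, mul_smul_comm, smul_mul_assoc, RingHom.id_apply])

/-! ### Differential forms on the horosphere and group cohomology -/

/-- A differential `k`-form on the horosphere with values in `V = 𝔤`, in the Euclidean
coordinates given by `chart`. -/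
abbrev Form (n k : ℕ) : Type :=
  EuclideanSpace ℝ (Fin n) → EuclideanSpace ℝ (Fin n) [⋀^Fin k]→L[ℝ] (so n)

/-- The linear map `𝔫_ξ → T_{pO} ℋ_ξ(1) ≅ ℝⁿ` which sends `X` to the velocity of `p exp(tX) O` at
`t = 0`. -/
def tangent (p : F.P1) : 𝔫 F →ₗ[ℝ] EuclideanSpace ℝ (Fin n) where
  toFun X := F.chart (act p.1 (toEnd X.1 F.O))
  map_add' X Y := by simp only [Submodule.coe_add, map_add, add_apply]
  map_smul' c X := by simp only [Submodule.coe_smul, map_smul, smul_apply, RingHom.id_apply]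

/-- The function `P_ξ(1) → Hom(Λᵏ 𝔫_ξ, V)` which corresponds to the differential form `η` on the
horosphere `P_ξ(1) / K_ξ`: at `p` it is the pull back of `η` by `p ↦ p O`, in the left invariant
trivialization of the tangent bundle of the group, twisted by `ρ(p⁻¹)`. -/
def lift {k : ℕ} (η : Form n k) (p : F.P1) : (𝔫 F) [⋀^Fin k]→ₗ[ℝ] (so n) :=
  (Ad n (p.1)⁻¹).compAlternatingMap
    ((η (F.chart (act p.1 F.O))).toAlternatingMap.compLinearMap (F.tangent p))

/-- The stabilizer `Γ_ξ = Γ ∩ P_ξ`. -/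
abbrev stab (Γ : Subgroup (SOPlus n)) : Subgroup (SOPlus n) := Γ ⊓ F.P

/-- `ξ` is a fixed point of full rank of `Γ`: the group `Γ_ξ` acts cocompactly on the horosphere.
(An element of `P_ξ` which sends one point of the horosphere into the horosphere preserves it, so
only such elements matter here.) -/
def IsFullRank (Γ : Subgroup (SOPlus n)) : Prop :=
  ∃ C : Set (LSpace n), IsCompact C ∧ C ⊆ F.horosphere ∧
    ∀ x ∈ F.horosphere, ∃ γ ∈ F.stab Γ, act γ x ∈ C

/-- The coefficient module `Ad` of a group of isometries. -/
abbrev AdRep (Δ : Subgroup (SOPlus n)) : Rep.{0} ℝ Δ := Rep.of ((Ad n).comp Δ.subtype)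

/-- The simplex `{t ∈ ℝᵏ : t_i ≥ 0, ∑ t_i ≤ 1}`. -/
def stdSimplexCorner (k : ℕ) : Set (Fin k → ℝ) := {t | (∀ i, 0 ≤ t i) ∧ ∑ i, t i ≤ 1}

/-- The integral of a `V`-valued `k`-form over the oriented straight simplex of Euclidean space
with vertices `x₀, …, x_k`. -/
def simplexIntegral {k : ℕ} (η : Form n k) (x : Fin (k + 1) → EuclideanSpace ℝ (Fin n)) : so n :=
  ∫ t in stdSimplexCorner k,
    η (x 0 + ∑ i : Fin k, t i • (x i.succ - x 0)) (fun i => x i.succ - x 0)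

/-- The inhomogeneous `k`-cochain which corresponds to a `V`-valued `k`-form on the horosphere: its
value at `(g₁, …, g_k)` is the integral of the form over the straight simplex of the (Euclidean)
horosphere with vertices `O, g₁ O, g₁ g₂ O, …, g₁ ⋯ g_k O`. -/
def cochain {k : ℕ} (η : Form n k) (Δ : Subgroup (SOPlus n)) (g : Fin k → Δ) : so n :=
  simplexIntegral η fun j => F.chart (act (Fin.partialProd g j).1 F.O)

/-- The form `η` represents the class `α` of group cohomology under the de Rham isomorphism: the
cochain obtained by integrating `η` over straight simplices is a cocycle with class `α`. -/
def Represents {k : ℕ} (η : Form n k) (Δ : Subgroup (SOPlus n))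
    (α : groupCohomology (AdRep Δ) k) : Prop :=
  ∃ c : groupCohomology.cocycles (AdRep Δ) k,
    groupCohomology.iCocycles (AdRep Δ) k c = F.cochain η Δ ∧ groupCohomology.π (AdRep Δ) k c = α

/-- `η` is a smooth closed `V`-valued `n`-form on the horosphere which is invariant under `N_ξ` and
under `Γ_ξ`, represents `α`, and has an initial value `(u_1^* ∧ ⋯ ∧ u_n^*) ⊗ v` with
`v ∈ V_{-2}`. -/
structure IsInvariantRepresentative (Γ : Subgroup (SOPlus n))
    (α : groupCohomology (AdRep (F.stab Γ)) n) (η : Form n n) : Prop where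
  smooth : ContDiff ℝ ∞ η
  closed : extDeriv η = 0
  N_invariant : ∀ ν : F.P1, ν.1 ∈ F.N → ∀ p : F.P1, F.lift η (ν * p) = F.lift η p
  Γ_invariant : ∀ γ : F.P1, γ.1 ∈ F.stab Γ → ∀ p : F.P1, F.lift η (γ * p) = F.lift η p
  represents : F.Represents η (F.stab Γ) α
  initial : ∃ v ∈ F.V (-2), F.lift η 1 = F.volTensor v

end Frame

end HypCusp

end

open HypCusp

/-! ### Homogeneous cochains -/

/-! The `N_ξ`-invariant `n`-forms with initial value in `V₋₂` form a family `η_y` indexed by `y ∈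
ℝⁿ`: the coefficient of the volume form at `x` is `Ad (ν x) (root y)`, where `ν x` is the
translation by `x`. An element `g` of `P_ξ(1)` carries `η_y` to `η_{rot(g) y}` (`Ad_field`), so
`η_y` is `Γ_ξ`-invariant exactly when `y` is fixed by all rotation parts of `Γ_ξ`. Closedness is
automatic in top degree, and Stokes on degenerate simplices (`sum_topIntegral`) makes the
integration cochain a cocycle. Everything reduces to showing that `y ↦ [η_y]` identifies the fixed
vectors with `Hⁿ(Γ_ξ, Ad)`.

By discreteness and full rank, `Γ_ξ` preserves the horosphere (`stab_le_P1`) and is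
crystallographic; Bieberbach's theorem provides a lattice `L` of translations of finite index
(`exists_translations`). Over `L` the map `y ↦ [η_y]` is bijective on all of `ℝⁿ`.

Injectivity: `X ↦ chart (X ξ)` is an `N_ξ`-invariant map `𝔤 → ℝⁿ` which is constantly `2 y` on the
coefficient of `η_y`. Evaluation on the fundamental cycle of the torus, which kills coboundaries
(`torusEval_hd`), therefore recovers a nonzero multiple of `y` (`eq_zero_of_homCochain_eq`).

Surjectivity: iterated connecting maps exhibit `Hⁿ(L, 𝔤)` as a quotient of the coinvariants `𝔤_L`,
the half of Poincaré duality that is needed. The kernel of `X ↦ chart (X ξ)` dies in `𝔤_L`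
(`mem_of_coinv_eq_zero`), so the dimension is at most `n`, and the injection is onto
(`exists_eq_add_hd`).

Averaging over the finite quotient passes from `L` to `Γ_ξ` (`exists_invariant_eq_add_hd`);
uniqueness is injectivity over `L`. Finally `Θ` sends `root y` to `-ξ ∧ y`, which translations
centralize and which a rotation fixing `y` preserves. -/

namespace HomCochain

variable {k G V : Type*} [Field k] [AddCommGroup V] [Module k V]

/-- The differential of homogeneous cochains; the cochains on `Fin 0 → G` are the augmentation. -/
def hd (k : Type*) [Field k] [Module k V] (q : ℕ) :
    ((Fin q → G) → V) →ₗ[k] ((Fin (q + 1) → G) → V) where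
  toFun c x := ∑ i : Fin (q + 1), (-1 : k) ^ (i : ℕ) • c (x ∘ i.succAbove)
  map_add' c c' := by
    ext x
    simp [Finset.sum_add_distrib]
  map_smul' r c := by
    ext x
    simp [Finset.smul_sum, smul_comm _ r]

theorem hd_apply (q : ℕ) (c : (Fin q → G) → V) (x : Fin (q + 1) → G) :
    hd k q c x = ∑ i : Fin (q + 1), (-1 : k) ^ (i : ℕ) • c (x ∘ i.succAbove) := rfl

/-- The cone contraction of homogeneous cochains. -/
def cone {q : ℕ} (a : G) (c : (Fin (q + 1) → G) → V) (x : Fin q → G) : V := c (Fin.cons a x)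

theorem cons_comp_succ_succAbove {q : ℕ} (a : G) (x : Fin (q + 1) → G) (i : Fin (q + 1)) :
    (Fin.cons a x : Fin (q + 2) → G) ∘ i.succ.succAbove =
      (Fin.cons a (x ∘ i.succAbove) : Fin (q + 1) → G) := by
  ext j
  refine Fin.cases ?_ (fun j => ?_) j
  · simp
  · simp

/-- The face opposite to the cone vertex `a` returns `c`; every other face is the cone on a face of
the base, with its index, hence its sign, shifted by one. -/
theorem cone_hd {q : ℕ} (a : G) (c : (Fin (q + 1) → G) → V) :
    cone a (hd k (q + 1) c) = c - hd k q (cone a c) := by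
  ext x
  simp only [cone, hd_apply, Pi.sub_apply]
  rw [Fin.sum_univ_succ, sub_eq_add_neg, ← Finset.sum_neg_distrib]
  congr 1
  · simp only [Fin.val_zero, pow_zero, one_smul]
    congr 1
  · refine Finset.sum_congr rfl fun i _ => ?_
    rw [cons_comp_succ_succAbove, Fin.val_succ, pow_succ, mul_neg_one, neg_smul]

/-- The contraction replaces the usual cancellation in a double sum: the value at `x` is the value
of a cone with vertex `x 0`, and coning twice reduces the degree by one. -/
theorem hd_hd {q : ℕ} (c : (Fin q → G) → V) : hd k (q + 1) (hd k q c) = 0 := by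
  induction q with
  | zero =>
    ext x
    have h (y : Fin (0 + 1) → G) : hd k 0 c y = c default := by
      simp [hd_apply, Subsingleton.elim (y ∘ _) default]
    rw [hd_apply, Fin.sum_univ_two, h, h]
    simp
  | succ q ih =>
    ext x
    have h : cone (x 0) (hd k (q + 1 + 1) (hd k (q + 1) c)) = 0 := by
      rw [cone_hd, cone_hd, map_sub, ih, sub_zero, sub_self]
    have := congrFun h (Fin.tail x)
    rwa [cone, Fin.cons_self_tail] at this

variable [Group G]

/-- The action of the group on homogeneous cochains. -/
def tr (ρ : Representation k G V) {q : ℕ} (g : G) :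
    ((Fin q → G) → V) →ₗ[k] ((Fin q → G) → V) where
  toFun c x := ρ g (c fun i => g⁻¹ * x i)
  map_add' c c' := by
    ext x
    simp
  map_smul' r c := by
    ext x
    simp

theorem tr_apply (ρ : Representation k G V) {q : ℕ} (g : G) (c : (Fin q → G) → V)
    (x : Fin q → G) : tr ρ g c x = ρ g (c fun i => g⁻¹ * x i) := rfl

theorem tr_one (ρ : Representation k G V) {q : ℕ} (c : (Fin q → G) → V) : tr ρ 1 c = c := by
  ext x
  simp [tr_apply]

theorem tr_mul (ρ : Representation k G V) {q : ℕ} (g h : G) (c : (Fin q → G) → V) :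
    tr ρ (g * h) c = tr ρ g (tr ρ h c) := by
  ext x
  simp [tr_apply, mul_assoc]

theorem hd_tr (ρ : Representation k G V) {q : ℕ} (g : G) (c : (Fin q → G) → V) :
    hd k q (tr ρ g c) = tr ρ g (hd k q c) := by
  ext x
  simp only [hd_apply, tr_apply, map_sum, map_smul]
  rfl

/-- The full complex is acyclic. The primitive is not equivariant, since the vertex `1` is moved by
the group; this is what leaves room for cohomology. -/
theorem exists_hd_eq {q : ℕ} {c : (Fin (q + 1) → G) → V} (hc : hd k (q + 1) c = 0) :
    hd k q (cone 1 c) = c := by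
  have h := cone_hd (k := k) 1 c
  rw [hc] at h
  exact (sub_eq_zero.mp h.symm).symm

/-! ### The top cohomology of a free abelian group of rank `n` acting freely -/

section Lattice

variable (ρ : Representation k G V) {n : ℕ} (e : Fin n → G)

/-- The cochains which are fixed by the first `i` elements of the family `e`. -/
def fixedBy (i q : ℕ) : Submodule k ((Fin q → G) → V) where
  carrier := {c | ∀ j : Fin n, (j : ℕ) < i → tr ρ (e j) c = c}
  zero_mem' := fun j _ => map_zero _
  add_mem' := fun ha hb j hj => by rw [map_add, ha j hj, hb j hj]
  smul_mem' := fun r c hc j hj => by rw [map_smul, hc j hj]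

variable {ρ e}

theorem hd_mem_fixedBy {i q : ℕ} {c : (Fin q → G) → V} (hc : c ∈ fixedBy ρ e i q) :
    hd k q c ∈ fixedBy ρ e i (q + 1) := fun j hj => by rw [← hd_tr, hc j hj]

theorem tr_mem_fixedBy (hcomm : ∀ i j, Commute (e i) (e j)) {i q : ℕ} {c : (Fin q → G) → V}
    (hc : c ∈ fixedBy ρ e i q) (l : Fin n) : tr ρ (e l) c ∈ fixedBy ρ e i q := fun j hj => by
  rw [← tr_mul, (hcomm j l).eq, tr_mul, hc j hj]

theorem mem_fixedBy_succ {i : Fin n} {q : ℕ} {c : (Fin q → G) → V} :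
    c ∈ fixedBy ρ e (i + 1) q ↔ c ∈ fixedBy ρ e i q ∧ tr ρ (e i) c = c := by
  refine ⟨fun h => ⟨fun j hj => h j (by omega), h i (by omega)⟩, fun h j hj => ?_⟩
  rcases Nat.lt_succ_iff_lt_or_eq.mp hj with h1 | h1
  · exact h.1 j h1
  · rw [Fin.ext h1]
    exact h.2

/-- The sum of a function over the integers from `0` to `m - 1`, counted with sign. -/
noncomputable def intSum {A : Type*} [AddCommGroup A] (f : ℤ → A) (m : ℤ) : A :=
  ∑ l ∈ Finset.Ico 0 m, f l - ∑ l ∈ Finset.Ico m 0, f l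

theorem intSum_add_one {A : Type*} [AddCommGroup A] (f : ℤ → A) (m : ℤ) :
    intSum f (m + 1) = intSum f m + f m := by
  unfold intSum
  rcases le_or_gt 0 m with h | h
  · rw [Finset.Ico_eq_empty (a := m) (by omega), Finset.Ico_eq_empty (a := m + 1) (by omega),
      show Finset.Ico 0 (m + 1) = insert m (Finset.Ico 0 m) by
        ext x
        simp only [Finset.mem_insert, Finset.mem_Ico]
        omega, Finset.sum_insert (by simp)]
    simp [add_comm]
  · rw [Finset.Ico_eq_empty (b := m) (by omega), Finset.Ico_eq_empty (b := m + 1) (by omega)]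
    have : Finset.Ico m 0 = insert m (Finset.Ico (m + 1) 0) := by
      ext x
      simp only [Finset.mem_insert, Finset.mem_Ico]
      omega
    rw [this, Finset.sum_insert (by simp)]
    simp

theorem intSum_shift {A : Type*} [AddCommGroup A] (f : ℤ → A) (m : ℤ) :
    intSum (fun l => f (l + 1)) m = intSum f (m + 1) - f 0 := by
  induction m using Int.induction_on with
  | zero => rw [intSum_add_one]; simp [intSum]
  | succ m ih => rw [intSum_add_one, intSum_add_one f, ih]; abel
  | pred m ih =>
    have h1 := intSum_add_one (fun l => f (l + 1)) (-(m : ℤ) - 1)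
    have h2 := intSum_add_one f (-(m : ℤ) - 1 + 1)
    rw [sub_add_cancel] at h1 h2
    rw [ih] at h1
    rw [h2] at h1
    rw [sub_add_cancel]
    have := eq_sub_of_add_eq h1.symm
    rw [this]
    abel

theorem map_intSum {A B : Type*} [AddCommGroup A] [AddCommGroup B] (φ : A →+ B) (f : ℤ → A)
    (m : ℤ) : φ (intSum f m) = intSum (fun l => φ (f l)) m := by
  simp [intSum]

/-- The family `m` records the exponents of the elements `e` in a free left action: they are
the coordinates of a retraction of `G` onto the subgroup generated by `e`. -/
def IsExponent (e : Fin n → G) (m : Fin n → G → ℤ) : Prop :=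
  ∀ i j x, m i (e j * x) = m i x + if i = j then 1 else 0

variable {m : Fin n → G → ℤ}

theorem IsExponent.inv (hm : IsExponent e m) (i j : Fin n) (x : G) :
    m i ((e j)⁻¹ * x) = m i x - if i = j then 1 else 0 := by
  have := hm i j ((e j)⁻¹ * x)
  rw [mul_inv_cancel_left] at this
  rw [this]
  ring

/-- The difference equation `(e_i - 1) y = c` is solved by a telescoping sum of translates of `c`
along the `e_i`-orbit, with the exponent of the first vertex as upper limit. Solvability needs at
least one vertex. The elements before `e_i` do not change this exponent and commute with `e_i`, so
`y` stays fixed by them. -/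
theorem exists_tr_sub_eq (hcomm : ∀ i j, Commute (e i) (e j)) (hm : IsExponent e m) (i : Fin n)
    {q : ℕ} {c : (Fin (q + 1) → G) → V} (hc : c ∈ fixedBy ρ e i (q + 1)) :
    ∃ y ∈ fixedBy ρ e i (q + 1), tr ρ (e i) y - y = c := by
  refine ⟨fun x => -intSum (fun l => tr ρ (e i ^ l) c x) (m i (x 0)), fun j hj => ?_, ?_⟩
  · ext x
    rw [tr_apply, map_neg, neg_inj, ← LinearMap.toAddMonoidHom_coe, map_intSum]
    rw [hm.inv, if_neg (by rintro rfl; omega), sub_zero]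
    congr 1
    ext l
    have : tr ρ (e i ^ l) c x = tr ρ (e j) (tr ρ (e i ^ l) c) x := by
      rw [← tr_mul, ((hcomm j i).zpow_right l).eq, tr_mul, hc j hj]
    rw [this]
    rfl
  · ext x
    rw [Pi.sub_apply, tr_apply, map_neg, ← LinearMap.toAddMonoidHom_coe, map_intSum, hm.inv, if_pos rfl]
    have : (fun l : ℤ => (ρ (e i)).toAddMonoidHom (tr ρ (e i ^ l) c fun t => (e i)⁻¹ * x t)) =
        fun l : ℤ => (fun l : ℤ => tr ρ (e i ^ l) c x) (l + 1) := by
      ext l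
      have : tr ρ (e i ^ (l + 1)) c x = tr ρ (e i) (tr ρ (e i ^ l) c) x := by
        rw [← tr_mul, add_comm l, zpow_add, zpow_one]
      exact this.symm
    rw [this, intSum_shift (fun l : ℤ => tr ρ (e i ^ l) c x)]
    simp [tr_one]

/-- Let `C_i` be the subcomplex fixed by the first `i` elements. By `exists_tr_sub_eq` there is a
short exact sequence `0 → C_{i+1} → C_i → C_i → 0` with second map `e_i - 1`, so each further
generator raises the cohomological dimension by at most one. -/
theorem fixedBy_acyclic (hcomm : ∀ i j, Commute (e i) (e j)) (hm : IsExponent e m) (i : ℕ)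
    (hi : i ≤ n) :
    ∀ q, i < q → ∀ c ∈ fixedBy ρ e i (q + 1), hd k (q + 1) c = 0 →
      ∃ b ∈ fixedBy ρ e i q, hd k q b = c := by
  induction i with
  | zero => exact fun q _ c _ hc => ⟨cone 1 c, fun j hj => absurd hj (by omega), exists_hd_eq hc⟩
  | succ i ih =>
    intro q hq c hc hdc
    have hc' := (mem_fixedBy_succ (i := ⟨i, hi⟩)).mp hc
    obtain ⟨y, hy, rfl⟩ := ih (by omega) q (by omega) c hc'.1 hdc
    obtain ⟨q, rfl⟩ : ∃ q', q = q' + 1 + 1 := ⟨q - 2, by omega⟩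
    have hz : hd k _ (tr ρ (e ⟨i, hi⟩) y - y) = 0 := by
      rw [map_sub, hd_tr, hc'.2, sub_self]
    obtain ⟨b, hb, hbz⟩ := ih (by omega) (q + 1) (by omega) _
      (Submodule.sub_mem _ (tr_mem_fixedBy hcomm hy _) hy) hz
    obtain ⟨b', hb', rfl⟩ := exists_tr_sub_eq hcomm hm ⟨i, hi⟩ hb
    -- The primitive `y` fails to be fixed by `e_i` by the coboundary of `(e_i - 1) b'`; subtracting
    -- the coboundary of `b'` repairs this without changing `hd y`.
    refine ⟨y - hd k _ b', (mem_fixedBy_succ (i := ⟨i, hi⟩)).mpr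
      ⟨Submodule.sub_mem _ hy (hd_mem_fixedBy hb'), ?_⟩, by rw [map_sub, hd_hd, sub_zero]⟩
    rw [map_sub, ← hd_tr]
    rw [map_sub] at hbz
    rw [← sub_eq_zero, ← neg_eq_zero, ← sub_eq_zero.mpr hbz]
    abel

variable (ρ e) in
/-- The iterated connecting homomorphism from `V` to the cohomology of degree `i` of the cochains
fixed by the first `i` elements of `e`, as a linear relation with cocycles. -/
def transgression : ∀ i : ℕ, i ≤ n → Submodule k (V × ((Fin (i + 1) → G) → V))
  | 0, _ => LinearMap.range (LinearMap.prod LinearMap.id (LinearMap.pi fun _ => LinearMap.id))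
  | i + 1, hi => ((transgression i (Nat.le_of_succ_le hi)).comap (LinearMap.prodMap LinearMap.id
      (tr ρ (e ⟨i, hi⟩) - LinearMap.id)) ⊓ (fixedBy ρ e i (i + 1)).comap (LinearMap.snd k _ _)).map
        (LinearMap.prodMap LinearMap.id (hd k (i + 1)))

theorem mem_transgression_zero {v : V} {c : (Fin 1 → G) → V} :
    (v, c) ∈ transgression ρ e 0 (Nat.zero_le n) ↔ c = fun _ => v := by
  constructor
  · rintro ⟨w, hw⟩
    rw [Prod.ext_iff] at hw
    obtain ⟨rfl, rfl⟩ := hw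
    rfl
  · rintro rfl
    exact ⟨v, rfl⟩

theorem mem_transgression_succ {i : ℕ} {hi : i + 1 ≤ n} {v : V} {c : (Fin (i + 2) → G) → V} :
    (v, c) ∈ transgression ρ e (i + 1) hi ↔ ∃ y ∈ fixedBy ρ e i (i + 1),
      (v, tr ρ (e ⟨i, hi⟩) y - y) ∈ transgression ρ e i (Nat.le_of_succ_le hi) ∧
        hd k (i + 1) y = c := by
  constructor
  · rintro ⟨⟨w, y⟩, ⟨h1, h2⟩, h⟩
    rw [Prod.ext_iff] at h
    obtain ⟨rfl, rfl⟩ := h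
    exact ⟨y, h2, h1, rfl⟩
  · rintro ⟨y, h1, h2, rfl⟩
    exact ⟨(v, y), ⟨h2, h1⟩, rfl⟩

theorem isCocycle_of_mem_transgression {i : ℕ} {hi : i ≤ n} {v : V} {c : (Fin (i + 1) → G) → V}
    (h : (v, c) ∈ transgression ρ e i hi) : c ∈ fixedBy ρ e i (i + 1) ∧ hd k (i + 1) c = 0 := by
  induction i generalizing v with
  | zero =>
    rw [mem_transgression_zero] at h
    subst h
    refine ⟨fun j hj => absurd hj (by omega), ?_⟩
    ext x
    simp [hd_apply, Fin.sum_univ_two]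
  | succ i ih =>
    rw [mem_transgression_succ] at h
    obtain ⟨y, hy, h, rfl⟩ := h
    refine ⟨(mem_fixedBy_succ (i := ⟨i, hi⟩)).mpr ⟨hd_mem_fixedBy hy, ?_⟩, hd_hd y⟩
    have := (ih h).2
    rwa [map_sub, hd_tr, sub_eq_zero] at this

/-- The connecting map is onto because the middle term `C_i` of the short exact sequence has no
cohomology in degree `i + 1`. -/
theorem exists_mem_transgression (hcomm : ∀ i j, Commute (e i) (e j)) (hm : IsExponent e m)
    {i : ℕ} {hi : i ≤ n} {c : (Fin (i + 1) → G) → V}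
    (hc : c ∈ fixedBy ρ e i (i + 1)) (hdc : hd k (i + 1) c = 0) :
    ∃ v, (v, c) ∈ transgression ρ e i hi := by
  induction i with
  | zero =>
    refine ⟨cone 1 c default, mem_transgression_zero.mpr ?_⟩
    conv_lhs => rw [← exists_hd_eq hdc]
    ext x
    simp [hd_apply, Subsingleton.elim (x ∘ _) default]
  | succ i ih =>
    have hc' := (mem_fixedBy_succ (i := ⟨i, hi⟩)).mp hc
    obtain ⟨y, hy, rfl⟩ := fixedBy_acyclic hcomm hm i (by omega) (i + 1) (by omega) c hc'.1 hdc
    have hz : hd k _ (tr ρ (e ⟨i, hi⟩) y - y) = 0 := by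
      rw [map_sub, hd_tr, hc'.2, sub_self]
    obtain ⟨v, hv⟩ := ih (hi := Nat.le_of_succ_le hi)
      (Submodule.sub_mem _ (tr_mem_fixedBy hcomm hy _) hy) hz
    exact ⟨v, mem_transgression_succ.mpr ⟨y, hy, hv, rfl⟩⟩

theorem transgression_total (hcomm : ∀ i j, Commute (e i) (e j)) (hm : IsExponent e m)
    {i : ℕ} {hi : i ≤ n} (v : V) : ∃ c, (v, c) ∈ transgression ρ e i hi := by
  induction i with
  | zero => exact ⟨_, mem_transgression_zero.mpr rfl⟩
  | succ i ih =>
    obtain ⟨z, hz⟩ := ih (hi := Nat.le_of_succ_le hi)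
    obtain ⟨y, hy, rfl⟩ := exists_tr_sub_eq hcomm hm ⟨i, hi⟩ (isCocycle_of_mem_transgression hz).1
    exact ⟨_, mem_transgression_succ.mpr ⟨y, hy, hz, rfl⟩⟩

/-- Used with `i = n`, where `c` itself is fixed by `e j`: subtracting then relates `ρ (e j) v - v`
to the zero cochain, so the relation factors through coinvariants. -/
theorem transgression_equivariant (hcomm : ∀ i j, Commute (e i) (e j))
    {i : ℕ} {hi : i ≤ n} {v : V} {c : (Fin (i + 1) → G) → V}
    (h : (v, c) ∈ transgression ρ e i hi) (j : Fin n) :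
    (ρ (e j) v, tr ρ (e j) c) ∈ transgression ρ e i hi := by
  induction i generalizing v with
  | zero =>
    rw [mem_transgression_zero] at h ⊢
    subst h
    rfl
  | succ i ih =>
    rw [mem_transgression_succ] at h ⊢
    obtain ⟨y, hy, h, rfl⟩ := h
    refine ⟨tr ρ (e j) y, tr_mem_fixedBy hcomm hy j, ?_, hd_tr _ _ _⟩
    rw [← tr_mul, (hcomm _ j).eq, tr_mul, ← map_sub]
    exact ih h

/-- This makes the relation a well-defined map into cohomology: a cocycle attached to `0` is a
coboundary of a cochain with the same invariance. -/
theorem exists_hd_eq_of_transgression_zero (hcomm : ∀ i j, Commute (e i) (e j))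
    (hm : IsExponent e m) {i : ℕ} {hi : i ≤ n} {c : (Fin (i + 1) → G) → V}
    (h : (0, c) ∈ transgression ρ e i hi) :
    ∃ b ∈ fixedBy ρ e i i, hd k i b = c ∧ (i = 0 → b = 0) := by
  induction i with
  | zero =>
    rw [mem_transgression_zero] at h
    subst h
    exact ⟨0, Submodule.zero_mem _, map_zero _, fun _ => rfl⟩
  | succ i ih =>
    rw [mem_transgression_succ] at h
    obtain ⟨y, hy, h, rfl⟩ := h
    obtain ⟨b, hb, hbz, hb0⟩ := ih h
    obtain ⟨b', hb', rfl⟩ : ∃ b' ∈ fixedBy ρ e i i, tr ρ (e ⟨i, hi⟩) b' - b' = b := by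
      -- For `i = 0` the primitive lives on empty tuples, where `exists_tr_sub_eq` is not available;
      -- the last clause of the induction says that it is zero there.
      rcases i with _ | i
      · exact ⟨0, Submodule.zero_mem _, by rw [hb0 rfl]; simp⟩
      · exact exists_tr_sub_eq hcomm hm ⟨i + 1, hi⟩ hb
    refine ⟨y - hd k _ b', (mem_fixedBy_succ (i := ⟨i, hi⟩)).mpr
      ⟨Submodule.sub_mem _ hy (hd_mem_fixedBy hb'), ?_⟩, by rw [map_sub, hd_hd, sub_zero],
      by omega⟩
    rw [map_sub, ← hd_tr]
    rw [map_sub] at hbz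
    rw [← sub_eq_zero, ← neg_eq_zero, ← sub_eq_zero.mpr hbz]
    abel

theorem exists_hd_eq_of_mem_span (hcomm : ∀ i j, Commute (e i) (e j))
    (hm : IsExponent e m) {v : V} {c : (Fin (n + 1) → G) → V}
    (h : (v, c) ∈ transgression ρ e n le_rfl)
    (hv : v ∈ Submodule.span k {w | ∃ j u, ρ (e j) u - u = w}) :
    ∃ b ∈ fixedBy ρ e n n, hd k n b = c := by
  have key : Submodule.span k {w | ∃ j u, ρ (e j) u - u = w} ≤
      (transgression ρ e n le_rfl).comap (LinearMap.inl k V ((Fin (n + 1) → G) → V)) := by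
    rw [Submodule.span_le]
    rintro _ ⟨j, u, rfl⟩
    obtain ⟨c', hc'⟩ := transgression_total (ρ := ρ) hcomm hm (hi := le_rfl) u
    have h1 := Submodule.sub_mem _ (transgression_equivariant hcomm hc' j) hc'
    rw [Prod.mk_sub_mk, (isCocycle_of_mem_transgression hc').1 j j.2, sub_self] at h1
    exact h1
  have h1 := Submodule.sub_mem _ h (key hv)
  rw [LinearMap.inl_apply, Prod.mk_sub_mk, sub_self, sub_zero] at h1
  obtain ⟨b, hb, hbc, -⟩ := exists_hd_eq_of_transgression_zero hcomm hm h1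
  exact ⟨b, hb, hbc⟩

/-- If the coinvariants have dimension at most `dim W` and a space of cocycles of dimension
`dim W` injects into cohomology, then it represents all of the top cohomology. -/
theorem exists_eq_add_hd (hcomm : ∀ i j, Commute (e i) (e j)) (hm : IsExponent e m)
    {U W : Type*} [AddCommGroup U] [Module k U] [AddCommGroup W] [Module k W]
    [FiniteDimensional k U] [FiniteDimensional k W]
    (hUW : Module.finrank k U = Module.finrank k W) (l : V →ₗ[k] W)
    (hl : LinearMap.ker l ≤ Submodule.span k {w | ∃ j u, ρ (e j) u - u = w})
    (Φ : U →ₗ[k] ((Fin (n + 1) → G) → V)) (hΦ : ∀ u, Φ u ∈ fixedBy ρ e n (n + 1))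
    (hdΦ : ∀ u, hd k (n + 1) (Φ u) = 0)
    (hinj : ∀ u, ∀ b ∈ fixedBy ρ e n n, hd k n b = Φ u → u = 0)
    {c : (Fin (n + 1) → G) → V} (hc : c ∈ fixedBy ρ e n (n + 1)) (hdc : hd k (n + 1) c = 0) :
    ∃ u, ∃ b ∈ fixedBy ρ e n n, c = Φ u + hd k n b := by
  set B := (fixedBy ρ e n n).map (hd k n) with hB
  set R := transgression ρ e n le_rfl
  let f : R →ₗ[k] W := l ∘ₗ LinearMap.fst k _ _ ∘ₗ R.subtype
  let g : R →ₗ[k] (((Fin (n + 1) → G) → V) ⧸ B) := B.mkQ ∘ₗ LinearMap.snd k _ _ ∘ₗ R.subtype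
  -- Both maps are defined on the relation `R`: `f` reads the image of `v` in `W`, and `g` reads the
  -- class of the cocycle. As `f` determines `g`, the classes reached span a space of dimension at
  -- most `dim W`.
  have hfg : LinearMap.ker f ≤ LinearMap.ker g := by
    rintro ⟨⟨v, c⟩, h⟩ hv
    rw [LinearMap.mem_ker] at hv ⊢
    exact (Submodule.Quotient.mk_eq_zero B).mpr
      (exists_hd_eq_of_mem_span hcomm hm h (hl hv))
  obtain ⟨s, hs⟩ := f.rangeRestrict.exists_rightInverse_of_surjective f.range_rangeRestrict
  have hgs : LinearMap.range g = LinearMap.range (g ∘ₗ s) := by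
    refine le_antisymm ?_ (LinearMap.range_comp_le_range _ _)
    rintro _ ⟨r, rfl⟩
    refine ⟨f.rangeRestrict r, ?_⟩
    have h1 : s (f.rangeRestrict r) - r ∈ LinearMap.ker f := by
      rw [LinearMap.mem_ker, map_sub, sub_eq_zero]
      have := LinearMap.congr_fun hs (f.rangeRestrict r)
      exact congrArg Subtype.val this
    have h2 := hfg h1
    rwa [LinearMap.mem_ker, map_sub, sub_eq_zero] at h2
  have hle : LinearMap.range (B.mkQ ∘ₗ Φ) ≤ LinearMap.range g := by
    rintro _ ⟨u, rfl⟩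
    obtain ⟨v, hv⟩ := exists_mem_transgression hcomm hm (hi := le_rfl) (hΦ u) (hdΦ u)
    exact ⟨⟨(v, Φ u), hv⟩, rfl⟩
  have hker : Function.Injective (B.mkQ ∘ₗ Φ) := by
    rw [← LinearMap.ker_eq_bot, LinearMap.ker_eq_bot']
    intro u hu
    obtain ⟨b, hb, hbu⟩ := (Submodule.Quotient.mk_eq_zero B).mp hu
    exact hinj u b hb hbu
  have hfin : FiniteDimensional k (LinearMap.range g) := by
    rw [hgs]
    infer_instance
  -- The classes of `Φ` already fill dimension `dim U = dim W`, so they exhaust the range of `g`.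
  have heq : LinearMap.range (B.mkQ ∘ₗ Φ) = LinearMap.range g := by
    refine Submodule.eq_of_le_of_finrank_le hle ?_
    rw [LinearMap.finrank_range_of_inj hker, hUW, hgs]
    exact (LinearMap.finrank_range_le _).trans (Submodule.finrank_le _)
  obtain ⟨v, hv⟩ := exists_mem_transgression hcomm hm (hi := le_rfl) hc hdc
  have : B.mkQ c ∈ LinearMap.range (B.mkQ ∘ₗ Φ) := heq ▸ ⟨⟨(v, c), hv⟩, rfl⟩
  obtain ⟨u, hu⟩ := this
  obtain ⟨b, hb, hbu⟩ := (Submodule.Quotient.eq B).mp hu.symm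
  exact ⟨u, b, hb, by rw [hbu]; abel⟩

end Lattice

end HomCochain

namespace HomCochain

open Equiv

/-! ### The fundamental cycle of a torus -/

section FundamentalCycle

variable {G : Type*} [Group G]

/-- The evaluation of a cochain on the fundamental cycle of the torus with commuting generators
`e`, decomposed into `n!` simplices. -/
noncomputable def torusEval {n : ℕ} (e : Fin n → G) (f : (Fin (n + 1) → G) → ℝ) : ℝ :=
  ∑ σ : Perm (Fin n), ((Perm.sign σ : ℤ) : ℝ) * f (Fin.partialProd (e ∘ σ))

theorem contractNth_comp_swap {m : ℕ} (g : Fin (m + 1) → G) (hg : ∀ i j, Commute (g i) (g j))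
    (a : Fin m) :
    Fin.contractNth a.castSucc (· * ·) (g ∘ swap a.castSucc a.succ) =
      Fin.contractNth a.castSucc (· * ·) g := by
  ext k
  have hne : ∀ l : Fin (m + 1), l ≠ a.castSucc → l ≠ a.succ →
      swap a.castSucc a.succ l = l := fun l h1 h2 => swap_apply_of_ne_of_ne h1 h2
  rcases lt_trichotomy (k : ℕ) (a : ℕ) with h | h | h
  · rw [Fin.contractNth_apply_of_lt _ _ _ _ h, Fin.contractNth_apply_of_lt _ _ _ _ h,
      Function.comp_apply, hne]
    · simp only [ne_eq, Fin.ext_iff, Fin.val_castSucc]; omega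
    · simp only [ne_eq, Fin.ext_iff, Fin.val_castSucc, Fin.val_succ]; omega
  · obtain rfl : k = a := Fin.ext h
    rw [Fin.contractNth_apply_of_eq _ _ _ _ rfl, Fin.contractNth_apply_of_eq _ _ _ _ rfl,
      Function.comp_apply, Function.comp_apply, swap_apply_left, swap_apply_right]
    exact hg _ _
  · rw [Fin.contractNth_apply_of_gt _ _ _ _ h, Fin.contractNth_apply_of_gt _ _ _ _ h,
      Function.comp_apply, hne]
    · simp only [ne_eq, Fin.ext_iff, Fin.val_castSucc, Fin.val_succ]; omega
    · simp only [ne_eq, Fin.ext_iff, Fin.val_succ]; omega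

/-- The chain is a cycle modulo translation. Inner faces cancel in pairs under adjacent
transpositions, because the generators commute; the first and last faces are identified by a
translation and a cyclic rotation of the generators. -/
theorem torusEval_hd {m : ℕ} (e : Fin (m + 1) → G) (hcomm : ∀ i j, Commute (e i) (e j))
    (b : (Fin (m + 1) → G) → ℝ) (hb : ∀ j x, b (fun i => e j * x i) = b x) :
    torusEval e (hd ℝ (m + 1) b) = 0 := by
  set s : Perm (Fin (m + 1)) → ℝ := fun σ => ((Perm.sign σ : ℤ) : ℝ) with hs
  have hmul : ∀ σ τ, s (σ * τ) = s σ * s τ := fun σ τ => by simp [hs]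
  set T := ∑ σ : Perm (Fin (m + 1)), s σ * b (Fin.partialProd (Fin.tail (e ∘ σ))) with hT
  have h0 : ∀ σ : Perm (Fin (m + 1)), b (Fin.partialProd (e ∘ σ) ∘ (0 : Fin (m + 2)).succAbove) =
      b (Fin.partialProd (Fin.tail (e ∘ σ))) := fun σ => by
    rw [← hb (σ 0) (Fin.partialProd (Fin.tail (e ∘ σ)))]
    congr 1
    ext i
    rw [Function.comp_apply, Fin.zero_succAbove, Fin.partialProd_succ']
    rfl
  have hlast : ∑ σ : Perm (Fin (m + 1)),
      s σ * b (Fin.partialProd (Fin.init (e ∘ σ))) = (-1) ^ m * T := by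
    rw [← Equiv.sum_comp (Equiv.mulRight (finRotate (m + 1))), hT, Finset.mul_sum]
    refine Finset.sum_congr rfl fun σ _ => ?_
    rw [coe_mulRight, hmul]
    have h1 : s (finRotate (m + 1)) = (-1) ^ m := by
      simp [hs, sign_finRotate]
    have h2 : (Fin.init (e ∘ (σ * finRotate (m + 1) : Perm _)) : Fin m → G) =
        Fin.tail (e ∘ σ) := by
      ext i
      simp [Fin.init, Fin.tail]
    rw [h1, h2]
    ring
  have hmid : ∀ a : Fin m, ∑ σ : Perm (Fin (m + 1)),
      s σ * b (Fin.partialProd (Fin.contractNth a.castSucc (· * ·) (e ∘ σ))) = 0 := fun a => by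
    have h := Equiv.sum_comp (Equiv.mulRight (swap a.castSucc a.succ)) fun σ : Perm (Fin (m + 1)) =>
      s σ * b (Fin.partialProd (Fin.contractNth a.castSucc (· * ·) (e ∘ σ)))
    have h2 : ∀ σ : Perm (Fin (m + 1)),
        s (Equiv.mulRight (swap a.castSucc a.succ) σ) * b (Fin.partialProd (Fin.contractNth
          a.castSucc (· * ·) (e ∘ (Equiv.mulRight (swap a.castSucc a.succ) σ)))) =
        -(s σ * b (Fin.partialProd (Fin.contractNth a.castSucc (· * ·) (e ∘ σ)))) := fun σ => by
      rw [coe_mulRight, hmul, Perm.coe_mul, ← Function.comp_assoc,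
        contractNth_comp_swap (e ∘ σ) fun _ _ => hcomm _ _]
      have : s (swap a.castSucc a.succ) = -1 := by
        simp [hs, Perm.sign_swap (Fin.castSucc_lt_succ (i := a)).ne]
      rw [this]
      ring
    rw [Finset.sum_congr rfl fun σ _ => h2 σ, Finset.sum_neg_distrib] at h
    linarith
  have hcl : ∀ g : Fin (m + 1) → G,
      Fin.contractNth (Fin.last m) (· * ·) g = Fin.init g := fun g => by
    ext i
    rw [Fin.contractNth_apply_of_lt _ _ _ _ (by simp)]
    rfl
  have hexp : ∀ σ : Perm (Fin (m + 1)), s σ * hd ℝ (m + 1) b (Fin.partialProd (e ∘ σ)) =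
      s σ * b (Fin.partialProd (Fin.tail (e ∘ σ))) +
      (∑ a : Fin m, (-1 : ℝ) ^ ((a : ℕ) + 1) *
        (s σ * b (Fin.partialProd (Fin.contractNth a.castSucc (· * ·) (e ∘ σ)))) +
      (-1) ^ (m + 1) * (s σ * b (Fin.partialProd (Fin.init (e ∘ σ))))) := fun σ => by
    rw [hd_apply, Fin.sum_univ_succ, h0, Fin.sum_univ_castSucc, mul_add, mul_add, Finset.mul_sum]
    simp only [← Fin.partialProd_contractNth, hcl, smul_eq_mul]
    congr 1
    · simp
    congr 1
    · refine Finset.sum_congr rfl fun a _ => ?_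
      rw [Fin.val_succ, Fin.val_castSucc]
      ring
    · rw [Fin.val_succ, Fin.val_last]
      ring
  change ∑ σ : Perm (Fin (m + 1)), s σ * hd ℝ (m + 1) b (Fin.partialProd (e ∘ σ)) = 0
  rw [Finset.sum_congr rfl fun σ _ => hexp σ, Finset.sum_add_distrib, Finset.sum_add_distrib,
    Finset.sum_comm, ← Finset.mul_sum, hlast]
  simp only [← Finset.mul_sum, hmid, mul_zero, Finset.sum_const_zero, zero_add]
  -- The last face carries the sign `(-1)^(m+1)` and the rotation contributes `(-1)^m`, so it enters
  -- as `-T` and cancels the first face.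
  rw [← hT, ← mul_assoc, ← pow_add, (show Odd (m + 1 + m) from ⟨m, by ring⟩).neg_one_pow]
  ring

end FundamentalCycle

/-! ### Exponent functions from coset representatives -/

section Exponent

variable {G : Type*} [Group G] {n : ℕ}

/-- A choice of right coset representatives splits `x` as an element of `H` times a representative.
Left multiplication by `e j` changes only the first factor, on which the homomorphism `κ i` counts.
-/
theorem exists_isExponent (H : Subgroup G) (e : Fin n → G) (he : ∀ j, e j ∈ H)
    (κ : Fin n → H → ℤ) (hκ : ∀ i a b, κ i (a * b) = κ i a + κ i b)
    (hκe : ∀ i j, κ i ⟨e j, he j⟩ = if i = j then 1 else 0) :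
    ∃ m : Fin n → G → ℤ, IsExponent e m := by
  let r : G → G := fun x => (Quotient.mk (QuotientGroup.rightRel H) x).out
  have hr : ∀ x, x * (r x)⁻¹ ∈ H := fun x => by
    have h := Quotient.mk_out (s := QuotientGroup.rightRel H) x
    exact QuotientGroup.rightRel_apply.mp h
  have hre : ∀ j x, r (e j * x) = r x := fun j x => by
    have h : Quotient.mk (QuotientGroup.rightRel H) (e j * x) =
        Quotient.mk (QuotientGroup.rightRel H) x := by
      refine Quotient.sound (QuotientGroup.rightRel_apply.mpr ?_)
      rw [mul_inv_rev, mul_inv_cancel_left]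
      exact H.inv_mem (he j)
    exact congrArg Quotient.out h
  refine ⟨fun i x => κ i ⟨x * (r x)⁻¹, hr x⟩, fun i j x => ?_⟩
  have h : (⟨e j * x * (r (e j * x))⁻¹, hr _⟩ : H) = ⟨e j, he j⟩ * ⟨x * (r x)⁻¹, hr x⟩ := by
    ext
    simp [hre, mul_assoc]
  change κ i ⟨e j * x * (r (e j * x))⁻¹, hr _⟩ = _
  rw [h, hκ, hκe, add_comm]

end Exponent

/-! ### Averaging over a subgroup of finite index -/

section Average

variable {G V : Type*} [Group G] [AddCommGroup V] [Module ℝ V] (ρ : Representation ℝ G V)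
  (H : Subgroup G) [H.FiniteIndex] {q : ℕ}

noncomputable instance : Fintype (G ⧸ H) := Fintype.ofFinite _

/-- The average of the translates of a cochain over the cosets of a subgroup. -/
noncomputable def average : ((Fin q → G) → V) →ₗ[ℝ] ((Fin q → G) → V) :=
  (Fintype.card (G ⧸ H) : ℝ)⁻¹ • ∑ x : G ⧸ H, tr ρ x.out

theorem average_apply (c : (Fin q → G) → V) :
    average ρ H c = (Fintype.card (G ⧸ H) : ℝ)⁻¹ • ∑ x : G ⧸ H, tr ρ x.out c := by
  simp [average]

variable {ρ H}

/-- Left multiplication by `g` permutes the cosets and changes each chosen representative by an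
element of `H`, which does not move `c`. -/
theorem tr_average {c : (Fin q → G) → V} (hc : ∀ h ∈ H, tr ρ h c = c) (g : G) :
    tr ρ g (average ρ H c) = average ρ H c := by
  rw [average_apply, map_smul, map_sum]
  congr 1
  rw [← Equiv.sum_comp (MulAction.toPerm g : Perm (G ⧸ H)) fun x => tr ρ x.out c]
  refine Finset.sum_congr rfl fun x _ => ?_
  rw [MulAction.toPerm_apply]
  have h : (g * x.out)⁻¹ * (g • x).out ∈ H := by
    rw [← QuotientGroup.eq, QuotientGroup.out_eq', ← smul_eq_mul, ← MulAction.Quotient.smul_mk,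
      QuotientGroup.out_eq']
  have h2 : (g • x).out = g * x.out * ((g * x.out)⁻¹ * (g • x).out) := by group
  rw [h2, tr_mul _ (g * x.out), hc _ h, tr_mul]

theorem average_hd (c : (Fin q → G) → V) :
    average ρ H (hd ℝ q c) = hd ℝ q (average ρ H c) := by
  simp only [average_apply, map_smul, map_sum, hd_tr]

theorem average_eq_self {c : (Fin q → G) → V} (hc : ∀ g, tr ρ g c = c) : average ρ H c = c := by
  have h : (Fintype.card (G ⧸ H) : ℝ) ≠ 0 := Nat.cast_ne_zero.mpr Fintype.card_ne_zero
  rw [average_apply, Finset.sum_congr rfl fun x _ => hc _, Finset.sum_const, Finset.card_univ,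
    ← Nat.cast_smul_eq_nsmul ℝ, smul_smul, inv_mul_cancel₀ h, one_smul]

theorem average_mem {S : Submodule ℝ ((Fin q → G) → V)} {c : (Fin q → G) → V}
    (hS : ∀ g, tr ρ g c ∈ S) : average ρ H c ∈ S := by
  rw [average_apply]
  exact S.smul_mem _ (S.sum_mem fun x _ => hS _)

theorem tr_eq_of_mem_closure {n : ℕ} {e : Fin n → G} {c : (Fin q → G) → V}
    (hc : c ∈ fixedBy ρ e n q) {h : G} (hh : h ∈ Subgroup.closure (Set.range e)) :
    tr ρ h c = c := by
  induction hh using Subgroup.closure_induction with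
  | mem x hx =>
    obtain ⟨j, rfl⟩ := hx
    exact hc j j.2
  | one => exact tr_one ρ c
  | mul x y _ _ hx hy => rw [tr_mul, hy, hx]
  | inv x _ hx =>
    conv_lhs => rw [← hx, ← tr_mul, inv_mul_cancel, tr_one]

/-- The invariant version of `exists_eq_add_hd` for a group which contains the free abelian group
with generators `e` as a subgroup of finite index. -/
theorem exists_invariant_eq_add_hd {n : ℕ} {e : Fin n → G} {m : Fin n → G → ℤ}
    (hcomm : ∀ i j, Commute (e i) (e j)) (hm : IsExponent e m)
    [hfin : (Subgroup.closure (Set.range e)).FiniteIndex]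
    {U W : Type*} [AddCommGroup U] [Module ℝ U] [AddCommGroup W] [Module ℝ W]
    [FiniteDimensional ℝ U] [FiniteDimensional ℝ W]
    (hUW : Module.finrank ℝ U = Module.finrank ℝ W) (l : V →ₗ[ℝ] W)
    (hl : LinearMap.ker l ≤ Submodule.span ℝ {w | ∃ j u, ρ (e j) u - u = w})
    (Φ : U →ₗ[ℝ] ((Fin (n + 1) → G) → V)) (hΦ : ∀ u, Φ u ∈ fixedBy ρ e n (n + 1))
    (hΦG : ∀ g u, tr ρ g (Φ u) ∈ LinearMap.range Φ)
    (hdΦ : ∀ u, hd ℝ (n + 1) (Φ u) = 0)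
    (hinj : ∀ u, ∀ b ∈ fixedBy ρ e n n, hd ℝ n b = Φ u → u = 0)
    {c : (Fin (n + 1) → G) → V} (hc : ∀ g, tr ρ g c = c) (hdc : hd ℝ (n + 1) c = 0) :
    ∃ u, ∃ b : (Fin n → G) → V, (∀ g, tr ρ g (Φ u) = Φ u) ∧ (∀ g, tr ρ g b = b) ∧
      c = Φ u + hd ℝ n b := by
  obtain ⟨u, b, hb, hcb⟩ := exists_eq_add_hd hcomm hm hUW l hl Φ hΦ hdΦ hinj
    (fun j _ => hc (e j)) hdc
  -- Since the range of `Φ` is stable under `G`, the average of `Φ u` is again some `Φ u'`; `c` is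
  -- its own average, and averaging commutes with the differential.
  obtain ⟨u', hu'⟩ := average_mem (H := Subgroup.closure (Set.range e)) fun g => hΦG g u
  refine ⟨u', average ρ (Subgroup.closure (Set.range e)) b, fun g => ?_,
    tr_average fun h hh => tr_eq_of_mem_closure hb hh, ?_⟩
  · rw [hu']
    exact tr_average (fun h hh => tr_eq_of_mem_closure (hΦ u) hh) g
  · rw [hu', ← average_hd, ← map_add, ← hcb, average_eq_self hc]

end Average

/-! ### Homogeneous and inhomogeneous cochains -/

section Inhomogeneous

variable {G : Type} [Group G] (A : Rep.{0} ℝ G)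

/-- The homogeneous cochain which corresponds to an inhomogeneous one. -/
def homogenize {q : ℕ} (f : (Fin q → G) → A) (x : Fin (q + 1) → G) : A :=
  A.ρ (x 0) (f fun i => (x i.castSucc)⁻¹ * x i.succ)

variable {A}

theorem tr_homogenize {q : ℕ} (f : (Fin q → G) → A) (g : G) :
    tr A.ρ g (homogenize A f) = homogenize A f := by
  ext x
  rw [tr_apply, homogenize, homogenize, ← Module.End.mul_apply, ← map_mul, mul_inv_cancel_left]
  simp only [mul_inv_rev, inv_inv, mul_assoc, mul_inv_cancel_left]

theorem homogenize_partialProd {q : ℕ} (f : (Fin q → G) → A) (g : Fin q → G) :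
    homogenize A f (Fin.partialProd g) = f g := by
  simp only [homogenize, Fin.partialProd_zero, map_one, Fin.partialProd_right_inv,
    Module.End.one_apply]

/-- Every tuple can be translated so that it starts at `1`, and a tuple starting at `1` consists of
the partial products of its successive quotients. -/
theorem eq_of_partialProd {q : ℕ} {F F' : (Fin (q + 1) → G) → A} (hF : ∀ g, tr A.ρ g F = F)
    (hF' : ∀ g, tr A.ρ g F' = F') (h : ∀ g : Fin q → G, F (Fin.partialProd g) =
      F' (Fin.partialProd g)) : F = F' := by
  ext x
  have key : (fun i => (x 0)⁻¹ * x i) =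
      Fin.partialProd fun i : Fin q => (x i.castSucc)⁻¹ * x i.succ := by
    ext i
    have := congrFun (Fin.partialProd_left_inv x) i
    rw [← this]
    simp
  rw [← hF (x 0), ← hF' (x 0), tr_apply, tr_apply, key, h]

/-- Invariance is needed for face `0` only: it does not start at `1`, and translating it back
produces the coefficient action in the inhomogeneous formula. -/
theorem d_partialProd {q : ℕ} {F : (Fin (q + 1) → G) → A} (hF : ∀ g, tr A.ρ g F = F) :
    inhomogeneousCochains.d A q (fun g => F (Fin.partialProd g)) =
      fun g => hd ℝ (q + 1) F (Fin.partialProd g) := by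
  ext g
  rw [inhomogeneousCochains.d_hom_apply, hd_apply, Fin.sum_univ_succ (n := q + 1)]
  congr 1
  · rw [Fin.val_zero, pow_zero, one_smul]
    conv_rhs => rw [← hF (g 0), tr_apply]
    congr 2
    ext i
    rw [Function.comp_apply, Fin.zero_succAbove, Fin.partialProd_succ', inv_mul_cancel_left]
    rfl
  · refine Finset.sum_congr rfl fun j _ => ?_
    rw [Fin.partialProd_contractNth, Fin.val_succ]

end Inhomogeneous

end HomCochain

/-! ### Bieberbach's first theorem -/

namespace Bieberbach

open scoped InnerProductSpace

variable {E : Type*} [NormedAddCommGroup E] [InnerProductSpace ℝ E] [FiniteDimensional ℝ E]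

theorem exists_norm_eq_opNorm [Nontrivial E] (P : E →L[ℝ] E) :
    ∃ x, ‖x‖ = 1 ∧ ‖P x‖ = ‖P‖ := by
  have hc : IsCompact (Metric.sphere (0 : E) 1) := isCompact_sphere 0 1
  obtain ⟨x, hx, hmax⟩ := hc.exists_isMaxOn (NormedSpace.sphere_nonempty.mpr zero_le_one)
    (P.continuous.norm.continuousOn)
  have hx1 : ‖x‖ = 1 := by simpa using hx
  refine ⟨x, hx1, le_antisymm ?_ ?_⟩
  · simpa [hx1] using P.le_opNorm x
  · refine P.opNorm_le_bound (norm_nonneg _) fun y => ?_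
    rcases eq_or_ne y 0 with rfl | hy
    · simp
    have hy' : ‖y‖ ≠ 0 := norm_ne_zero_iff.mpr hy
    have h := hmax (show ‖y‖⁻¹ • y ∈ Metric.sphere (0 : E) 1 by
      simp [norm_smul, hy'])
    simp only [Set.mem_ofPred_eq, map_smul, norm_smul, norm_inv, norm_norm] at h
    rw [inv_mul_le_iff₀ (by positivity)] at h
    linarith

/-- The displacement `T - 1` of a linear isometry is a multiple of an isometry on a nonzero
invariant subspace, and strictly smaller on the orthogonal complement. -/
theorem exists_maximal_displacement (T T' : E →L[ℝ] E) (hT : ∀ x, ‖T x‖ = ‖x‖)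
    (hTT' : T * T' = 1) (hT'T : T' * T = 1) (hne : T ≠ 1) :
    ∃ (K : Submodule ℝ E) (m' : ℝ), 0 ≤ m' ∧ m' < ‖T - 1‖ ∧ (∃ u ∈ K, ‖u‖ = 1) ∧
      (∀ x ∈ K, (T - 1) x ∈ K ∧ ‖(T - 1) x‖ = ‖T - 1‖ * ‖x‖) ∧
      (∀ x ∈ Kᗮ, (T - 1) x ∈ Kᗮ ∧ ‖(T - 1) x‖ ≤ m' * ‖x‖) := by
  have h1 : ∀ x, T (T' x) = x := fun x => DFunLike.congr_fun hTT' x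
  have h2 : ∀ x, T' (T x) = x := fun x => DFunLike.congr_fun hT'T x
  have hT' : ∀ x, ‖T' x‖ = ‖x‖ := fun x => by rw [← hT, h1]
  have hinner : ∀ x y, ⟪T x, y⟫_ℝ = ⟪x, T' y⟫_ℝ := fun x y => by
    let L : E →ₗᵢ[ℝ] E := ⟨T, hT⟩
    have := L.inner_map_map x (T' y)
    rw [← this]
    exact congrArg (fun z => ⟪T x, z⟫_ℝ) (h1 y).symm
  have hnt : Nontrivial E := by
    by_contra h
    rw [not_nontrivial_iff_subsingleton] at h
    exact hne (ContinuousLinearMap.ext fun x => Subsingleton.elim _ _)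
  set m := ‖T - 1‖ with hm
  have hm0 : 0 < m := norm_pos_iff.mpr (sub_ne_zero.mpr hne)
  have hP : ∀ x, ‖(T - 1) x‖ ≤ m * ‖x‖ := fun x => (T - 1).le_opNorm x
  have hP' : ∀ x, ‖(T' - 1) x‖ ≤ m * ‖x‖ := fun x => by
    have : (T' - 1) x = -((T - 1) (T' x)) := by
      simp [h1]
    rw [this, norm_neg, ← hT' x]
    exact hP _
  have hPin : ∀ x y, ⟪(T - 1) x, y⟫_ℝ = ⟪x, (T' - 1) y⟫_ℝ := fun x y => by
    simp only [sub_apply, one_apply_eq_self, inner_sub_left, inner_sub_right, hinner]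
  -- As `T'` is the adjoint of `T`, this is the eigenspace of `(T - 1)* (T - 1)` for its top
  -- eigenvalue `m ^ 2`.
  let K : Submodule ℝ E := LinearMap.ker
    (((T' - 1) * (T - 1) - (m ^ 2) • (1 : E →L[ℝ] E) : E →L[ℝ] E) : E →ₗ[ℝ] E)
  have hK : ∀ x, x ∈ K ↔ (T' - 1) ((T - 1) x) = m ^ 2 • x := fun x => by
    rw [LinearMap.mem_ker]
    exact sub_eq_zero
  have hKn : ∀ x ∈ K, ‖(T - 1) x‖ = m * ‖x‖ := fun x hx => by
    have h3 : ‖(T - 1) x‖ ^ 2 = (m * ‖x‖) ^ 2 := by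
      rw [← real_inner_self_eq_norm_sq, hPin, (hK x).mp hx, real_inner_smul_right,
        real_inner_self_eq_norm_sq]
      ring
    exact (pow_left_inj₀ (norm_nonneg _) (by positivity) two_ne_zero).mp h3
  -- If the maximal displacement is attained at `x`, expanding the squared norm of `(T' - 1) (T - 1)
  -- x - m² x` gives at most `m⁴ - 2 m⁴ + m⁴ = 0` times `‖x‖²`.
  have hKn' : ∀ x, ‖(T - 1) x‖ = m * ‖x‖ → x ∈ K := fun x hx => by
    rw [hK, ← sub_eq_zero, ← norm_eq_zero, ← sq_eq_zero_iff]
    refine le_antisymm ?_ (sq_nonneg _)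
    rw [norm_sub_sq_real, real_inner_smul_right, real_inner_comm, ← hPin,
      real_inner_self_eq_norm_sq, norm_smul, hx]
    have h4 := hP' ((T - 1) x)
    rw [hx] at h4
    have h5 := pow_le_pow_left₀ (norm_nonneg _) h4 2
    rw [Real.norm_of_nonneg (by positivity)]
    nlinarith
  have hKT : ∀ x ∈ K, T x ∈ K := fun x hx => by
    rw [hK] at hx ⊢
    have : (T' - 1) ((T - 1) (T x)) = T ((T' - 1) ((T - 1) x)) := by
      simp [h1, h2]
    rw [this, hx, map_smul]
  have hKT' : ∀ x ∈ K, T' x ∈ K := fun x hx => by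
    rw [hK] at hx ⊢
    have : (T' - 1) ((T - 1) (T' x)) = T' ((T' - 1) ((T - 1) x)) := by
      simp [h1, h2]
    rw [this, hx, map_smul]
  obtain ⟨m', hm'0, hm'm, hm'⟩ : ∃ m' : ℝ, 0 ≤ m' ∧ m' < m ∧
      ∀ x ∈ Kᗮ, ‖(T - 1) x‖ ≤ m' * ‖x‖ := by
    by_cases hs : (Metric.sphere (0 : E) 1 ∩ (Kᗮ : Set E)).Nonempty
    · have hc : IsCompact (Metric.sphere (0 : E) 1 ∩ (Kᗮ : Set E)) :=
        (isCompact_sphere 0 1).inter_right K.isClosed_orthogonal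
      obtain ⟨y, ⟨hy, hyK⟩, hmax⟩ := hc.exists_isMaxOn hs ((T - 1).continuous.norm.continuousOn)
      have hy1 : ‖y‖ = 1 := by simpa using hy
      refine ⟨‖(T - 1) y‖, norm_nonneg _, lt_of_le_of_ne ?_ fun h => ?_, fun x hx => ?_⟩
      · simpa [hy1] using hP y
      · have hyK' : y ∈ K := hKn' y (by rw [h, hy1, mul_one])
        have : y = 0 := by
          rw [← inner_self_eq_zero (𝕜 := ℝ)]
          exact hyK y hyK'
        rw [this, norm_zero] at hy1
        exact zero_ne_one hy1
      · rcases eq_or_ne x 0 with rfl | hx0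
        · simp
        have hx' : ‖x‖ ≠ 0 := norm_ne_zero_iff.mpr hx0
        have h := hmax (show ‖x‖⁻¹ • x ∈ Metric.sphere (0 : E) 1 ∩ (Kᗮ : Set E) from
          ⟨by simp [norm_smul, hx'], Submodule.smul_mem _ _ hx⟩)
        simp only [Set.mem_ofPred_eq, map_smul, norm_smul, norm_inv, norm_norm] at h
        rw [inv_mul_le_iff₀ (by positivity)] at h
        linarith
    · refine ⟨0, le_rfl, hm0, fun x hx => ?_⟩
      rcases eq_or_ne x 0 with rfl | hx0
      · simp
      have hx' : ‖x‖ ≠ 0 := norm_ne_zero_iff.mpr hx0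
      exact absurd ⟨‖x‖⁻¹ • x, by simp [norm_smul, hx'], Submodule.smul_mem _ _ hx⟩ hs
  obtain ⟨u, hu1, hu⟩ := exists_norm_eq_opNorm (T - 1)
  refine ⟨K, m', hm'0, hm'm, ⟨u, hKn' u (by rw [hu, hu1, mul_one]), hu1⟩,
    fun x hx => ⟨K.sub_mem (hKT x hx) hx, hKn x hx⟩, fun x hx => ⟨?_, hm' x hx⟩⟩
  refine Submodule.sub_mem _ (fun y hy => ?_) hx
  change ⟪y, T x⟫_ℝ = 0
  rw [real_inner_comm, hinner, real_inner_comm]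
  exact hx _ (hKT' y hy)

/-- A discrete cocompact group of isometries of a Euclidean space, given by its linear parts `A`
and its translation parts `t`. -/
structure Crystallographic {G : Type*} [Group G] (A : G →* (E →L[ℝ] E)) (t : G → E) : Prop where
  isometry : ∀ g x, ‖A g x‖ = ‖x‖
  t_mul : ∀ g h, t (g * h) = t g + A g (t h)
  finite : ∀ R : ℝ, {g | ‖t g‖ ≤ R}.Finite
  dense : ∃ R : ℝ, ∀ x, ∃ g, ‖t g - x‖ ≤ R

namespace Crystallographic

variable {G : Type*} [Group G] {A : G →* (E →L[ℝ] E)} {t : G → E} (H : Crystallographic A t)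
include H

omit [FiniteDimensional ℝ E]

theorem norm_le_one (g : G) : ‖A g‖ ≤ 1 :=
  (A g).opNorm_le_bound zero_le_one fun x => by rw [H.isometry, one_mul]

omit H in
theorem apply_inv (g : G) (x : E) : A g (A g⁻¹ x) = x := by
  have h := map_mul A g g⁻¹
  rw [mul_inv_cancel, map_one] at h
  exact (DFunLike.congr_fun h x).symm

theorem t_one : t 1 = 0 := by
  have h := H.t_mul 1 1
  rw [mul_one, map_one, one_apply_eq_self] at h
  exact left_eq_add.mp h

theorem t_mul_inv (g h : G) : t (g * h⁻¹) = t g - A (g * h⁻¹) (t h) := by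
  have h1 := H.t_mul (g * h⁻¹) h
  rw [inv_mul_cancel_right] at h1
  rw [h1, add_sub_cancel_right]

theorem norm_mul_inv_sub_one_le (g h : G) : ‖A (g * h⁻¹) - 1‖ ≤ ‖A g - A h‖ := by
  have h1 : A (g * h⁻¹) - 1 = (A g - A h) * A h⁻¹ := by
    rw [sub_mul, ← map_mul, ← map_mul, mul_inv_cancel, map_one]
  rw [h1]
  exact (norm_mul_le _ _).trans (mul_le_of_le_one_right (norm_nonneg _) (H.norm_le_one _))

/-- Replacing `A g` and `A h` by `A g - 1` and `A h - 1` does not change their additive commutator,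
so the estimate is a product of the two small norms. -/
theorem norm_commutator_sub_one_le (g h : G) :
    ‖A (g * h * g⁻¹ * h⁻¹) - 1‖ ≤ 2 * ‖A g - 1‖ * ‖A h - 1‖ := by
  have h1 : g * h * g⁻¹ * h⁻¹ = (g * h) * (h * g)⁻¹ := by group
  rw [h1]
  refine (H.norm_mul_inv_sub_one_le _ _).trans ?_
  have h2 : A (g * h) - A (h * g) = (A g - 1) * (A h - 1) - (A h - 1) * (A g - 1) := by
    rw [map_mul, map_mul]
    noncomm_ring
  rw [h2]
  refine (norm_sub_le _ _).trans ?_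
  have h3 := norm_mul_le (A g - 1) (A h - 1)
  have h4 := norm_mul_le (A h - 1) (A g - 1)
  linarith

theorem t_commutator (a b : G) : t (a * b * a⁻¹ * b⁻¹) = (A a - 1) (t b) +
    (-((A (a * b * a⁻¹ * b⁻¹) - 1) (t b)) - A a ((A b - 1) (A a⁻¹ (t a)))) := by
  have h1 : a * b * a⁻¹ * b⁻¹ = (a * b) * (b * a)⁻¹ := by group
  have h2 : A (a * b * a⁻¹ * b⁻¹) (A b (t a)) = A a (A b (A a⁻¹ (t a))) := by
    have : a * b * a⁻¹ * b⁻¹ * b = a * (b * a⁻¹) := by group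
    have h3 : A (a * b * a⁻¹ * b⁻¹) * A b = A a * (A b * A a⁻¹) := by
      rw [← map_mul, this, map_mul, map_mul]
    exact DFunLike.congr_fun h3 (t a)
  rw [h1, H.t_mul_inv, ← h1, H.t_mul, H.t_mul, map_add, h2]
  simp only [sub_apply, one_apply_eq_self, map_sub, apply_inv]
  abel

theorem exists_minimal {S : Set G} (hS : S.Nonempty) : ∃ a ∈ S, ∀ b ∈ S, ‖t a‖ ≤ ‖t b‖ := by
  obtain ⟨g, hg⟩ := hS
  obtain ⟨a, ⟨ha, hag⟩, hmin⟩ := Set.exists_min_image (S ∩ {h | ‖t h‖ ≤ ‖t g‖}) (fun h => ‖t h‖)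
    ((H.finite ‖t g‖).subset Set.inter_subset_right) ⟨g, hg, le_refl ‖t g‖⟩
  refine ⟨a, ha, fun b hb => ?_⟩
  rcases le_total ‖t b‖ ‖t g‖ with h | h
  · exact hmin b ⟨hb, h⟩
  · exact le_trans hag h

variable [FiniteDimensional ℝ E]

/-- A sequence in the group has two terms, arbitrarily far apart, with nearby linear parts. -/
theorem exists_close (b : ℕ → G) {ε : ℝ} (hε : 0 < ε) :
    ∃ i : ℕ, ∀ N : ℕ, ∃ j ≥ N, ‖A (b j) - A (b i)‖ < ε := by
  have : ProperSpace (E →L[ℝ] E) := FiniteDimensional.proper ℝ _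
  obtain ⟨B, -, φ, hφ, hB⟩ := (isCompact_closedBall (0 : E →L[ℝ] E) 1).tendsto_subseq
    (x := fun k => A (b k)) fun k => by simpa using H.norm_le_one (b k)
  obtain ⟨N, hN⟩ := Metric.cauchySeq_iff'.mp hB.cauchySeq ε hε
  refine ⟨φ N, fun M => ⟨φ (max N M), (le_max_right N M).trans (hφ.id_le _), ?_⟩⟩
  have := hN (max N M) (le_max_left _ _)
  rwa [dist_eq_norm] at this

/-- Choose elements `b k` whose translation parts follow the ray `k u` up to a bounded error. Two of
them, far apart along the ray, have nearly equal linear parts; their quotient has a long translation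
part close to the direction of `u`, while the error stays bounded. -/
theorem exists_almost_translation {u : E} (hu : ‖u‖ = 1) {ε δ : ℝ} (hε : 0 < ε) (hδ : 0 < δ) :
    ∃ g, ∃ s : ℝ, 0 < s ∧ ‖t g - s • u‖ < δ * s ∧ ‖A g - 1‖ < ε := by
  obtain ⟨R, hR⟩ := H.dense
  choose b hb using fun k : ℕ => hR ((k : ℝ) • u)
  obtain ⟨i, hi⟩ := H.exists_close b hε
  obtain ⟨N, hN⟩ := exists_nat_gt ((2 * R + 2 * i) / δ + i)
  obtain ⟨j, hj, hji⟩ := hi N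
  have hR0 : 0 ≤ R := (norm_nonneg _).trans (hb 0)
  have hjN : (N : ℝ) ≤ j := Nat.cast_le.mpr hj
  have hs : (2 * R + 2 * i) / δ < (j : ℝ) - i := by linarith
  have hs0 : 0 < (j : ℝ) - i := lt_of_le_of_lt (by positivity) hs
  refine ⟨b j * (b i)⁻¹, (j : ℝ) - i, hs0, ?_, (H.norm_mul_inv_sub_one_le _ _).trans_lt hji⟩
  rw [div_lt_iff₀ hδ] at hs
  set B := A (b j * (b i)⁻¹) with hB
  have h1 : t (b j * (b i)⁻¹) - ((j : ℝ) - i) • u =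
      (t (b j) - (j : ℝ) • u) - B (t (b i) - (i : ℝ) • u) - (i : ℝ) • (B u - u) := by
    rw [H.t_mul_inv, map_sub, map_smul, sub_smul, smul_sub]
    abel
  rw [h1]
  have h2 : ‖B (t (b i) - (i : ℝ) • u)‖ ≤ R := by
    rw [hB, H.isometry]
    exact hb i
  have h3 : ‖(i : ℝ) • (B u - u)‖ ≤ i * 2 := by
    rw [norm_smul, Real.norm_natCast]
    refine mul_le_mul_of_nonneg_left ((norm_sub_le _ _).trans ?_) (Nat.cast_nonneg i)
    rw [hB, H.isometry, hu]
    norm_num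
  have h4 := norm_sub_le (t (b j) - (j : ℝ) • u - B (t (b i) - (i : ℝ) • u))
    ((i : ℝ) • (B u - u))
  have h5 := norm_sub_le (t (b j) - (j : ℝ) • u) (B (t (b i) - (i : ℝ) • u))
  have h6 := hb j
  linarith

/-- Elements with small linear part are translations. -/
theorem eq_one_of_norm_le (g : G) (hg : ‖A g - 1‖ ≤ 1 / 2) : A g = 1 := by
  by_contra hne
  -- Let `a` be a counterexample with shortest translation part and `K` its subspace of maximal
  -- displacement. Among the elements moving mainly along `K` with very small linear part, the
  -- shortest, `b`, is contradicted by the commutator of `a` and `b`.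
  obtain ⟨a, ⟨ha, hane⟩, hamin⟩ := H.exists_minimal
    (S := {g | ‖A g - 1‖ ≤ 1 / 2 ∧ A g ≠ 1}) ⟨g, hg, hne⟩
  obtain ⟨K, m', hm'0, hm'm, ⟨u, huK, hu1⟩, hK, hK'⟩ := exists_maximal_displacement (A a) (A a⁻¹)
    (H.isometry a) (by rw [← map_mul, mul_inv_cancel, map_one])
    (by rw [← map_mul, inv_mul_cancel, map_one]) hane
  set m := ‖A a - 1‖ with hm
  have hdec : ∀ x : E, ∃ p ∈ K, ∃ q ∈ Kᗮ, x = p + q ∧ ‖p‖ ≤ ‖x‖ ∧ ‖q‖ ≤ ‖x‖ := fun x => by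
    obtain ⟨p, hp, q, hq, rfl⟩ := K.exists_add_mem_mem_orthogonal x
    have h := norm_add_sq_eq_norm_sq_add_norm_sq_real (hq p hp)
    refine ⟨p, hp, q, hq, rfl, ?_, ?_⟩
    · exact abs_le_of_sq_le_sq' (by nlinarith [norm_nonneg q]) (norm_nonneg _) |>.2
    · exact abs_le_of_sq_le_sq' (by nlinarith [norm_nonneg p]) (norm_nonneg _) |>.2
  let S : Set G := {g | (∃ p ∈ K, ∃ q ∈ Kᗮ, t g = p + q ∧ ‖q‖ < ‖p‖) ∧
    ‖A g - 1‖ ≤ 1 / 8 * (m - m')}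
  have hS : S.Nonempty := by
    obtain ⟨b, s, hs, hb, hbε⟩ := H.exists_almost_translation hu1 (ε := 1 / 8 * (m - m'))
      (δ := 1 / 4) (by linarith) (by norm_num)
    obtain ⟨p, hp, q, hq, hpq, hpn, hqn⟩ := hdec (t b - s • u)
    refine ⟨b, ⟨s • u + p, K.add_mem (K.smul_mem s huK) hp, q, hq, ?_, ?_⟩, hbε.le⟩
    · rw [add_assoc, ← hpq, add_sub_cancel]
    · have h1 : ‖s • u‖ = s := by rw [norm_smul, hu1, mul_one, Real.norm_of_nonneg hs.le]
      have h2 := norm_sub_le (s • u + p) p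
      rw [add_sub_cancel_right, h1] at h2
      linarith
  obtain ⟨b, ⟨⟨p, hp, q, hq, hpq, hlt⟩, hbm⟩, hbmin⟩ := H.exists_minimal hS
  set c := a * b * a⁻¹ * b⁻¹ with hc
  obtain ⟨r, hr⟩ : ∃ r, r = -((A c - 1) (t b)) - A a ((A b - 1) (A a⁻¹ (t a))) := ⟨_, rfl⟩
  have htc : t c = (A a - 1) (t b) + r := by rw [hr]; exact H.t_commutator a b
  have hmc : ‖A c - 1‖ ≤ 2 * m * ‖A b - 1‖ := H.norm_commutator_sub_one_le a b
  have hb0 := norm_nonneg (A b - 1)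
  have hmc' : ‖A c - 1‖ ≤ ‖A b - 1‖ := by nlinarith
  have hrle : ‖r‖ ≤ 2 * ‖A b - 1‖ * ‖t b‖ := by
    have h1 : ‖r‖ ≤ ‖A c - 1‖ * ‖t b‖ + ‖A b - 1‖ * ‖t a‖ := by
      rw [hr]
      refine (norm_sub_le _ _).trans (add_le_add ?_ ?_)
      · rw [norm_neg]
        exact (A c - 1).le_opNorm _
      · rw [H.isometry]
        refine ((A b - 1).le_opNorm _).trans ?_
        rw [H.isometry]
    -- Either `b` is a translation and both sides vanish, or `b` is itself a counterexample and
    -- minimality of `a` applies.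
    have h2 : ‖A b - 1‖ * ‖t a‖ ≤ ‖A b - 1‖ * ‖t b‖ := by
      by_cases hb1 : A b = 1
      · simp [hb1]
      · refine mul_le_mul_of_nonneg_left (hamin b ⟨?_, hb1⟩) hb0
        linarith
    have h3 := mul_le_mul_of_nonneg_right hmc' (norm_nonneg (t b))
    linarith
  have htb : ‖t b‖ < 2 * ‖p‖ := by
    have := norm_add_le p q
    rw [hpq]
    linarith
  have hp0 : 0 < ‖p‖ := (norm_nonneg q).trans_lt hlt
  have hrp : ‖r‖ < 1 / 2 * (m - m') * ‖p‖ := by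
    have h1 : 2 * ‖A b - 1‖ * ‖t b‖ ≤ 2 * (1 / 8 * (m - m')) * ‖t b‖ := by gcongr
    have h2 : 2 * (1 / 8 * (m - m')) * ‖t b‖ < 2 * (1 / 8 * (m - m')) * (2 * ‖p‖) :=
      mul_lt_mul_of_pos_left htb (by linarith)
    nlinarith
  have hb_pos : 0 < ‖t b‖ := by
    have h1 := norm_add_sq_eq_norm_sq_add_norm_sq_real (hq p hp)
    rw [← hpq] at h1
    by_contra h2
    have h3 : ‖t b‖ = 0 := le_antisymm (not_lt.mp h2) (norm_nonneg _)
    rw [h3] at h1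
    nlinarith [norm_nonneg q]
  -- Up to the error `r`, the commutator stretches the `K`-part by exactly `m` and the orthogonal
  -- part by at most `m' < m`. The error is below half of `(m - m') ‖p‖`, so the `K`-part still
  -- dominates.
  have hcS : c ∈ S := by
    obtain ⟨p', hp', q', hq', hpq', hpn, hqn⟩ := hdec r
    refine ⟨⟨(A a - 1) p + p', K.add_mem (hK p hp).1 hp', (A a - 1) q + q',
      Submodule.add_mem _ (hK' q hq).1 hq', ?_, ?_⟩, hmc'.trans hbm⟩
    · rw [htc, hpq, hpq', map_add]
      abel
    · have h1 := norm_add_le ((A a - 1) q) q'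
      have h2 := norm_sub_le ((A a - 1) p + p') p'
      rw [add_sub_cancel_right, (hK p hp).2] at h2
      have h3 := (hK' q hq).2
      have h4 : m' * ‖q‖ ≤ m' * ‖p‖ := mul_le_mul_of_nonneg_left hlt.le hm'0
      nlinarith
  -- The contradiction: `‖t c‖ ≤ (1/2 + 1/8) ‖t b‖`, although `b` is shortest.
  have h1 := hbmin c hcS
  have h2 : ‖t c‖ ≤ m * ‖t b‖ + ‖r‖ := by
    rw [htc]
    exact (norm_add_le _ _).trans (add_le_add ((A a - 1).le_opNorm _) le_rfl)
  have h3 : 2 * ‖A b - 1‖ * ‖t b‖ ≤ 2 * (1 / 8 * (1 / 2)) * ‖t b‖ := by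
    have : ‖A b - 1‖ ≤ 1 / 8 * (1 / 2) := by linarith
    gcongr
  have h4 : m * ‖t b‖ ≤ 1 / 2 * ‖t b‖ := by gcongr
  linarith

/-- A unit vector orthogonal to all translations is nearly the direction of some element with small
linear part. That element is a translation, hence orthogonal to the vector, against Pythagoras. -/
theorem span_translations : Submodule.span ℝ {x | ∃ g, A g = 1 ∧ t g = x} = ⊤ := by
  set W := Submodule.span ℝ {x | ∃ g, A g = 1 ∧ t g = x} with hW
  rw [← Submodule.orthogonal_eq_bot_iff, Submodule.eq_bot_iff]
  intro x hx
  by_contra hx0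
  have hx' : ‖x‖ ≠ 0 := norm_ne_zero_iff.mpr hx0
  set u := ‖x‖⁻¹ • x with hu
  have hu1 : ‖u‖ = 1 := by simp [hu, norm_smul, hx']
  obtain ⟨g, s, hs, hg, hgA⟩ := H.exists_almost_translation hu1 (ε := 1 / 2) (δ := 1)
    (by norm_num) one_pos
  have hgW : t g ∈ W := Submodule.subset_span ⟨g, H.eq_one_of_norm_le g hgA.le, rfl⟩
  have huW : u ∈ Wᗮ := Submodule.smul_mem _ _ hx
  have h1 : ⟪t g, s • u⟫_ℝ = 0 := Submodule.smul_mem _ s huW _ hgW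
  have h2 := norm_sub_sq_eq_norm_sq_add_norm_sq_real h1
  have h3 : ‖s • u‖ = s := by rw [norm_smul, hu1, mul_one, Real.norm_of_nonneg hs.le]
  rw [h3] at h2
  nlinarith [norm_nonneg (t g), norm_nonneg (t g - s • u)]

/-- Infinitely many linear parts would include two distinct ones at distance below `1/2`, by
compactness; the quotient of the two elements would then be a translation. -/
theorem finite_range : (Set.range A).Finite := by
  by_contra hinf
  obtain ⟨f, hf⟩ := (Set.infinite_coe_iff.mpr hinf).natEmbedding
  choose b hb using fun k => (f k).2
  obtain ⟨i, hi⟩ := H.exists_close b (ε := 1 / 2) (by norm_num)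
  obtain ⟨j, hj, hji⟩ := hi (i + 1)
  have h1 := H.eq_one_of_norm_le _ ((H.norm_mul_inv_sub_one_le (b j) (b i)).trans hji.le)
  have h2 : A (b j) = A (b i) := by
    rw [← inv_mul_cancel_right (b j) (b i), map_mul, h1, one_mul]
  rw [hb, hb] at h2
  have := hf (Subtype.ext h2)
  omega

end Crystallographic

end Bieberbach

/-! ### Stokes' theorem for top degree forms on degenerate simplices -/

namespace CornerSimplex

open MeasureTheory HypCusp.Frame

theorem isClosed_corner (k : ℕ) : IsClosed (stdSimplexCorner k) := by
  have h : stdSimplexCorner k = {t | ∀ i, 0 ≤ t i} ∩ {t | ∑ i, t i ≤ 1} := rfl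
  rw [h]
  refine IsClosed.inter ?_ ?_
  · simp only [Set.ofPred_forall]
    exact isClosed_iInter fun i => isClosed_le continuous_const (continuous_apply i)
  · exact isClosed_le (continuous_finsetSum _ fun i _ => continuous_apply i) continuous_const

theorem isCompact_corner (k : ℕ) : IsCompact (stdSimplexCorner k) := by
  refine (isCompact_Icc (a := (0 : Fin k → ℝ)) (b := 1)).of_isClosed_subset (isClosed_corner k) ?_
  intro t ht
  refine ⟨ht.1, fun i => ?_⟩
  exact (Finset.single_le_sum (fun j _ => ht.1 j) (Finset.mem_univ i)).trans ht.2

theorem volume_corner_pos (k : ℕ) : 0 < volume (stdSimplexCorner k) := by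
  have hU : IsOpen {t : Fin k → ℝ | (∀ i, 0 < t i) ∧ ∑ i, t i < 1} := by
    have h : {t : Fin k → ℝ | (∀ i, 0 < t i) ∧ ∑ i, t i < 1} =
      {t | ∀ i, 0 < t i} ∩ {t | ∑ i, t i < 1} := rfl
    rw [h]
    refine IsOpen.inter ?_ ?_
    · simp only [Set.ofPred_forall]
      exact isOpen_iInter_of_finite fun i => isOpen_lt continuous_const (continuous_apply i)
    · exact isOpen_lt (continuous_finsetSum _ fun i _ => continuous_apply i) continuous_const
  have hne : {t : Fin k → ℝ | (∀ i, 0 < t i) ∧ ∑ i, t i < 1}.Nonempty := by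
    refine ⟨fun _ => 1 / ((k : ℝ) + 1), fun i => by positivity, ?_⟩
    rw [Finset.sum_const, Finset.card_univ, Fintype.card_fin, nsmul_eq_mul, mul_one_div,
      div_lt_one (by positivity)]
    linarith
  exact (hU.measure_pos volume hne).trans_le
    (measure_mono fun t ht => ⟨fun i => (ht.1 i).le, ht.2.le⟩)

theorem volume_corner_lt_top (k : ℕ) : volume (stdSimplexCorner k) < ⊤ :=
  (isCompact_corner k).measure_lt_top

variable {V : Type*} [NormedAddCommGroup V] [NormedSpace ℝ V]

/-- An affine bijection of a set of finite positive volume onto itself has Jacobian of absolute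
value one, so no determinant has to be computed. -/
theorem setIntegral_comp_affine {k : ℕ} {S : Set (Fin k → ℝ)} (hS : MeasurableSet S)
    (h0 : volume S ≠ 0) (h1 : volume S ≠ ⊤) (c : Fin k → ℝ) (L : (Fin k → ℝ) →L[ℝ] (Fin k → ℝ))
    (hL : Set.InjOn (fun s => c + L s) S) (himg : (fun s => c + L s) '' S = S)
    (F : (Fin k → ℝ) → V) : ∫ s in S, F (c + L s) = ∫ s in S, F s := by
  have hd : ∀ x ∈ S, HasFDerivWithinAt (fun s => c + L s) L S x := fun x _ =>
    (L.hasFDerivAt.const_add c).hasFDerivWithinAt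
  have h2 := integral_image_eq_integral_abs_det_fderiv_smul volume hS hd hL fun _ => (1 : ℝ)
  have hv : (volume.real S) ≠ 0 := by
    rw [Measure.real, ENNReal.toReal_ne_zero]
    exact ⟨h0, h1⟩
  rw [himg] at h2
  simp only [smul_eq_mul, mul_one, setIntegral_const] at h2
  have h3 : |L.det| = 1 := mul_left_cancel₀ hv (by rw [mul_one]; exact h2.symm)
  have h4 := integral_image_eq_integral_abs_det_fderiv_smul volume hS hd hL F
  rw [himg, h3] at h4
  simp only [one_smul] at h4
  exact h4.symm

theorem sum_insertNth {k : ℕ} (i : Fin (k + 1)) (a : ℝ) (s : Fin k → ℝ) :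
    ∑ l, (i.insertNth a s : Fin (k + 1) → ℝ) l = a + ∑ j, s j := by
  rw [Fin.sum_univ_succAbove _ i]
  simp

theorem insertNth_mem_iff {k : ℕ} (i : Fin (k + 1)) (a : ℝ) (s : Fin k → ℝ) :
    (i.insertNth a s : Fin (k + 1) → ℝ) ∈ stdSimplexCorner (k + 1) ↔
      s ∈ stdSimplexCorner k ∧ a ∈ Set.Icc 0 (1 - ∑ j, s j) := by
  constructor
  · rintro ⟨h1, h2⟩
    rw [sum_insertNth] at h2
    have ha : 0 ≤ a := by simpa using h1 i
    have hs : ∀ j, 0 ≤ s j := fun j => by simpa using h1 (i.succAbove j)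
    exact ⟨⟨hs, by linarith⟩, ha, by linarith⟩
  · rintro ⟨⟨h1, h2⟩, h3, h4⟩
    refine ⟨fun l => ?_, by rw [sum_insertNth]; linarith⟩
    refine i.succAboveCases ?_ (fun j => ?_) l
    · simpa using h3
    · simpa using h1 j

/-- The integral over the slanted face of the simplex does not depend on the coordinate which is
used to parametrize it. -/
theorem integral_slanted {k : ℕ} (i : Fin (k + 1)) (G : (Fin (k + 1) → ℝ) → V) :
    ∫ s in stdSimplexCorner k, G (i.insertNth (1 - ∑ j, s j) s) =
      ∫ s in stdSimplexCorner k, G (Fin.cons (1 - ∑ j, s j) s) := by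
  -- The change of parametrization is an affine self-map of the simplex: append the slack coordinate
  -- `1 - ∑ s` in front, then delete coordinate `i`.
  let ψ : Fin (k + 1) → ((Fin k → ℝ) →ₗ[ℝ] ℝ) :=
    Fin.cons (-∑ j, LinearMap.proj j) fun j => LinearMap.proj j
  let L : (Fin k → ℝ) →L[ℝ] (Fin k → ℝ) :=
    LinearMap.toContinuousLinearMap (LinearMap.pi fun j => ψ (i.succAbove j))
  let c : Fin k → ℝ := fun j => (Fin.cons 1 0 : Fin (k + 1) → ℝ) (i.succAbove j)
  have hψ : ∀ (s : Fin k → ℝ) (l : Fin (k + 1)), (Fin.cons (1 - ∑ j, s j) s : Fin (k + 1) → ℝ) l =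
      (Fin.cons 1 0 : Fin (k + 1) → ℝ) l + ψ l s := fun s l => by
    refine Fin.cases ?_ (fun j => ?_) l
    · simp [ψ, sub_eq_add_neg]
    · simp [ψ]
  have hφ : ∀ s, c + L s =
      fun j => (Fin.cons (1 - ∑ j, s j) s : Fin (k + 1) → ℝ) (i.succAbove j) := fun s => by
    ext j
    rw [hψ]
    rfl
  have hone : ∀ s : Fin k → ℝ, ∑ l, (Fin.cons (1 - ∑ j, s j) s : Fin (k + 1) → ℝ) l = 1 :=
    fun s => by simp [Fin.sum_univ_succ]
  have hins : ∀ s, (i.insertNth (1 - ∑ j, (c + L s) j) (c + L s) : Fin (k + 1) → ℝ) =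
      Fin.cons (1 - ∑ j, s j) s := fun s => by
    have h1 := hone s
    rw [Fin.sum_univ_succAbove _ i] at h1
    rw [hφ s]
    refine (Fin.insertNth_eq_iff).mpr ⟨by linarith, rfl⟩
  have hinj : Function.Injective fun s => c + L s := fun s s' h => by
    have h1 := hins s
    have h2 := hins s'
    have h3 : c + L s = c + L s' := h
    rw [h3, h2] at h1
    exact ((Fin.cons_inj.mp h1).2).symm
  have himg : (fun s => c + L s) '' stdSimplexCorner k = stdSimplexCorner k := by
    ext s
    constructor
    · rintro ⟨s, hs, rfl⟩
      have h1 : (Fin.cons (1 - ∑ j, s j) s : Fin (k + 1) → ℝ) ∈ stdSimplexCorner (k + 1) := by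
        have := (insertNth_mem_iff 0 (1 - ∑ j, s j) s).mpr ⟨hs, by linarith [hs.2], le_rfl⟩
        rwa [Fin.insertNth_zero'] at this
      rw [← hins] at h1
      exact ((insertNth_mem_iff _ _ _).mp h1).1
    · intro hs
      have h1 : (i.insertNth (1 - ∑ j, s j) s : Fin (k + 1) → ℝ) ∈ stdSimplexCorner (k + 1) :=
        (insertNth_mem_iff _ _ _).mpr ⟨hs, by linarith [hs.2], le_rfl⟩
      set t : Fin (k + 1) → ℝ := i.insertNth (1 - ∑ j, s j) s with ht
      have hsum : ∑ l, t l = 1 := by rw [ht, sum_insertNth]; ring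
      have ht0 : t = Fin.cons (1 - ∑ j, Fin.tail t j) (Fin.tail t) := by
        rw [Fin.sum_univ_succ] at hsum
        conv_lhs => rw [← Fin.cons_self_tail t]
        congr 1
        rw [← hsum]
        simp [Fin.tail]
      refine ⟨Fin.tail t, ?_, ?_⟩
      · rw [ht0, ← Fin.insertNth_zero'] at h1
        exact ((insertNth_mem_iff _ _ _).mp h1).1
      · simp only [hφ, ← ht0]
        ext j
        simp [ht]
  rw [← setIntegral_comp_affine (isClosed_corner k).measurableSet (volume_corner_pos k).ne'
    (volume_corner_lt_top k).ne c L hinj.injOn himg]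
  simp only [hins]

/-- The divergence theorem for the standard simplex. -/
theorem integral_fderiv [CompleteSpace V] {k : ℕ} (i : Fin (k + 1)) (g : (Fin (k + 1) → ℝ) → V)
    (hg : ContDiff ℝ 1 g) :
    ∫ t in stdSimplexCorner (k + 1), fderiv ℝ g t (Pi.single i 1) =
      (∫ s in stdSimplexCorner k, g (Fin.cons (1 - ∑ j, s j) s)) -
        ∫ s in stdSimplexCorner k, g (i.insertNth 0 s) := by
  have hgc : Continuous g := hg.continuous
  have hsum : Continuous fun s : Fin k → ℝ => ∑ j, s j :=
    continuous_finsetSum _ fun i _ => continuous_apply i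
  have hins : Continuous fun p : ℝ × (Fin k → ℝ) => (i.insertNth p.1 p.2 : Fin (k + 1) → ℝ) :=
    Continuous.finInsertNth i continuous_fst continuous_snd
  rw [← integral_slanted i, ← integral_sub]
  rotate_left
  · exact (hgc.comp (hins.comp ((continuous_const.sub hsum).prodMk
      continuous_id))).continuousOn.integrableOn_compact (isCompact_corner k)
  · exact (hgc.comp (hins.comp (continuous_const.prodMk
      continuous_id))).continuousOn.integrableOn_compact (isCompact_corner k)
  set F : (Fin (k + 1) → ℝ) → V := fun t => fderiv ℝ g t (Pi.single i 1) with hF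
  have hFc : Continuous F := (hg.continuous_fderiv one_ne_zero).clm_apply continuous_const
  set S := stdSimplexCorner (k + 1)
  have hS : MeasurableSet S := (isClosed_corner (k + 1)).measurableSet
  have hmp := (volume_preserving_piFinSuccAbove (fun _ => ℝ) i).symm
  have hFi : Integrable (S.indicator F) :=
    (hFc.continuousOn.integrableOn_compact (isCompact_corner _)).integrable_indicator hS
  have hFi' : Integrable (fun p : ℝ × (Fin k → ℝ) => S.indicator F (i.insertNth p.1 p.2))
      (volume.prod volume) :=
    (hmp.integrable_comp_emb (MeasurableEquiv.measurableEmbedding _)).mpr hFi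
  have hmi : ∫ t, S.indicator F t =
      ∫ p : ℝ × (Fin k → ℝ), S.indicator F (i.insertNth p.1 p.2) ∂(volume.prod volume) :=
    (hmp.integral_comp' (g := S.indicator F)).symm
  rw [← integral_indicator hS, hmi, integral_prod_symm _ hFi', ← integral_indicator (isClosed_corner k).measurableSet]
  refine integral_congr_ae (Filter.Eventually.of_forall fun s => ?_)
  beta_reduce
  dsimp only
  by_cases hs : s ∈ stdSimplexCorner k
  · rw [Set.indicator_of_mem hs]
    have h1 : (fun a => S.indicator F (i.insertNth a s)) =
        (Set.Icc 0 (1 - ∑ j, s j)).indicator fun a => F (i.insertNth a s) := by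
      ext a
      by_cases ha : a ∈ Set.Icc 0 (1 - ∑ j, s j)
      · rw [Set.indicator_of_mem ha, Set.indicator_of_mem ((insertNth_mem_iff _ _ _).mpr ⟨hs, ha⟩)]
      · rw [Set.indicator_of_notMem ha, Set.indicator_of_notMem fun h =>
          ha ((insertNth_mem_iff _ _ _).mp h).2]
    rw [h1, integral_indicator measurableSet_Icc, integral_Icc_eq_integral_Ioc,
      ← intervalIntegral.integral_of_le (by linarith [hs.2])]
    refine intervalIntegral.integral_eq_sub_of_hasDerivAt
      (f := fun a => g (i.insertNth a s)) (fun a _ => ?_) ?_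
    · have h2 : HasDerivAt (fun a : ℝ => (i.insertNth a s : Fin (k + 1) → ℝ)) (Pi.single i 1) a := by
        rw [hasDerivAt_pi]
        intro l
        refine i.succAboveCases ?_ (fun j => ?_) l
        · simpa using hasDerivAt_id' a
        · simpa [Fin.succAbove_ne] using hasDerivAt_const a (s j)
      exact ((hg.differentiable one_ne_zero _).hasFDerivAt).comp_hasDerivAt a h2
    · exact (hFc.comp (hins.comp (continuous_id.prodMk continuous_const))).intervalIntegrable _ _
  · rw [Set.indicator_of_notMem hs]
    have h1 : (fun a => S.indicator F (i.insertNth a s)) = fun _ => 0 := by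
      ext a
      exact Set.indicator_of_notMem (fun h => hs ((insertNth_mem_iff _ _ _).mp h).1) _
    rw [h1, integral_zero]

/-- The linear relation between `n + 1` vectors in dimension `n` given by Cramer's rule. -/
theorem sum_det_smul {n : ℕ} (Y : Fin (n + 1) → Fin n → ℝ) (c : Fin n) :
    ∑ i : Fin (n + 1), (-1) ^ (i : ℕ) * Matrix.det (Matrix.of fun j => Y (i.succAbove j)) * Y i c
      = 0 := by
  let M : Matrix (Fin (n + 1)) (Fin (n + 1)) ℝ := Matrix.of fun i => Fin.cons (Y i c) (Y i)
  have h := Matrix.det_succ_column_zero M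
  rw [Matrix.det_zero_of_column_eq (i := 0) (j := c.succ) (Fin.succ_ne_zero c).symm
    fun i => by simp [M]] at h
  rw [h]
  refine Finset.sum_congr rfl fun i _ => ?_
  have h1 : M.submatrix i.succAbove Fin.succ = Matrix.of fun j => Y (i.succAbove j) := by
    ext a b
    simp [M]
  rw [h1]
  simp only [M, Matrix.of_apply, Fin.cons_zero]
  ring

/-- Both sides expand, along the first column, the determinant of the rows `(1, Y i)`, before and
after subtracting row `0` from the others. -/
theorem sum_det {n : ℕ} (Y : Fin (n + 1) → Fin n → ℝ) :
    ∑ i : Fin (n + 1), (-1) ^ (i : ℕ) * Matrix.det (Matrix.of fun j => Y (i.succAbove j)) =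
      Matrix.det (Matrix.of fun j => Y j.succ - Y 0) := by
  let M : Matrix (Fin (n + 1)) (Fin (n + 1)) ℝ := Matrix.of fun i => Fin.cons 1 (Y i)
  let N : Matrix (Fin (n + 1)) (Fin (n + 1)) ℝ :=
    Matrix.of (Fin.cons (Fin.cons 1 (Y 0)) fun j => Fin.cons 0 (Y j.succ - Y 0))
  have hMN : M.det = N.det := by
    refine Matrix.det_eq_of_forall_row_eq_smul_add_const (Fin.cons 0 1) 0 rfl fun i j => ?_
    refine Fin.cases ?_ (fun i => ?_) i
    · simp [M, N]
    · refine Fin.cases ?_ (fun j => ?_) j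
      · simp [M, N]
      · simp [M, N]
  have h := Matrix.det_succ_column_zero M
  have h' := Matrix.det_succ_column_zero N
  rw [Fin.sum_univ_succ, Finset.sum_eq_zero fun i _ => by simp [N]] at h'
  have h1 : ∀ i : Fin (n + 1), M.submatrix i.succAbove Fin.succ =
      Matrix.of fun j => Y (i.succAbove j) := fun i => by
    ext a b
    simp [M]
  have h2 : N.submatrix (0 : Fin (n + 1)).succAbove Fin.succ =
      Matrix.of fun j => Y j.succ - Y 0 := by
    ext a b
    simp [N]
  simp only [h1] at h
  rw [h2] at h'
  rw [hMN, h'] at h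
  simp only [M, N, Matrix.of_apply, Fin.cons_zero, mul_one, Fin.val_zero, pow_zero, one_mul,
    add_zero] at h
  exact h.symm

/-- The volume form of Euclidean space. -/
noncomputable def volForm (n : ℕ) :
    EuclideanSpace ℝ (Fin n) [⋀^Fin n]→L[ℝ] ℝ :=
  { Matrix.detRowAlternating.compLinearMap (WithLp.linearEquiv 2 ℝ (Fin n → ℝ)).toLinearMap with
    cont := by
      change Continuous fun w : Fin n → EuclideanSpace ℝ (Fin n) =>
        Matrix.det (Matrix.of fun i j => w i j)
      refine Continuous.matrix_det (continuous_pi fun i => continuous_pi fun j => ?_)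
      simp only [Matrix.of_apply]
      fun_prop }

theorem volForm_apply {n : ℕ} (w : Fin n → EuclideanSpace ℝ (Fin n)) :
    volForm n w = Matrix.det (Matrix.of fun i j => w i j) := rfl

/-- The integral of the form `f vol` over a straight simplex. -/
noncomputable def topIntegral {n : ℕ} (f : EuclideanSpace ℝ (Fin n) → V)
    (x : Fin (n + 1) → EuclideanSpace ℝ (Fin n)) : V :=
  ∫ t in stdSimplexCorner n, volForm n (fun i => x i.succ - x 0) •
    f (x 0 + ∑ i : Fin n, t i • (x i.succ - x 0))

theorem topIntegral_eq {n : ℕ} (f : EuclideanSpace ℝ (Fin n) → V)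
    (x : Fin (n + 1) → EuclideanSpace ℝ (Fin n)) :
    topIntegral f x = volForm n (fun i => x i.succ - x 0) •
      ∫ t in stdSimplexCorner n, f (x 0 + ∑ i : Fin n, t i • (x i.succ - x 0)) :=
  integral_smul _ _

/-- An `(n + 1)`-simplex in `ℝⁿ` is degenerate. Pulled back to the standard simplex, the form
becomes the flux of the field `g k` with constant vector `k`; as `k` maps to zero in `ℝⁿ`, its
divergence vanishes and the divergence theorem balances the faces. -/
theorem sum_topIntegral [CompleteSpace V] {n : ℕ} {f : EuclideanSpace ℝ (Fin n) → V}
    (hf : ContDiff ℝ 1 f) (x : Fin (n + 2) → EuclideanSpace ℝ (Fin n)) :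
    ∑ i : Fin (n + 2), (-1 : ℝ) ^ (i : ℕ) • topIntegral f (x ∘ i.succAbove) = 0 := by
  set y : Fin (n + 1) → EuclideanSpace ℝ (Fin n) := fun i => x i.succ - x 0 with hy
  set k : Fin (n + 1) → ℝ := fun i => (-1) ^ (i : ℕ) * volForm n fun j => y (i.succAbove j) with hk
  let Λ : (Fin (n + 1) → ℝ) →L[ℝ] EuclideanSpace ℝ (Fin n) :=
    LinearMap.toContinuousLinearMap (Fintype.linearCombination ℝ y)
  have hΛ : ∀ t, Λ t = ∑ i, t i • y i := fun t => rfl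
  set g : (Fin (n + 1) → ℝ) → V := fun t => f (x 0 + Λ t) with hg
  have hgd : ContDiff ℝ 1 g := hf.comp (contDiff_const.add Λ.contDiff)
  set J := ∫ s in stdSimplexCorner n, g (Fin.cons (1 - ∑ j, s j) s) with hJ
  set B : Fin (n + 1) → V := fun i => ∫ s in stdSimplexCorner n, g (i.insertNth 0 s) with hB
  -- The signed maximal minors `k i` are the Cramer relation among the `n + 1` edge vectors; their
  -- sum is the volume factor of the slanted face.
  have hky : ∑ i, k i • y i = 0 := by
    ext c
    have := sum_det_smul (fun i => y i) c
    simp only [WithLp.ofLp_sum, WithLp.ofLp_smul, Finset.sum_apply, Pi.smul_apply, smul_eq_mul]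
    exact this
  have hk1 : ∑ i, k i = volForm n fun j => y j.succ - y 0 := sum_det fun i => y i
  have hdiv : ∑ i, k i • ∫ t in stdSimplexCorner (n + 1), fderiv ℝ g t (Pi.single i 1) = 0 := by
    have hd : ∀ t i, fderiv ℝ g t (Pi.single i 1) = fderiv ℝ f (x 0 + Λ t) (y i) := fun t i => by
      have h1 : HasFDerivAt g ((fderiv ℝ f (x 0 + Λ t)).comp Λ) t :=
        ((hf.differentiable one_ne_zero _).hasFDerivAt).comp t (Λ.hasFDerivAt.const_add (x 0))
      rw [h1.fderiv, ContinuousLinearMap.comp_apply]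
      congr 1
      simp [hΛ, Pi.single_apply, ite_smul]
    have hint : ∀ i, IntegrableOn (fun t => k i • fderiv ℝ g t (Pi.single i 1))
        (stdSimplexCorner (n + 1)) := fun i =>
      (continuous_const.smul ((hgd.continuous_fderiv one_ne_zero).clm_apply
        continuous_const)).continuousOn.integrableOn_compact (isCompact_corner _)
    simp only [← integral_smul]
    rw [← integral_finsetSum _ fun i _ => hint i]
    simp only [hd, ← map_smul, ← map_sum, hky, map_zero, integral_zero]
  simp only [integral_fderiv _ g hgd, smul_sub, Finset.sum_sub_distrib, ← Finset.sum_smul] at hdiv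
  rw [Fin.sum_univ_succ]
  have h0 : topIntegral f (x ∘ (0 : Fin (n + 2)).succAbove) = (∑ i, k i) • J := by
    rw [topIntegral_eq, hk1]
    simp only [Function.comp_apply, Fin.zero_succAbove]
    congr 2
    · ext j
      simp [hy]
    · ext s
      simp only [hg, hΛ, Fin.sum_univ_succ, Fin.cons_zero, Fin.cons_succ, hy]
      congr 1
      simp only [smul_sub, Finset.sum_sub_distrib, ← Finset.sum_smul, sub_smul, one_smul,
        Fin.succ_zero_eq_one]
      abel
  have hs : ∀ i : Fin (n + 1), (-1 : ℝ) ^ (i.succ : ℕ) • topIntegral f (x ∘ i.succ.succAbove) =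
      -(k i • B i) := fun i => by
    rw [topIntegral_eq]
    simp only [Function.comp_apply, Fin.succ_succAbove_zero, Fin.succ_succAbove_succ]
    have h1 : ∀ s : Fin n → ℝ, f (x 0 + ∑ j, s j • (x (i.succAbove j).succ - x 0)) =
        g (i.insertNth 0 s) := fun s => by
      simp only [hg, hΛ, hy]
      rw [Fin.sum_univ_succAbove _ i]
      simp
    simp only [h1]
    rw [Fin.val_succ, pow_succ, smul_smul, mul_neg_one, neg_mul, neg_smul]
  rw [h0, Finset.sum_congr rfl fun i _ => hs i, Finset.sum_neg_distrib, Fin.val_zero, pow_zero,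
    one_smul, ← sub_eq_add_neg]
  exact hdiv

end CornerSimplex

/-! ### The lattice of translations of a crystallographic group -/

namespace Bieberbach

namespace Crystallographic

open HomCochain

variable {E : Type*} [NormedAddCommGroup E] [InnerProductSpace ℝ E]
variable {G : Type*} [Group G] {A : G →* (E →L[ℝ] E)} {t : G → E} (H : Crystallographic A t)
include H

theorem t_mul_of_eq_one {g : G} (hg : A g = 1) (h : G) : t (g * h) = t g + t h := by
  rw [H.t_mul, hg, one_apply_eq_self]

theorem t_inv_of_eq_one {g : G} (hg : A g = 1) : t g⁻¹ = -t g := by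
  have h := H.t_mul_of_eq_one hg g⁻¹
  rw [mul_inv_cancel, H.t_one] at h
  exact (neg_eq_of_add_eq_zero_right h.symm).symm

omit H in
theorem inv_eq_one {g : G} (hg : A g = 1) : A g⁻¹ = 1 := by
  have h := map_mul A g g⁻¹
  rwa [mul_inv_cancel, map_one, hg, one_mul, eq_comm] at h

/-- The lattice of the translations in a crystallographic group. -/
def lattice : Submodule ℤ E :=
  AddSubgroup.toIntSubmodule
    { carrier := {x | ∃ g, A g = 1 ∧ t g = x}
      zero_mem' := ⟨1, map_one A, H.t_one⟩
      add_mem' := by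
        rintro _ _ ⟨g, hg, rfl⟩ ⟨h, hh, rfl⟩
        exact ⟨g * h, by rw [map_mul, hg, hh, one_mul], H.t_mul_of_eq_one hg h⟩
      neg_mem' := by
        rintro _ ⟨g, hg, rfl⟩
        exact ⟨g⁻¹, inv_eq_one hg, H.t_inv_of_eq_one hg⟩ }

theorem discreteTopology_lattice : DiscreteTopology H.lattice := by
  have hfin : {x : E | x ∈ H.lattice ∧ ‖x‖ ≤ 1 ∧ x ≠ 0}.Finite := by
    refine ((H.finite 1).image t).subset ?_
    rintro _ ⟨⟨g, -, rfl⟩, h1, -⟩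
    exact ⟨g, h1, rfl⟩
  refine discreteTopology_of_isOpen_singleton_zero ?_
  have h1 : IsOpen ((Subtype.val : H.lattice → E) ⁻¹'
      (Metric.ball 0 1 ∩ {x : E | x ∈ H.lattice ∧ ‖x‖ ≤ 1 ∧ x ≠ 0}ᶜ)) :=
    (Metric.isOpen_ball.inter hfin.isClosed.isOpen_compl).preimage continuous_subtype_val
  convert h1 using 1
  ext x
  constructor
  · rintro rfl
    exact ⟨Metric.mem_ball_self one_pos, fun h => h.2.2 rfl⟩
  · rintro ⟨h2, h3⟩
    by_contra h4
    exact h3 ⟨x.2, (mem_ball_zero_iff.mp h2).le, fun h5 => h4 (Subtype.ext h5)⟩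

variable [FiniteDimensional ℝ E]

/-- A crystallographic group contains, with finite index, a free abelian group which is generated
by linearly independent translations. -/
theorem exists_generators (hfaithful : ∀ g h, A g = A h → t g = t h → g = h) {n : ℕ}
    (hn : Module.finrank ℝ E = n) :
    ∃ (τ : Module.Basis (Fin n) ℝ E) (e : Fin n → G) (m : Fin n → G → ℤ),
      (∀ j, A (e j) = 1) ∧ (∀ j, t (e j) = τ j) ∧ (∀ i j, Commute (e i) (e j)) ∧
      IsExponent e m ∧ (Subgroup.closure (Set.range e)).FiniteIndex := by
  have := H.discreteTopology_lattice
  have hZ : IsZLattice ℝ H.lattice := ⟨H.span_translations⟩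
  have := ZLattice.module_finite ℝ H.lattice
  have := ZLattice.module_free ℝ H.lattice
  let b : Module.Basis (Fin n) ℤ H.lattice :=
    Module.finBasisOfFinrankEq ℤ H.lattice ((ZLattice.rank ℝ H.lattice).trans hn)
  choose e heA het using fun j => (b j).2
  have hker : ∀ g h, A g = 1 → A h = 1 → t g = t h → g = h := fun g h hg hh =>
    hfaithful g h (hg.trans hh.symm)
  have hcomm : ∀ i j, Commute (e i) (e j) := fun i j => by
    refine hker _ _ (by rw [map_mul, heA, heA, one_mul]) (by rw [map_mul, heA, heA, one_mul]) ?_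
    rw [H.t_mul_of_eq_one (heA i), H.t_mul_of_eq_one (heA j), add_comm]
  -- The lattice coordinates of a translation are homomorphisms on the kernel of `A`; extended along
  -- coset representatives, they give the exponents.
  let ι : A.ker → H.lattice := fun g => ⟨t g, g, g.2, rfl⟩
  obtain ⟨m, hm⟩ := exists_isExponent A.ker e heA (fun i g => b.repr (ι g) i)
    (fun i g h => by
      have : ι (g * h) = ι g + ι h := Subtype.ext (H.t_mul_of_eq_one g.2 h)
      rw [this, map_add, Finsupp.add_apply])
    (fun i j => by
      have : ι ⟨e j, heA j⟩ = b j := Subtype.ext (het j)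
      rw [this, b.repr_self, Finsupp.single_apply]
      simp only [eq_comm])
  refine ⟨b.ofZLatticeBasis ℝ H.lattice, e, m, heA, fun j =>
    (het j).trans (b.ofZLatticeBasis_apply ℝ H.lattice j).symm, hcomm, hm, ?_⟩
  have hrange : Finite A.toHomUnits.range := by
    have := H.finite_range.to_subtype
    refine Finite.of_injective (fun u : A.toHomUnits.range =>
      (⟨u.1, by obtain ⟨_, g, rfl⟩ := u; exact ⟨g, rfl⟩⟩ : Set.range A)) fun u v h => ?_
    exact Subtype.ext (Units.ext (congrArg Subtype.val h))
  have hfin : A.toHomUnits.ker.FiniteIndex := inferInstance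
  rw [MonoidHom.ker_toHomUnits] at hfin
  -- The kernel of `A` has finite index because the linear parts are finite in number; faithfulness
  -- puts it inside the subgroup generated by `e`.
  refine Subgroup.finiteIndex_of_le (H := A.ker) fun g hg => ?_
  have key : ∀ x ∈ Submodule.span ℤ (Set.range b),
      ∃ h ∈ Subgroup.closure (Set.range e), A h = 1 ∧ t h = x := fun x hx => by
    induction hx using Submodule.span_induction with
    | mem x hx =>
      obtain ⟨j, rfl⟩ := hx
      exact ⟨e j, Subgroup.subset_closure ⟨j, rfl⟩, heA j, het j⟩
    | zero => exact ⟨1, Subgroup.one_mem _, map_one A, H.t_one⟩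
    | add x y _ _ hx hy =>
      obtain ⟨g, hg, hgA, hgt⟩ := hx
      obtain ⟨h, hh, hhA, hht⟩ := hy
      exact ⟨g * h, Subgroup.mul_mem _ hg hh, by rw [map_mul, hgA, hhA, one_mul],
        by rw [H.t_mul_of_eq_one hgA, hgt, hht]; rfl⟩
    | smul a x _ hx =>
      obtain ⟨g, hg, hgA, hgt⟩ := hx
      induction a using Int.induction_on with
      | zero => exact ⟨1, Subgroup.one_mem _, map_one A, by rw [H.t_one, zero_smul]; rfl⟩
      | succ i ih =>
        obtain ⟨h, hh, hhA, hht⟩ := ih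
        exact ⟨h * g, Subgroup.mul_mem _ hh hg, by rw [map_mul, hgA, hhA, one_mul],
          by rw [H.t_mul_of_eq_one hhA, hgt, hht, add_smul, one_smul]; rfl⟩
      | pred i ih =>
        obtain ⟨h, hh, hhA, hht⟩ := ih
        exact ⟨h * g⁻¹, Subgroup.mul_mem _ hh (Subgroup.inv_mem _ hg),
          by rw [map_mul, inv_eq_one hgA, hhA, one_mul],
          by rw [H.t_mul_of_eq_one hhA, H.t_inv_of_eq_one hgA, hgt, hht, sub_smul, one_smul,
            sub_eq_add_neg]; rfl⟩
  obtain ⟨h, hh, hhA, hht⟩ := key ⟨t g, g, hg, rfl⟩ (by rw [b.span_eq]; trivial)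
  rwa [hker g h hg hhA hht.symm]

end Crystallographic

end Bieberbach

/-! ### Linear algebra of a frame -/

namespace HypCusp

theorem SOPlus_ext {n : ℕ} {g h : SOPlus n} (H : ∀ x, act g x = act h x) : g = h :=
  Subtype.ext (Units.ext (ContinuousLinearMap.ext H))

theorem Ad_wedge {n : ℕ} (g : SOPlus n) (a b : LSpace n) :
    Ad n g (wedge a b) = wedge (act g a) (act g b) := by
  refine so_ext fun x => ?_
  have h : ∀ y, lor n y (act g⁻¹ x) = lor n (act g y) x := fun y => by
    rw [← lor_act g, act_act_inv]
  rw [Ad_apply, wedge_apply, wedge_apply, map_sub, map_smul, map_smul, h, h]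

/-- The bilinear map `a, b ↦ a ∧ b`. -/
noncomputable def wedgeB (n : ℕ) : LSpace n →ₗ[ℝ] LSpace n →ₗ[ℝ] so n :=
  LinearMap.mk₂ ℝ wedge
    (fun a a' b => so_ext fun x => by
      rw [map_add, add_apply, wedge_apply, wedge_apply, wedge_apply, map_add, LinearMap.add_apply]
      module)
    (fun c a b => so_ext fun x => by
      rw [map_smul, smul_apply, wedge_apply, wedge_apply, map_smul, LinearMap.smul_apply,
        smul_eq_mul]
      module)
    (fun a b b' => so_ext fun x => by
      rw [map_add, add_apply, wedge_apply, wedge_apply, wedge_apply, map_add, LinearMap.add_apply]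
      module)
    (fun c a b => so_ext fun x => by
      rw [map_smul, smul_apply, wedge_apply, wedge_apply, map_smul, LinearMap.smul_apply,
        smul_eq_mul]
      module)

theorem wedgeB_apply {n : ℕ} (a b : LSpace n) : wedgeB n a b = wedge a b := rfl

theorem wedge_self {n : ℕ} (a : LSpace n) : wedge a a = 0 := so_ext fun x => by
  rw [wedge_apply, sub_self, map_zero, zero_apply]

theorem wedge_swap {n : ℕ} (a b : LSpace n) : wedge a b = -wedge b a := so_ext fun x => by
  rw [map_neg, neg_apply, wedge_apply, wedge_apply, neg_sub]

namespace Frame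

variable {n : ℕ} (F : Frame n)

theorem lor_ξ_w (i : Fin n) : lor n F.ξ (F.w i) = 0 := by rw [lor_comm, F.w_ξ]
theorem lor_O_w (i : Fin n) : lor n F.O (F.w i) = 0 := by rw [lor_comm, F.w_O]
theorem lor_O_ξ : lor n F.O F.ξ = -1 := by rw [lor_comm, F.ξ_O]
theorem lor_O_O : lor n F.O F.O = -1 := F.O_mem.1

/-- The point of `ℝⁿ` as a vector tangent to the horosphere at `O`; this is a section of
`chart`. -/
noncomputable def incl : EuclideanSpace ℝ (Fin n) →ₗ[ℝ] LSpace n :=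
  Fintype.linearCombination ℝ F.w ∘ₗ (WithLp.linearEquiv 2 ℝ (Fin n → ℝ)).toLinearMap

theorem incl_apply (y : EuclideanSpace ℝ (Fin n)) : F.incl y = ∑ i, y i • F.w i := rfl

theorem lor_ξ_incl (y : EuclideanSpace ℝ (Fin n)) : lor n F.ξ (F.incl y) = 0 := by
  simp [incl_apply, lor_ξ_w]

theorem lor_O_incl (y : EuclideanSpace ℝ (Fin n)) : lor n F.O (F.incl y) = 0 := by
  simp [incl_apply, lor_O_w]

theorem lor_w_incl (i : Fin n) (y : EuclideanSpace ℝ (Fin n)) :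
    lor n (F.w i) (F.incl y) = y i := by
  simp [incl_apply, F.w_w]

theorem lor_incl (x y : EuclideanSpace ℝ (Fin n)) :
    lor n (F.incl x) (F.incl y) = inner ℝ x y := by
  rw [F.incl_apply x, map_sum, LinearMap.sum_apply]
  simp only [map_smul, LinearMap.smul_apply, lor_w_incl, smul_eq_mul]
  simp [PiLp.inner_apply, mul_comm]

theorem lor_incl_left (y : EuclideanSpace ℝ (Fin n)) (x : LSpace n) :
    lor n (F.incl y) x = inner ℝ y (F.chart x) := by
  rw [F.incl_apply y, map_sum, LinearMap.sum_apply]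
  simp only [map_smul, LinearMap.smul_apply, smul_eq_mul]
  simp [PiLp.inner_apply, mul_comm, chart_apply]

theorem chart_incl (y : EuclideanSpace ℝ (Fin n)) : F.chart (F.incl y) = y := by
  ext i
  rw [chart_apply, lor_w_incl]

theorem chart_ξ : F.chart F.ξ = 0 := by
  ext i
  rw [chart_apply, F.w_ξ]
  rfl

theorem chart_O : F.chart F.O = 0 := by
  ext i
  rw [chart_apply, F.w_O]
  rfl

/-- The coordinates with respect to the basis `ξ, w₁, …, wₙ, O`. -/
noncomputable def coord : LSpace n →ₗ[ℝ] (Unit ⊕ (Fin n ⊕ Unit) → ℝ) :=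
  LinearMap.pi (Sum.elim (fun _ => lor n F.ξ - lor n F.O)
    (Sum.elim (fun i => lor n (F.w i)) fun _ => -lor n F.ξ))

theorem coord_surjective : Function.Surjective F.coord := by
  intro c
  refine ⟨c (Sum.inl ()) • F.ξ + F.incl (WithLp.toLp 2 fun i => c (Sum.inr (Sum.inl i))) +
    c (Sum.inr (Sum.inr ())) • F.O, ?_⟩
  ext j
  rcases j with j | j | j
  · simp [coord, F.ξ_null, F.ξ_O, lor_O_ξ, lor_O_O, lor_ξ_incl, lor_O_incl]
  · simp [coord, F.w_ξ, F.w_O, lor_w_incl]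
  · simp [coord, F.ξ_null, F.ξ_O, lor_ξ_incl]

theorem coord_injective : Function.Injective F.coord := by
  refine (LinearMap.injective_iff_surjective_of_finrank_eq_finrank ?_).mpr F.coord_surjective
  simp only [Module.finrank_fintype_fun_eq_card, Fintype.card_sum, Fintype.card_fin,
    Fintype.card_unit]
  ring

/-- The basis `ξ, w₁, …, wₙ, O`. -/
noncomputable def basis : Module.Basis (Unit ⊕ (Fin n ⊕ Unit)) ℝ (LSpace n) :=
  Module.Basis.ofEquivFun (LinearEquiv.ofBijective F.coord ⟨F.coord_injective, F.coord_surjective⟩)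

theorem basis_repr (x : LSpace n) (j : Unit ⊕ (Fin n ⊕ Unit)) :
    F.basis.repr x j = F.coord x j := rfl

theorem basis_eq (j : Unit ⊕ (Fin n ⊕ Unit)) :
    F.basis j = Sum.elim (fun _ => F.ξ) (Sum.elim F.w fun _ => F.O) j := by
  refine F.coord_injective ?_
  ext l
  rw [← basis_repr, F.basis.repr_self, Finsupp.single_apply]
  rcases j with j | j | j <;> rcases l with l | l | l <;>
    simp [coord, F.ξ_null, F.ξ_O, lor_O_ξ, lor_O_O, lor_ξ_w, lor_O_w, F.w_ξ, F.w_O, F.w_w, eq_comm]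

theorem expand (x : LSpace n) : x = (lor n F.ξ x - lor n F.O x) • F.ξ - lor n F.ξ x • F.O +
    F.incl (F.chart x) := by
  conv_lhs => rw [← F.basis.sum_repr x]
  simp only [Fintype.sum_sum_type, basis_eq, basis_repr]
  simp only [coord, LinearMap.pi_apply, Sum.elim_inl, Sum.elim_inr, Finset.univ_unique,
    Finset.sum_singleton, LinearMap.sub_apply, LinearMap.neg_apply, incl_apply, chart_apply]
  module

theorem eq_zero_of_lor {x : LSpace n} (h1 : lor n F.ξ x = 0) (h2 : lor n F.O x = 0)
    (h3 : ∀ i, lor n (F.w i) x = 0) : x = 0 := by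
  have h4 : F.chart x = 0 := by
    ext i
    exact h3 i
  rw [F.expand x, h1, h2, h4]
  simp

theorem eq_smul_ξ {x : LSpace n} (h1 : lor n F.ξ x = 0) :
    x = F.incl (F.chart x) + (-lor n F.O x) • F.ξ := by
  conv_lhs => rw [F.expand x, h1]
  module

/-- By skewness, the range of `X` is orthogonal to every vector killed by `X`, here to a basis. -/
theorem so_eq_zero {X : so n} (h1 : toEnd X F.ξ = 0) (h2 : toEnd X F.O = 0)
    (h3 : ∀ i, toEnd X (F.w i) = 0) : X = 0 := by
  refine so_ext fun x => ?_
  rw [map_zero, zero_apply]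
  have h : ∀ a, toEnd X a = 0 → lor n a (toEnd X x) = 0 := fun a ha => by
    have := toEnd_skew X a x
    rwa [ha, map_zero, LinearMap.zero_apply, zero_add] at this
  exact F.eq_zero_of_lor (h _ h1) (h _ h2) fun i => h _ (h3 i)

theorem lor_toEnd_self (X : so n) (x : LSpace n) : lor n x (toEnd X x) = 0 := by
  have h := toEnd_skew X x x
  rw [lor_comm] at h
  linarith

/-! ### Future pointing vectors -/

theorem sq_sum_le (x y : LSpace n) : (∑ i : Fin (n + 1), x i.succ * y i.succ) ^ 2 ≤
    (lor n x x + x 0 ^ 2) * (lor n y y + y 0 ^ 2) := by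
  have h := Finset.sum_mul_sq_le_sq_mul_sq Finset.univ (fun i : Fin (n + 1) => x i.succ)
    fun i => y i.succ
  have h1 : ∀ z : LSpace n, lor n z z + z 0 ^ 2 = ∑ i : Fin (n + 1), z i.succ ^ 2 := fun z => by
    rw [lor_apply]
    simp only [sq]
    ring
  rwa [h1, h1]

theorem ξ_time_pos : 0 < F.ξ 0 := by
  by_contra hneg
  have h := sq_sum_le F.ξ F.O
  have h1 := F.ξ_O
  have h2 := F.O_mem.2
  rw [lor_apply] at h1
  rw [F.ξ_null, F.lor_O_O] at h
  have h3 : F.ξ 0 * F.O 0 ≤ 0 := mul_nonpos_of_nonpos_of_nonneg (not_lt.mp hneg) h2.le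
  nlinarith [sq_nonneg (F.ξ 0)]

theorem lor_ξ_neg {x : LSpace n} (hx : x ∈ hyperboloid n) : lor n F.ξ x < 0 := by
  have h := sq_sum_le F.ξ x
  rw [F.ξ_null, hx.1] at h
  have h1 := mul_pos F.ξ_time_pos hx.2
  rw [lor_apply]
  by_contra h2
  nlinarith [F.ξ_time_pos, pow_pos F.ξ_time_pos 2]

theorem mem_hyperboloid {x : LSpace n} (hx : lor n x x = -1) (hξ : lor n F.ξ x < 0) :
    x ∈ hyperboloid n := by
  refine ⟨hx, ?_⟩
  by_contra h
  have h1 : -x ∈ hyperboloid n := ⟨by simpa using hx, by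
    have := lt_of_le_of_ne (not_lt.mp h) (time_ne_zero hx)
    simpa using this⟩
  have h2 := F.lor_ξ_neg h1
  rw [map_neg] at h2
  linarith

/-! ### Determinants and the translations of the horosphere -/

/-- In the basis `ξ, w, O` the matrix is block upper triangular with corner entries `1`: `f` fixes
`ξ` and preserves the pairing with `ξ`. Only the action on `ξ^⊥ / ℝ ξ` contributes. -/
theorem det_eq (f : LSpace n →ₗ[ℝ] LSpace n) (hξ : f F.ξ = F.ξ)
    (hf : ∀ x, lor n F.ξ (f x) = lor n F.ξ x) :
    LinearMap.det f = Matrix.det (Matrix.of fun i j => lor n (F.w i) (f (F.w j))) := by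
  rw [← LinearMap.det_toMatrix F.basis]
  have hM : ∀ i j, LinearMap.toMatrix F.basis F.basis f i j = F.coord (f (F.basis j)) i :=
    fun i j => by rw [LinearMap.toMatrix_apply, basis_repr]
  set M := LinearMap.toMatrix F.basis F.basis f
  rw [← Matrix.fromBlocks_toBlocks M]
  have h21 : M.toBlocks₂₁ = 0 := by
    ext i j
    rcases i with i | i
    · simp [Matrix.toBlocks₂₁, hM, basis_eq, hξ, coord, F.w_ξ]
    · simp [Matrix.toBlocks₂₁, hM, basis_eq, hξ, coord, F.ξ_null]
  rw [h21, Matrix.det_fromBlocks_zero₂₁, ← Matrix.fromBlocks_toBlocks M.toBlocks₂₂]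
  have h21' : M.toBlocks₂₂.toBlocks₂₁ = 0 := by
    ext i j
    simp [Matrix.toBlocks₂₂, Matrix.toBlocks₂₁, hM, basis_eq, coord, hf, lor_ξ_w]
  rw [h21', Matrix.det_fromBlocks_zero₂₁, Matrix.det_unique (n := Unit), Matrix.det_unique (n := Unit)]
  have h1 : M.toBlocks₁₁ default default = 1 := by
    simp [Matrix.toBlocks₁₁, hM, basis_eq, hξ, coord, F.ξ_null, lor_O_ξ]
  have h2 : M.toBlocks₂₂.toBlocks₂₂ default default = 1 := by
    simp [Matrix.toBlocks₂₂, hM, basis_eq, hf, coord, F.ξ_O]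
  rw [h1, h2, one_mul, mul_one]
  congr 1
  ext i j
  simp [Matrix.toBlocks₂₂, Matrix.toBlocks₁₁, hM, basis_eq, coord]

/-- The unipotent map which restricts to the translation by `a` of the horosphere. -/
noncomputable def unip (a : EuclideanSpace ℝ (Fin n)) : LSpace n →L[ℝ] LSpace n :=
  LinearMap.toContinuousLinearMap (LinearMap.id - (lor n F.ξ).smulRight (F.incl a) +
    (lor n (F.incl a) - (‖a‖ ^ 2 / 2) • lor n F.ξ).smulRight F.ξ)

theorem unip_apply (a : EuclideanSpace ℝ (Fin n)) (x : LSpace n) :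
    F.unip a x = x - lor n F.ξ x • F.incl a +
      (lor n (F.incl a) x - (‖a‖ ^ 2 / 2) * lor n F.ξ x) • F.ξ := rfl

theorem lor_ξ_unip (a : EuclideanSpace ℝ (Fin n)) (x : LSpace n) :
    lor n F.ξ (F.unip a x) = lor n F.ξ x := by
  simp [unip_apply, lor_ξ_incl, F.ξ_null]

theorem unip_ξ (a : EuclideanSpace ℝ (Fin n)) : F.unip a F.ξ = F.ξ := by
  simp [unip_apply, F.ξ_null, lor_comm _ F.ξ, lor_ξ_incl]

theorem unip_incl (a y : EuclideanSpace ℝ (Fin n)) :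
    F.unip a (F.incl y) = F.incl y + (inner ℝ a y : ℝ) • F.ξ := by
  simp [unip_apply, lor_ξ_incl, lor_incl]

theorem unip_O (a : EuclideanSpace ℝ (Fin n)) :
    F.unip a F.O = F.O + F.incl a + (‖a‖ ^ 2 / 2) • F.ξ := by
  simp [unip_apply, F.ξ_O, lor_comm _ F.O, lor_O_incl]

theorem unip_unip (a b : EuclideanSpace ℝ (Fin n)) (x : LSpace n) :
    F.unip a (F.unip b x) = F.unip (a + b) x := by
  have h1 : lor n (F.incl a) (F.unip b x) =
      lor n (F.incl a) x - lor n F.ξ x * inner ℝ a b := by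
    simp [unip_apply, lor_incl, lor_comm (F.incl a) F.ξ, lor_ξ_incl]
  have h2 := norm_add_sq_real a b
  rw [F.unip_apply a, lor_ξ_unip, h1, unip_apply, unip_apply, h2, map_add, map_add,
    LinearMap.add_apply]
  module

theorem unip_zero (x : LSpace n) : F.unip 0 x = x := by
  simp [unip_apply]

theorem lor_unip (a : EuclideanSpace ℝ (Fin n)) (x y : LSpace n) :
    lor n (F.unip a x) (F.unip a y) = lor n x y := by
  simp only [unip_apply, map_add, map_sub, map_smul, LinearMap.add_apply, LinearMap.sub_apply,
    LinearMap.smul_apply, smul_eq_mul, lor_incl, lor_ξ_incl, F.ξ_null, lor_comm _ F.ξ,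
    real_inner_self_eq_norm_sq, lor_comm x (F.incl a)]
  ring

/-- The translation by `a` of the horosphere, as an element of `N_ξ`. -/
noncomputable def ν (a : EuclideanSpace ℝ (Fin n)) : SOPlus n :=
  ⟨⟨F.unip a, F.unip (-a), ContinuousLinearMap.ext fun x => by
      rw [mul_apply_eq_comp, unip_unip, add_neg_cancel, unip_zero]; rfl,
    ContinuousLinearMap.ext fun x => by
      rw [mul_apply_eq_comp, unip_unip, neg_add_cancel, unip_zero]; rfl⟩,
    F.lor_unip a, by
      rw [F.det_eq _ (F.unip_ξ a) (F.lor_ξ_unip a), ← Matrix.det_one (n := Fin n) (R := ℝ)]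
      congr 1
      ext i j
      have h : F.w j = F.incl (EuclideanSpace.single j 1) := by
        simp [incl_apply]
      change lor n (F.w i) (F.unip a (F.w j)) = _
      rw [h, unip_incl, map_add, map_smul, F.w_ξ, lor_w_incl, Matrix.one_apply]
      simp, fun x hx =>
      F.mem_hyperboloid ((F.lor_unip a x x).trans hx.1) (by
        change lor n F.ξ (F.unip a x) < 0
        rw [lor_ξ_unip]
        exact F.lor_ξ_neg hx)⟩

theorem act_ν (a : EuclideanSpace ℝ (Fin n)) (x : LSpace n) : act (F.ν a) x = F.unip a x := rfl

theorem ν_mem_N (a : EuclideanSpace ℝ (Fin n)) : F.ν a ∈ F.N := by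
  refine ⟨F.unip_ξ a, fun x hx => ⟨lor n (F.incl a) x, ?_⟩⟩
  rw [act_ν, unip_apply, hx]
  simp

theorem ν_mem_P1 (a : EuclideanSpace ℝ (Fin n)) : F.ν a ∈ F.P1 := F.unip_ξ a

theorem ν_add (a b : EuclideanSpace ℝ (Fin n)) : F.ν (a + b) = F.ν a * F.ν b :=
  SOPlus_ext fun x => by rw [act_mul, act_ν, act_ν, act_ν, unip_unip]

theorem ν_zero : F.ν 0 = 1 := SOPlus_ext fun x => by rw [act_ν, unip_zero, act_one]

theorem ν_neg (a : EuclideanSpace ℝ (Fin n)) : F.ν (-a) = (F.ν a)⁻¹ :=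
  eq_inv_of_mul_eq_one_left (by rw [← ν_add, neg_add_cancel, ν_zero])

/-! ### The action of `P_ξ(1)` on the horosphere by Euclidean isometries -/

variable {F} in
theorem P1.act_ξ {g : SOPlus n} (hg : g ∈ F.P1) : act g F.ξ = F.ξ := hg

variable {F} in
theorem P1.lor_ξ_act {g : SOPlus n} (hg : g ∈ F.P1) (x : LSpace n) :
    lor n F.ξ (act g x) = lor n F.ξ x := by
  conv_lhs => rw [← P1.act_ξ hg, lor_act]

/-- The linear part of the isometry of the horosphere given by an element of `P_ξ(1)`. -/
noncomputable def rot (g : SOPlus n) : EuclideanSpace ℝ (Fin n) →L[ℝ] EuclideanSpace ℝ (Fin n) :=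
  LinearMap.toContinuousLinearMap (F.chart ∘ₗ (act g).toLinearMap ∘ₗ F.incl)

theorem rot_apply (g : SOPlus n) (y : EuclideanSpace ℝ (Fin n)) :
    F.rot g y = F.chart (act g (F.incl y)) := rfl

/-- The translation part of the isometry of the horosphere given by an element of `P_ξ(1)`. -/
noncomputable def trans (g : SOPlus n) : EuclideanSpace ℝ (Fin n) := F.chart (act g F.O)

variable {F}

/-- One linear formula covers points and tangent vectors: the translation part is weighted by `-⟨ξ,
x⟩`, which is `1` on the horosphere and `0` on vectors tangent to it. -/
theorem chart_act {g : SOPlus n} (hg : g ∈ F.P1) (x : LSpace n) :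
    F.chart (act g x) = (-lor n F.ξ x) • F.trans g + F.rot g (F.chart x) := by
  conv_lhs => rw [F.expand x]
  rw [map_add, map_sub, map_smul, map_smul, P1.act_ξ hg, map_add, map_sub, map_smul, map_smul,
    chart_ξ, smul_zero, zero_sub, ← neg_smul]
  rfl

theorem trans_mul {g : SOPlus n} (hg : g ∈ F.P1) {h : SOPlus n} (hh : h ∈ F.P1) :
    F.trans (g * h) = F.trans g + F.rot g (F.trans h) := by
  rw [trans, act_mul, chart_act hg, P1.lor_ξ_act hh, F.ξ_O, neg_neg, one_smul]
  rfl

theorem rot_mul {g : SOPlus n} (hg : g ∈ F.P1) {h : SOPlus n} (hh : h ∈ F.P1) :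
    F.rot (g * h) = F.rot g * F.rot h := by
  ext1 y
  rw [rot_apply, act_mul, chart_act hg, P1.lor_ξ_act hh, lor_ξ_incl, neg_zero, zero_smul, zero_add]
  rfl

variable (F) in
theorem rot_one : F.rot 1 = 1 := by
  ext1 y
  rw [rot_apply, act_one, chart_incl]
  rfl

variable (F) in
theorem trans_one : F.trans 1 = 0 := by
  rw [trans, act_one, chart_O]

theorem act_incl {g : SOPlus n} (hg : g ∈ F.P1) (y : EuclideanSpace ℝ (Fin n)) :
    act g (F.incl y) = F.incl (F.rot g y) + (-lor n F.O (act g (F.incl y))) • F.ξ :=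
  F.eq_smul_ξ (by rw [P1.lor_ξ_act hg, lor_ξ_incl])

variable (F) in
theorem lor_self_of_orthogonal {x : LSpace n} (hx : lor n F.ξ x = 0) :
    lor n x x = ‖F.chart x‖ ^ 2 := by
  rw [F.eq_smul_ξ hx]
  simp only [map_add, map_smul, LinearMap.add_apply, LinearMap.smul_apply, smul_eq_mul, lor_incl,
    lor_ξ_incl, F.ξ_null, lor_comm _ F.ξ, real_inner_self_eq_norm_sq, chart_incl, chart_ξ]
  simp

theorem norm_rot {g : SOPlus n} (hg : g ∈ F.P1) (y : EuclideanSpace ℝ (Fin n)) :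
    ‖F.rot g y‖ = ‖y‖ := by
  have h1 := F.lor_self_of_orthogonal (x := act g (F.incl y))
    (by rw [P1.lor_ξ_act hg, lor_ξ_incl])
  rw [lor_act, lor_incl, real_inner_self_eq_norm_sq, ← rot_apply] at h1
  exact (pow_left_inj₀ (norm_nonneg _) (norm_nonneg _) two_ne_zero).mp h1.symm

variable (F) in
theorem rot_ν (a : EuclideanSpace ℝ (Fin n)) : F.rot (F.ν a) = 1 := by
  ext1 y
  rw [rot_apply, act_ν, unip_incl, map_add, map_smul, chart_ξ, smul_zero, add_zero, chart_incl]
  rfl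

variable (F) in
theorem trans_ν (a : EuclideanSpace ℝ (Fin n)) : F.trans (F.ν a) = a := by
  rw [trans, act_ν, unip_O, map_add, map_add, map_smul, chart_ξ, chart_incl, chart_O]
  simp

theorem act_O_of_trans {g : SOPlus n} (hg : g ∈ F.P1) (ht : F.trans g = 0) : act g F.O = F.O := by
  have h1 : act g F.O = (-1 - lor n F.O (act g F.O)) • F.ξ + F.O := by
    conv_lhs => rw [F.expand (act g F.O), P1.lor_ξ_act hg, F.ξ_O, ← trans, ht, map_zero]
    module
  have h2 := lor_act g F.O F.O
  rw [h1] at h2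
  simp only [map_add, map_smul, LinearMap.add_apply, LinearMap.smul_apply, smul_eq_mul, F.ξ_null,
    F.ξ_O, lor_O_ξ, lor_O_O] at h2
  have h3 : -1 - lor n F.O (act g F.O) = 0 := by linarith
  rw [h3, zero_smul, zero_add] at h1
  exact h1

theorem act_incl_of_trans {g : SOPlus n} (hg : g ∈ F.P1) (ht : F.trans g = 0)
    (y : EuclideanSpace ℝ (Fin n)) : act g (F.incl y) = F.incl (F.rot g y) := by
  have h := act_incl hg y
  have h1 : lor n F.O (act g (F.incl y)) = 0 := by
    conv_lhs => rw [← act_O_of_trans hg ht, lor_act, lor_O_incl]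
  rwa [h1, neg_zero, zero_smul, add_zero] at h

theorem eq_one_of_rot_trans {g : SOPlus n} (hg : g ∈ F.P1) (ht : F.trans g = 0)
    (hA : F.rot g = 1) : g = 1 := by
  refine SOPlus_ext fun x => ?_
  rw [F.expand x, map_add, map_sub, map_smul, map_smul, P1.act_ξ hg, act_O_of_trans hg ht,
    act_incl_of_trans hg ht, hA]
  rfl

theorem eq_of_rot_trans {g h : SOPlus n} (hg : g ∈ F.P1) (hh : h ∈ F.P1)
    (hA : F.rot g = F.rot h) (ht : F.trans g = F.trans h) : g = h := by
  have hh' := F.P1.inv_mem hh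
  have h1 : F.rot h⁻¹ * F.rot h = 1 := by rw [← rot_mul hh' hh, inv_mul_cancel, rot_one]
  have h2 := trans_mul hh' hh
  rw [inv_mul_cancel, trans_one, ← ht, ← trans_mul hh' hg] at h2
  have h3 := eq_one_of_rot_trans (F.P1.mul_mem hh' hg) h2.symm (by
    rw [rot_mul hh' hg, hA, h1])
  exact (inv_mul_eq_one.mp h3).symm

/-- The rotation part of an element of `P_ξ(1)`, as an element of `K_ξ`. -/
theorem exists_rotation {g : SOPlus n} (hg : g ∈ F.P1) (x : EuclideanSpace ℝ (Fin n)) :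
    ∃ k : SOPlus n, k ∈ F.P1 ∧ F.trans k = 0 ∧ F.rot k = F.rot g ∧
      g * F.ν x = F.ν (F.trans g + F.rot g x) * k := by
  set z := F.trans g + F.rot g x with hz
  have hgν := F.P1.mul_mem hg (F.ν_mem_P1 x)
  refine ⟨F.ν (-z) * (g * F.ν x), F.P1.mul_mem (F.ν_mem_P1 _) hgν, ?_, ?_, ?_⟩
  · rw [trans_mul (F.ν_mem_P1 _) hgν, rot_ν, trans_ν, one_apply_eq_self,
      trans_mul hg (F.ν_mem_P1 _), trans_ν, ← hz, neg_add_cancel]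
  · rw [rot_mul (F.ν_mem_P1 _) hgν, rot_mul hg (F.ν_mem_P1 _), rot_ν, rot_ν, one_mul, mul_one]
  · rw [ν_neg, mul_inv_cancel_left]

/-- Determinant one on `ℝ^{n+1,1}` passes to the rotation part by `det_eq`; this is where
preservation of orientation enters. -/
theorem volForm_rot {g : SOPlus n} (hg : g ∈ F.P1) (x : Fin n → EuclideanSpace ℝ (Fin n)) :
    CornerSimplex.volForm n (fun i => F.rot g (x i)) = CornerSimplex.volForm n x := by
  have h1 := F.det_eq (act g).toLinearMap (P1.act_ξ hg) (P1.lor_ξ_act hg)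
  have h2 : LinearMap.det ((act g).toLinearMap) = 1 := g.2.2.1
  rw [h2] at h1
  rw [CornerSimplex.volForm_apply, CornerSimplex.volForm_apply]
  have h3 : (Matrix.of fun i j => F.rot g (x i) j) = (Matrix.of fun i j => x i j) *
      (Matrix.of fun i j => lor n (F.w i) (act g (F.w j))).transpose := by
    ext i j
    rw [Matrix.mul_apply, Matrix.of_apply, rot_apply, chart_apply, incl_apply, map_sum, map_sum]
    simp
  rw [h3, Matrix.det_mul, Matrix.det_transpose]
  have h4 : (Matrix.of fun i j => lor n (F.w i) (act g (F.w j))).det = 1 := h1.symm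
  rw [h4, mul_one]

end Frame

end HypCusp

/-! ### Invariant forms of top degree on the horosphere -/

namespace HypCusp

open CornerSimplex HomCochain
open scoped ContDiff

instance (n : ℕ) : FiniteDimensional ℝ (so n) := inferInstanceAs (FiniteDimensional ℝ (skew n))

instance (n : ℕ) : CompleteSpace (so n) := FiniteDimensional.complete ℝ (so n)

namespace Frame

variable {n : ℕ} (F : Frame n)

/-- The null vector at `O` which is opposite to `ξ`. -/
def opp : LSpace n := (2 : ℝ) • F.O - F.ξ

theorem O_eq : F.O = (1 / 2 : ℝ) • (F.ξ + F.opp) := by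
  rw [opp]
  module

theorem lor_ξ_opp : lor n F.ξ F.opp = -2 := by
  simp only [opp, map_sub, map_smul, F.ξ_O, F.ξ_null, smul_eq_mul]
  norm_num

theorem w_eq_incl (i : Fin n) : F.w i = F.incl (EuclideanSpace.single i 1) := by
  simp [incl_apply]

theorem T_apply (x : LSpace n) :
    toEnd F.T x = (2 : ℝ) • (lor n F.ξ x • F.O - lor n F.O x • F.ξ) := rfl

theorem T_ξ : toEnd F.T F.ξ = (2 : ℝ) • F.ξ := by
  rw [T_apply, F.ξ_null, lor_O_ξ]
  module

theorem T_opp : toEnd F.T F.opp = (-2 : ℝ) • F.opp := by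
  rw [T_apply, lor_ξ_opp, opp, map_sub, map_smul, lor_O_ξ, lor_O_O]
  module

theorem T_incl (y : EuclideanSpace ℝ (Fin n)) : toEnd F.T (F.incl y) = (0 : ℝ) • F.incl y := by
  rw [T_apply, lor_ξ_incl, lor_O_incl]
  module

theorem T_w (i : Fin n) : toEnd F.T (F.w i) = (0 : ℝ) • F.w i := by
  rw [w_eq_incl, T_incl]

variable {F}

/-- Weights under `T` must add up to zero: skewness moves `T` to the first argument, giving `(α + β
+ l) ⟨a, v b⟩ = 0`. -/
theorem lor_eq_zero_of_mem_V {l : ℝ} {v : so n} (hv : v ∈ F.V l) {a b : LSpace n} {α β : ℝ}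
    (ha : toEnd F.T a = α • a) (hb : toEnd F.T b = β • b) (h : α + β + l ≠ 0) :
    lor n a (toEnd v b) = 0 := by
  have h1 : toEnd F.T (toEnd v b) - toEnd v (toEnd F.T b) = l • toEnd v b :=
    DFunLike.congr_fun (show toEnd F.T * toEnd v - toEnd v * toEnd F.T = l • toEnd v from hv) b
  have h2 := toEnd_skew F.T a (toEnd v b)
  have h3 := congrArg (lor n a) h1
  rw [ha, map_smul, LinearMap.smul_apply, smul_eq_mul] at h2
  rw [hb, map_sub, map_smul, map_smul, map_smul, smul_eq_mul, smul_eq_mul] at h3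
  refine (mul_eq_zero.mp (?_ : (α + β + l) * lor n a (toEnd v b) = 0)).resolve_left h
  linarith

variable (F)

theorem eq_zero_of_lor_opp {x : LSpace n} (h1 : lor n F.ξ x = 0) (h2 : lor n F.opp x = 0)
    (h3 : ∀ i, lor n (F.w i) x = 0) : x = 0 := by
  refine F.eq_zero_of_lor h1 ?_ h3
  rw [O_eq, map_smul, map_add, LinearMap.smul_apply, LinearMap.add_apply, h1, h2]
  simp

/-- The parametrization of `V₋₂` by Euclidean space. -/
noncomputable def root : EuclideanSpace ℝ (Fin n) →ₗ[ℝ] so n := wedgeB n F.opp ∘ₗ F.incl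

theorem root_apply (y : EuclideanSpace ℝ (Fin n)) : F.root y = wedge F.opp (F.incl y) := rfl

/-- The quotient map of `𝔤` onto its coinvariants under `N_ξ`. -/
noncomputable def coinv : so n →ₗ[ℝ] EuclideanSpace ℝ (Fin n) where
  toFun X := F.chart (toEnd X F.ξ)
  map_add' X Y := by simp
  map_smul' c X := by simp

theorem coinv_apply (X : so n) : F.coinv X = F.chart (toEnd X F.ξ) := rfl

theorem coinv_root (y : EuclideanSpace ℝ (Fin n)) : F.coinv (F.root y) = (2 : ℝ) • y := by
  rw [coinv_apply, root_apply, wedge_apply, lor_comm _ F.ξ, lor_comm _ F.ξ, lor_ξ_incl, lor_ξ_opp,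
    zero_smul, zero_sub, map_neg, map_smul, chart_incl, neg_smul, neg_neg]

/-- Translations fix `ξ` and act trivially on `ξ^⊥ / ℝ ξ`, where `X ξ` lies by skewness. -/
theorem coinv_Ad_ν (a : EuclideanSpace ℝ (Fin n)) (X : so n) :
    F.coinv (Ad n (F.ν a) X) = F.coinv X := by
  rw [coinv_apply, Ad_apply, P1.act_ξ (F.P1.inv_mem (F.ν_mem_P1 a)), chart_act (F.ν_mem_P1 a),
    rot_ν, lor_toEnd_self, neg_zero, zero_smul, zero_add]
  rfl

theorem root_mem (y : EuclideanSpace ℝ (Fin n)) : F.root y ∈ F.V (-2) := by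
  change toEnd F.T * toEnd (F.root y) - toEnd (F.root y) * toEnd F.T = (-2 : ℝ) • toEnd (F.root y)
  ext1 x
  have h1 := toEnd_skew F.T (F.incl y) x
  have h2 := toEnd_skew F.T F.opp x
  rw [T_incl, zero_smul, map_zero, LinearMap.zero_apply, zero_add] at h1
  rw [T_opp, map_smul, LinearMap.smul_apply, smul_eq_mul] at h2
  have h3 : lor n F.opp (toEnd F.T x) = 2 * lor n F.opp x := by linarith
  rw [sub_apply, smul_apply, mul_apply_eq_comp, mul_apply_eq_comp, root_apply, wedge_apply,
    wedge_apply, map_sub, map_smul, map_smul, T_opp, T_incl, h1, h3]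
  module

variable {F} in
theorem exists_root {v : so n} (hv : v ∈ F.V (-2)) : ∃ y, v = F.root y := by
  -- The factor inverts `coinv_root`. The difference then has zero `coinv`, and weights force all
  -- its remaining matrix entries to vanish.
  refine ⟨(1 / 2 : ℝ) • F.coinv v, sub_eq_zero.mp ?_⟩
  set y := (1 / 2 : ℝ) • F.coinv v with hy
  have hD : v - F.root y ∈ F.V (-2) := Submodule.sub_mem _ hv (F.root_mem y)
  have hc : F.coinv (v - F.root y) = 0 := by
    rw [map_sub, coinv_root, hy, smul_smul]
    norm_num
  set D := v - F.root y
  have h1 : toEnd D F.ξ = 0 := F.eq_zero_of_lor_opp (lor_toEnd_self D F.ξ)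
    (lor_eq_zero_of_mem_V hD F.T_opp F.T_ξ (by norm_num))
    fun i => by
      have := congrArg (fun z : EuclideanSpace ℝ (Fin n) => z i) hc
      exact this
  have h2 : toEnd D F.opp = 0 := F.eq_zero_of_lor_opp
    (lor_eq_zero_of_mem_V hD F.T_ξ F.T_opp (by norm_num))
    (lor_eq_zero_of_mem_V hD F.T_opp F.T_opp (by norm_num))
    fun i => lor_eq_zero_of_mem_V hD (F.T_w i) F.T_opp (by norm_num)
  refine F.so_eq_zero h1 ?_ fun j => F.eq_zero_of_lor_opp ?_
    (lor_eq_zero_of_mem_V hD F.T_opp (F.T_w j) (by norm_num))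
    fun i => lor_eq_zero_of_mem_V hD (F.T_w i) (F.T_w j) (by norm_num)
  · rw [O_eq, map_smul, map_add, h1, h2]
    simp
  · have h3 := toEnd_skew D F.ξ (F.w j)
    rwa [h1, map_zero, LinearMap.zero_apply, zero_add] at h3

/-! ### The equivariant functions on the horosphere -/

/-- The coefficient function of the `N_ξ`-invariant form with initial value in `V₋₂`. -/
noncomputable def field (y x : EuclideanSpace ℝ (Fin n)) : so n := Ad n (F.ν x) (F.root y)

theorem field_zero (y : EuclideanSpace ℝ (Fin n)) : F.field y 0 = F.root y := by
  rw [field, ν_zero, map_one, Module.End.one_apply]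

theorem field_add (y y' x : EuclideanSpace ℝ (Fin n)) :
    F.field (y + y') x = F.field y x + F.field y' x := by simp [field]

theorem field_smul (c : ℝ) (y x : EuclideanSpace ℝ (Fin n)) :
    F.field (c • y) x = c • F.field y x := by simp [field]

theorem coinv_field (y x : EuclideanSpace ℝ (Fin n)) : F.coinv (F.field y x) = (2 : ℝ) • y := by
  rw [field, coinv_Ad_ν, coinv_root]

theorem contDiff_unip (b : LSpace n) : ContDiff ℝ ∞ fun x => F.unip x b := by
  have h1 : ContDiff ℝ ∞ fun x : EuclideanSpace ℝ (Fin n) => F.incl x :=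
    (LinearMap.toContinuousLinearMap F.incl).contDiff
  have h2 : ContDiff ℝ ∞ fun x : EuclideanSpace ℝ (Fin n) => (inner ℝ x (F.chart b) : ℝ) :=
    contDiff_id.inner ℝ contDiff_const
  have h3 : ContDiff ℝ ∞ fun x : EuclideanSpace ℝ (Fin n) => ‖x‖ ^ 2 := contDiff_norm_sq ℝ
  simp only [unip_apply, lor_incl_left]
  have h4 : ContDiff ℝ ∞ fun x : EuclideanSpace ℝ (Fin n) => lor n F.ξ b • F.incl x :=
    h1.const_smul (lor n F.ξ b)
  have h5 : ContDiff ℝ ∞ fun x : EuclideanSpace ℝ (Fin n) =>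
      (inner ℝ x (F.chart b) : ℝ) - ‖x‖ ^ 2 / 2 * lor n F.ξ b :=
    h2.sub ((h3.div_const 2).mul contDiff_const)
  have h6 : ContDiff ℝ ∞ fun _ : EuclideanSpace ℝ (Fin n) => F.ξ := contDiff_const
  have h7 : ContDiff ℝ ∞ fun _ : EuclideanSpace ℝ (Fin n) => b := contDiff_const
  exact (h7.sub h4).add (h5.smul h6)

theorem contDiff_field (y : EuclideanSpace ℝ (Fin n)) : ContDiff ℝ ∞ (F.field y) := by
  let B : LSpace n →L[ℝ] LSpace n →L[ℝ] so n := LinearMap.toContinuousLinearMap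
    (LinearMap.toContinuousLinearMap.toLinearMap ∘ₗ wedgeB n)
  have h : F.field y = fun x => B (F.unip x F.opp) (F.unip x (F.incl y)) := by
    ext1 x
    rw [field, root_apply, Ad_wedge]
    rfl
  rw [h]
  exact (B.contDiff.comp (F.contDiff_unip _)).clm_apply (F.contDiff_unip _)

variable {F} in
-- Write `g ν(x) = ν(g x) k` with `k` a rotation about `O`. Such a `k` fixes both null directions
-- `ξ` and `opp`, so it acts on `V₋₂` by rotating the parameter `y`.
theorem Ad_field {g : SOPlus n} (hg : g ∈ F.P1) (y x : EuclideanSpace ℝ (Fin n)) :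
    Ad n g (F.field y x) = F.field (F.rot g y) (F.trans g + F.rot g x) := by
  obtain ⟨k, hk, hkt, hkr, hgk⟩ := exists_rotation hg x
  have h1 : Ad n k (F.root y) = F.root (F.rot g y) := by
    rw [root_apply, Ad_wedge, act_incl_of_trans hk hkt, hkr, opp, map_sub, map_smul,
      act_O_of_trans hk hkt, P1.act_ξ hk]
    rfl
  rw [field, ← Module.End.mul_apply, ← map_mul, hgk, map_mul, Module.End.mul_apply, h1, field]

/-- The `N_ξ`-invariant `n`-form with a given initial value in `V₋₂`. -/
noncomputable def topForm (y : EuclideanSpace ℝ (Fin n)) : Form n n :=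
  fun x => (volForm n).smulRight (F.field y x)

theorem contDiff_topForm (y : EuclideanSpace ℝ (Fin n)) : ContDiff ℝ ∞ (F.topForm y) := by
  let L : so n →ₗ[ℝ] (EuclideanSpace ℝ (Fin n) [⋀^Fin n]→L[ℝ] so n) :=
    { toFun := fun v => (volForm n).smulRight v
      map_add' := fun v v' => by
        ext w
        exact smul_add (volForm n w) v v'
      map_smul' := fun c v => by
        ext w
        exact smul_comm (volForm n w) c v }
  exact (LinearMap.toContinuousLinearMap L).contDiff.comp (F.contDiff_field y)

omit F in
-- Any `n + 1` vectors of `ℝⁿ` are dependent, so an alternating form of that degree is zero.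
theorem extDeriv_top (η : Form n n) : extDeriv η = 0 := by
  ext x v
  have h : ¬LinearIndependent ℝ v := fun h => by
    have := h.fintype_card_le_finrank
    simp at this
  exact (extDeriv η x).toAlternatingMap.map_linearDependent v h

theorem chart_lor_ξ_of_mem_n (X : 𝔫 F) : lor n F.ξ (toEnd X.1 F.O) = 0 := by
  have h1 := lor_eq_zero_of_mem_V X.2 F.T_ξ F.T_opp (by norm_num)
  rw [O_eq, map_smul, map_add, map_smul, map_add, h1, lor_toEnd_self]
  simp

theorem tangent_apply (p : F.P1) (X : 𝔫 F) :
    F.tangent p X = F.rot p.1 (F.chart (toEnd X.1 F.O)) := by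
  change F.chart (act p.1 (toEnd X.1 F.O)) = _
  rw [chart_act p.2, chart_lor_ξ_of_mem_n, neg_zero, zero_smul, zero_add]

theorem vol_apply (X : Fin n → 𝔫 F) :
    F.vol X = volForm n fun i => F.chart (toEnd (X i).1 F.O) := rfl

theorem lift_topForm (y : EuclideanSpace ℝ (Fin n)) (p : F.P1) :
    F.lift (F.topForm y) p = F.volTensor (Ad n (p.1)⁻¹ (F.field y (F.trans p.1))) := by
  ext X
  change Ad n (p.1)⁻¹ (volForm n (fun i => F.tangent p (X i)) • F.field y (F.trans p.1)) =
    F.vol X • Ad n (p.1)⁻¹ (F.field y (F.trans p.1))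
  simp only [tangent_apply]
  rw [map_smul, volForm_rot p.2, vol_apply]

theorem volTensor_injective : Function.Injective F.volTensor := fun v v' h => by
  have h1 := congrArg (fun f : (𝔫 F) [⋀^Fin n]→ₗ[ℝ] so n => f F.u) h
  change F.vol F.u • v = F.vol F.u • v' at h1
  rwa [vol_u, one_smul, one_smul] at h1

theorem lift_topForm_one (y : EuclideanSpace ℝ (Fin n)) :
    F.lift (F.topForm y) 1 = F.volTensor (F.root y) := by
  rw [lift_topForm]
  congr 1
  change Ad n (1 : SOPlus n)⁻¹ (F.field y (F.trans 1)) = _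
  rw [trans_one, field_zero, inv_one, map_one, Module.End.one_apply]

theorem lift_topForm_mul (y : EuclideanSpace ℝ (Fin n)) (g p : F.P1) (hg : F.rot g.1 y = y) :
    F.lift (F.topForm y) (g * p) = F.lift (F.topForm y) p := by
  rw [lift_topForm, lift_topForm]
  congr 1
  have h := Ad_field g.2 y (F.trans p.1)
  rw [hg, ← trans_mul g.2 p.2] at h
  change Ad n (g.1 * p.1)⁻¹ (F.field y (F.trans (g.1 * p.1))) = _
  rw [← h, mul_inv_rev, ← Module.End.mul_apply, ← map_mul, inv_mul_cancel_right]

/-- Invariance at the identity equates the fields of `y` and `rot g y` at `trans g`; `coinv`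
recovers the parameter of a field from any one of its values. -/
theorem rot_eq_of_lift (y : EuclideanSpace ℝ (Fin n)) (g : F.P1)
    (h : F.lift (F.topForm y) g = F.lift (F.topForm y) 1) : F.rot g.1 y = y := by
  rw [lift_topForm_one, lift_topForm] at h
  have h1 := F.volTensor_injective h
  have h2 := congrArg (Ad n g.1) h1
  rw [← Module.End.mul_apply, ← map_mul, mul_inv_cancel, map_one, Module.End.one_apply,
    ← field_zero, Ad_field g.2, map_zero, add_zero] at h2
  have h3 := congrArg F.coinv h2
  rw [coinv_field, coinv_field] at h3
  exact (smul_right_injective _ (two_ne_zero' ℝ) h3).symm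

theorem rot_of_mem_N {g : SOPlus n} (hg : g ∈ F.N) : F.rot g = 1 := by
  ext1 y
  obtain ⟨c, hc⟩ := hg.2 (F.incl y) (F.lor_ξ_incl y)
  rw [rot_apply, hc, map_add, map_smul, chart_incl, chart_ξ, smul_zero, add_zero]
  rfl

/-- The translations act transitively on the horosphere, so invariance propagates the value at the
identity to every point. -/
theorem eq_topForm {η : Form n n} {y : EuclideanSpace ℝ (Fin n)}
    (hN : ∀ ν : F.P1, ν.1 ∈ F.N → ∀ p : F.P1, F.lift η (ν * p) = F.lift η p)
    (h1 : F.lift η 1 = F.volTensor (F.root y)) : η = F.topForm y := by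
  ext1 x
  refine ContinuousAlternatingMap.toAlternatingMap_injective ?_
  refine Module.Basis.ext_alternating (EuclideanSpace.basisFun (Fin n) ℝ).toBasis fun v _ => ?_
  let p : F.P1 := ⟨F.ν x, F.ν_mem_P1 x⟩
  have h2 : F.lift η p = F.lift (F.topForm y) p := by
    have h3 := hN p (F.ν_mem_N x) 1
    have h4 := F.lift_topForm_mul y p 1 (by rw [F.rot_of_mem_N (F.ν_mem_N x)]; rfl)
    rw [mul_one] at h3 h4
    rw [h3, h4, h1, lift_topForm_one]
  have h5 : ∀ i, F.tangent p (F.u i) = (EuclideanSpace.basisFun (Fin n) ℝ).toBasis i := fun i => by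
    rw [tangent_apply, rot_ν]
    change F.chart (toEnd (wedge F.ξ (F.w i)) F.O) = _
    rw [wedge_apply, F.w_O, F.ξ_O, zero_smul, zero_sub, neg_smul, neg_neg, one_smul, w_eq_incl,
      chart_incl]
    simp
  have h6 := congrArg (fun f : (𝔫 F) [⋀^Fin n]→ₗ[ℝ] so n => f (F.u ∘ v)) h2
  have h7 : ∀ ζ : Form n n, F.lift ζ p (F.u ∘ v) =
      Ad n (F.ν x)⁻¹ (ζ x ((EuclideanSpace.basisFun (Fin n) ℝ).toBasis ∘ v)) := fun ζ => by
    change Ad n (F.ν x)⁻¹ (ζ (F.trans (F.ν x)) fun i => F.tangent p (F.u (v i))) = _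
    rw [trans_ν]
    simp only [h5]
    rfl
  simp only [h7] at h6
  have h8 := congrArg (Ad n (F.ν x)) h6
  simp only [← Module.End.mul_apply, ← map_mul, mul_inv_cancel, map_one, Module.End.one_apply] at h8
  exact h8

/-! ### The Cartan involution -/

theorem Θ_wedge (a b : LSpace n) : F.Θ (wedge a b) = wedge (F.sym a) (F.sym b) := by
  refine so_ext fun x => ?_
  change F.sym (toEnd (wedge a b) (F.sym x)) = _
  rw [wedge_apply, wedge_apply, map_sub, map_smul, map_smul, lor_sym, lor_sym]

theorem Θ_root (y : EuclideanSpace ℝ (Fin n)) : F.Θ (F.root y) = -wedge F.ξ (F.incl y) := by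
  have h1 : F.sym F.opp = F.ξ := by
    rw [sym_apply, opp, map_sub, map_smul, lor_O_O, lor_O_ξ]
    module
  have h2 : F.sym (F.incl y) = -F.incl y := by
    rw [sym_apply, lor_O_incl]
    module
  rw [root_apply, Θ_wedge, h1, h2, ← wedgeB_apply, map_neg, wedgeB_apply]

variable {F} in
-- `Θ` exchanges the null directions, so `Θ (root y)` is `ξ ∧ y` up to sign. The motion of `y` by
-- `g` is only along `ξ`, which the wedge with `ξ` removes.
theorem Ad_Θ_root {g : SOPlus n} (hg : g ∈ F.P1) {y : EuclideanSpace ℝ (Fin n)}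
    (hy : F.rot g y = y) : Ad n g (F.Θ (F.root y)) = F.Θ (F.root y) := by
  rw [Θ_root, map_neg, Ad_wedge, P1.act_ξ hg, act_incl hg, hy]
  rw [← wedgeB_apply, map_add, map_smul, wedgeB_apply, wedgeB_apply, wedge_self, smul_zero,
    add_zero]

/-! ### The cochains of the invariant forms -/

theorem integrableOn_field (y a : EuclideanSpace ℝ (Fin n)) (q : Fin n → EuclideanSpace ℝ (Fin n)) :
    MeasureTheory.IntegrableOn (fun t : Fin n → ℝ => F.field y (a + ∑ i : Fin n, t i • q i))
      (stdSimplexCorner n) := by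
  refine ContinuousOn.integrableOn_compact (isCompact_corner n) (Continuous.continuousOn ?_)
  refine (F.contDiff_field y).continuous.comp ?_
  fun_prop

variable {F} in
theorem Ad_topIntegral {g : SOPlus n} (hg : g ∈ F.P1) (y : EuclideanSpace ℝ (Fin n))
    (p : Fin (n + 1) → EuclideanSpace ℝ (Fin n)) :
    Ad n g (topIntegral (F.field y) p) =
      topIntegral (F.field (F.rot g y)) fun j => F.trans g + F.rot g (p j) := by
  have h := (LinearMap.toContinuousLinearMap (Ad n g)).integral_comp_comm
    (F.integrableOn_field y (p 0) fun i => p i.succ - p 0)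
  rw [topIntegral_eq, topIntegral_eq, map_smul]
  simp only [add_sub_add_left_eq_sub, ← map_sub]
  rw [volForm_rot hg]
  refine congrArg _ (h.symm.trans (congrArg _ (funext fun t => ?_)))
  rw [LinearMap.coe_toContinuousLinearMap', Ad_field hg]
  simp only [← map_smul, ← map_sum]
  rw [map_add, add_assoc]

/-- The homogeneous cochain of the invariant form with initial value given by `y`. -/
noncomputable def homCochain (Δ : Subgroup (SOPlus n)) :
    EuclideanSpace ℝ (Fin n) →ₗ[ℝ] ((Fin (n + 1) → Δ) → so n) where
  toFun y x := topIntegral (F.field y) fun j => F.trans (x j)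
  map_add' y y' := by
    ext1 x
    rw [Pi.add_apply, topIntegral_eq, topIntegral_eq, topIntegral_eq, ← smul_add]
    simp only [field_add]
    rw [MeasureTheory.integral_add (F.integrableOn_field _ _ _) (F.integrableOn_field _ _ _)]
  map_smul' c y := by
    ext1 x
    rw [Pi.smul_apply, RingHom.id_apply, topIntegral_eq, topIntegral_eq, smul_comm c]
    simp only [field_smul]
    rw [MeasureTheory.integral_smul]

theorem homCochain_apply (Δ : Subgroup (SOPlus n)) (y : EuclideanSpace ℝ (Fin n))
    (x : Fin (n + 1) → Δ) :
    F.homCochain Δ y x = topIntegral (F.field y) fun j => F.trans (x j) := rfl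

theorem hd_homCochain (Δ : Subgroup (SOPlus n)) (y : EuclideanSpace ℝ (Fin n)) :
    hd ℝ (n + 1) (F.homCochain Δ y) = 0 := by
  ext1 x
  exact sum_topIntegral ((F.contDiff_field y).of_le (by exact_mod_cast le_top))
    fun j => F.trans (x j)

/-- The restriction of the adjoint representation to a group of isometries. -/
noncomputable abbrev adRes (Δ : Subgroup (SOPlus n)) : Representation ℝ Δ (so n) := (Ad n).comp Δ.subtype

variable {F} in
theorem tr_homCochain {Δ : Subgroup (SOPlus n)} (hΔ : Δ ≤ F.P1) (g : Δ)
    (y : EuclideanSpace ℝ (Fin n)) :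
    tr (adRes Δ) g (F.homCochain Δ y) = F.homCochain Δ (F.rot g y) := by
  ext1 x
  rw [tr_apply, homCochain_apply, homCochain_apply]
  refine (Ad_topIntegral (hΔ g.2) y _).trans (congrArg _ (funext fun j => ?_))
  rw [← trans_mul (hΔ g.2) (hΔ (g⁻¹ * x j).2)]
  congr 1
  exact mul_inv_cancel_left g.1 (x j).1

end Frame

end HypCusp

/-! ### Coinvariants and the fundamental class of a cusp -/

namespace HypCusp

open CornerSimplex HomCochain

namespace Frame

section Coinvariants

variable {n : ℕ} {F : Frame n}

/-- The translation by `a` moves `O ∧ ξ` by `a ∧ ξ`, which is linear in `a`; hence a basis of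
translations suffices. -/
theorem wedge_ξ_incl_mem {S : Submodule ℝ (so n)}
    (τ : Module.Basis (Fin n) ℝ (EuclideanSpace ℝ (Fin n)))
    (hS : ∀ j X, Ad n (F.ν (τ j)) X - X ∈ S) (a : EuclideanSpace ℝ (Fin n)) :
    wedge F.ξ (F.incl a) ∈ S := by
  have h : (⊤ : Submodule ℝ (EuclideanSpace ℝ (Fin n))) ≤
      S.comap (wedgeB n F.ξ ∘ₗ F.incl) := by
    rw [← τ.span_eq, Submodule.span_le]
    rintro _ ⟨j, rfl⟩
    refine S.neg_mem_iff.mp ?_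
    have h1 := hS j (wedge F.O F.ξ)
    rw [Ad_wedge, act_ν, act_ν, unip_ξ, unip_O, ← wedgeB_apply, map_add, map_add,
      LinearMap.add_apply, LinearMap.add_apply, map_smul, LinearMap.smul_apply, wedgeB_apply,
      wedgeB_apply, wedgeB_apply, wedge_self, smul_zero, add_zero, add_sub_cancel_left,
      wedge_swap] at h1
    exact h1
  exact h (Submodule.mem_top (x := a))

/-- The displacement of `O ∧ b` under the translation by `a` is this element plus quadratic terms in
`ξ ∧ 𝔫`-directions already known to lie in `S`. What remains is linear in `a`, so it extends from
the basis to all `a`. -/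
theorem smul_wedge_add_mem {S : Submodule ℝ (so n)}
    (τ : Module.Basis (Fin n) ℝ (EuclideanSpace ℝ (Fin n)))
    (hS : ∀ j X, Ad n (F.ν (τ j)) X - X ∈ S) (a b : EuclideanSpace ℝ (Fin n)) :
    (inner ℝ b a : ℝ) • wedge F.O F.ξ - wedge (F.incl b) (F.incl a) ∈ S := by
  have h : (⊤ : Submodule ℝ (EuclideanSpace ℝ (Fin n))) ≤
      S.comap (((innerₛₗ ℝ b).smulRight (wedge F.O F.ξ)) - wedgeB n (F.incl b) ∘ₗ F.incl) := by
    rw [← τ.span_eq, Submodule.span_le]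
    rintro _ ⟨j, rfl⟩
    have h1 := hS j (wedge F.O (F.incl b))
    have h2 := S.smul_mem (inner ℝ b (τ j)) (wedge_ξ_incl_mem τ hS (τ j))
    have h3 := S.smul_mem (‖τ j‖ ^ 2 / 2) (wedge_ξ_incl_mem τ hS b)
    have h4 := S.sub_mem (S.add_mem h1 h2) h3
    rw [Ad_wedge, act_ν, act_ν, unip_incl, unip_O, ← wedgeB_apply] at h4
    simp only [map_add, map_smul, LinearMap.add_apply, LinearMap.smul_apply, wedgeB_apply,
      wedge_self, wedge_swap (F.incl (τ j)), real_inner_comm] at h4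
    change (inner ℝ b (τ j) : ℝ) • wedge F.O F.ξ - wedge (F.incl b) (F.incl (τ j)) ∈ S
    convert h4 using 1
    rw [real_inner_comm]
    module
  exact h (Submodule.mem_top (x := a))

theorem mem_of_coinv_eq_zero (hn : 1 ≤ n) {S : Submodule ℝ (so n)}
    (τ : Module.Basis (Fin n) ℝ (EuclideanSpace ℝ (Fin n)))
    (hS : ∀ j X, Ad n (F.ν (τ j)) X - X ∈ S) {X : so n} (hX : F.coinv X = 0) : X ∈ S := by
  -- Taking both arguments equal to a unit vector kills the wedge term; this requires `n ≥ 1`.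
  have hOξ : wedge F.O F.ξ ∈ S := by
    have h := smul_wedge_add_mem τ hS (EuclideanSpace.single ⟨0, hn⟩ 1)
      (EuclideanSpace.single ⟨0, hn⟩ 1)
    rw [wedge_self, sub_zero, real_inner_self_eq_norm_sq] at h
    simpa using h
  have hww : ∀ a b, wedge (F.incl b) (F.incl a) ∈ S := fun a b =>
    (S.sub_mem_iff_right (S.smul_mem _ hOξ)).mp (smul_wedge_add_mem τ hS a b)
  set c : ℝ := -lor n F.O (toEnd X F.ξ) with hc
  set β := F.chart (toEnd X F.O) with hβ
  have hXξ : toEnd X F.ξ = c • F.ξ := by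
    have h := F.eq_smul_ξ (lor_toEnd_self X F.ξ)
    rwa [← coinv_apply, hX, map_zero, zero_add] at h
  -- Removing the components along `T` and `𝔫_ξ` leaves an infinitesimal rotation fixing `ξ` and
  -- `O`, which is a combination of the `w_i ∧ w_j`.
  set Z := X - c • wedge F.O F.ξ - wedge F.ξ (F.incl β) with hZ
  have hZapp : ∀ x, toEnd Z x = toEnd X x - c • (lor n F.ξ x • F.O - lor n F.O x • F.ξ) -
      (lor n (F.incl β) x • F.ξ - lor n F.ξ x • F.incl β) := fun x => by
    rw [hZ, map_sub, map_sub, map_smul, sub_apply, sub_apply, smul_apply, wedge_apply, wedge_apply]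
  have hZξ : toEnd Z F.ξ = 0 := by
    rw [hZapp, hXξ, F.ξ_null, lor_O_ξ, lor_comm _ F.ξ, lor_ξ_incl]
    module
  have hZO : toEnd Z F.O = 0 := by
    have h1 := toEnd_skew X F.ξ F.O
    rw [hXξ, map_smul, LinearMap.smul_apply, F.ξ_O, smul_eq_mul] at h1
    have h2 : lor n F.ξ (toEnd X F.O) = c := by linarith
    have h3 := F.expand (toEnd X F.O)
    rw [h2, lor_toEnd_self, ← hβ] at h3
    rw [hZapp, h3, F.ξ_O, lor_O_O, lor_comm _ F.O, lor_O_incl]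
    module
  have hZw : ∀ i, toEnd Z (F.w i) = F.incl (F.chart (toEnd Z (F.w i))) := fun i => by
    have h1 := toEnd_skew Z F.ξ (F.w i)
    have h2 := toEnd_skew Z F.O (F.w i)
    rw [hZξ, map_zero, LinearMap.zero_apply, zero_add] at h1
    rw [hZO, map_zero, LinearMap.zero_apply, zero_add] at h2
    conv_lhs => rw [F.eq_smul_ξ h1, h2, neg_zero, zero_smul, add_zero]
  have hZmem : Z ∈ S := by
    have h : Z = (1 / 2 : ℝ) • ∑ l, wedge (toEnd Z (F.w l)) (F.w l) := by
      refine sub_eq_zero.mp (F.so_eq_zero ?_ ?_ fun j => ?_)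
      all_goals
        simp only [map_sub, map_smul, map_sum, sub_apply, smul_apply, sum_apply, wedge_apply]
      · simp only [hZξ, F.w_ξ, lor_comm _ F.ξ]
        simp only [fun l => (by rw [hZw l, lor_ξ_incl] : lor n F.ξ (toEnd Z (F.w l)) = 0)]
        simp
      · simp only [hZO, F.w_O, lor_comm _ F.O]
        simp only [fun l => (by rw [hZw l, lor_O_incl] : lor n F.O (toEnd Z (F.w l)) = 0)]
        simp
      · have h1 : ∀ l, lor n (toEnd Z (F.w l)) (F.w j) = -lor n (F.w l) (toEnd Z (F.w j)) :=
          fun l => by linarith [toEnd_skew Z (F.w l) (F.w j)]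
        have h2 : ∑ l, lor n (F.w l) (toEnd Z (F.w j)) • F.w l = toEnd Z (F.w j) := by
          conv_rhs => rw [hZw j, incl_apply]
          rfl
        simp only [h1, neg_smul, sub_neg_eq_add, Finset.sum_add_distrib, h2, F.w_w, ite_smul,
          one_smul, zero_smul, Finset.sum_ite_eq', Finset.mem_univ, if_true]
        module
    rw [h]
    refine S.smul_mem _ (S.sum_mem fun l _ => ?_)
    rw [hZw l, w_eq_incl]
    exact hww _ _
  have h := S.add_mem (S.add_mem hZmem (wedge_ξ_incl_mem τ hS β)) (S.smul_mem c hOξ)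
  rwa [hZ, sub_add_cancel, sub_add_cancel] at h

end Coinvariants

theorem hd_comp {G V W : Type*} [AddCommGroup V] [Module ℝ V] [AddCommGroup W] [Module ℝ W]
    (φ : V →ₗ[ℝ] W) {q : ℕ} (b : (Fin q → G) → V) :
    hd ℝ q (fun x => φ (b x)) = fun x => φ (hd ℝ q b x) := by
  ext1 x
  simp only [hd_apply, map_sum, map_smul]

section FundamentalClass

variable {n : ℕ} {F : Frame n}

theorem coinv_homCochain (Δ : Subgroup (SOPlus n)) (y : EuclideanSpace ℝ (Fin n))
    (x : Fin (n + 1) → Δ) :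
    F.coinv (F.homCochain Δ y x) =
      volForm n (fun i => F.trans (x i.succ).1 - F.trans (x 0).1) •
        MeasureTheory.volume.real (stdSimplexCorner n) • (2 : ℝ) • y := by
  have h := (LinearMap.toContinuousLinearMap F.coinv).integral_comp_comm
    (F.integrableOn_field y (F.trans (x 0).1) fun i => F.trans (x i.succ).1 - F.trans (x 0).1)
  rw [homCochain_apply, topIntegral_eq, map_smul]
  refine congrArg _ (h.symm.trans ?_)
  simp only [LinearMap.coe_toContinuousLinearMap', coinv_field]
  rw [MeasureTheory.setIntegral_const]

/-- Successive rows of partial sums differ by the original vectors, so row operations identify the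
determinants. -/
theorem volForm_partialSum {n : ℕ} (v : Fin n → EuclideanSpace ℝ (Fin n)) :
    volForm n (fun i => Fin.partialSum v i.succ) = volForm n v := by
  cases n with
  | zero => exact congrArg _ (Subsingleton.elim _ _)
  | succ m =>
    rw [volForm_apply, volForm_apply]
    refine Matrix.det_eq_of_forall_row_eq_smul_add_pred (fun _ => 1) (fun j => ?_) fun i j => ?_
    · simp [Fin.partialSum_succ]
    · rw [Matrix.of_apply, Fin.partialSum_succ, one_mul, PiLp.add_apply]
      exact add_comm _ _

theorem partialProd_ν {Δ : Subgroup (SOPlus n)} {q : ℕ} {e : Fin q → Δ}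
    {v : Fin q → EuclideanSpace ℝ (Fin n)} (he : ∀ j, (e j).1 = F.ν (v j)) (j : Fin (q + 1)) :
    (Fin.partialProd e j).1 = F.ν (Fin.partialSum v j) := by
  induction j using Fin.induction with
  | zero => rw [Fin.partialProd_zero, Fin.partialSum_zero, ν_zero, OneMemClass.coe_one]
  | succ i ih => rw [Fin.partialProd_succ, Fin.partialSum_succ, ν_add, Subgroup.coe_mul, ih, he]

theorem volForm_basis_ne_zero (τ : Module.Basis (Fin n) ℝ (EuclideanSpace ℝ (Fin n))) :
    volForm n τ ≠ 0 := by
  have h := (EuclideanSpace.basisFun (Fin n) ℝ).toBasis.isUnit_det τ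
  rw [Module.Basis.det_apply, ← Matrix.det_transpose] at h
  exact h.ne_zero

/-- Each of the `n!` simplices has signed volume form `sign σ` times that of `τ`; the sign in the
cycle squares it away, so all simplices contribute equally. -/
theorem torusEval_coinv (Δ : Subgroup (SOPlus n))
    (τ : Module.Basis (Fin n) ℝ (EuclideanSpace ℝ (Fin n))) {e : Fin n → Δ}
    (he : ∀ j, (e j).1 = F.ν (τ j)) (y : EuclideanSpace ℝ (Fin n)) (i : Fin n) :
    torusEval e (fun x => F.coinv (F.homCochain Δ y x) i) =
      n.factorial * (volForm n τ * (MeasureTheory.volume.real (stdSimplexCorner n) * (2 * y i))) := by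
  have h : ∀ σ : Equiv.Perm (Fin n),
      F.coinv (F.homCochain Δ y (Fin.partialProd (e ∘ σ))) i =
        ((Equiv.Perm.sign σ : ℤ) : ℝ) *
          (volForm n τ * (MeasureTheory.volume.real (stdSimplexCorner n) * (2 * y i))) := fun σ => by
    have h1 : ∀ j, F.trans (Fin.partialProd (e ∘ σ) j).1 = Fin.partialSum (τ ∘ σ) j := fun j => by
      rw [partialProd_ν (e := e ∘ σ) (v := τ ∘ σ) (fun j => he (σ j)), trans_ν]
    rw [coinv_homCochain]
    simp only [h1, Fin.partialSum_zero, sub_zero]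
    rw [volForm_partialSum]
    have h2 : volForm n (τ ∘ σ) = Equiv.Perm.sign σ • volForm n τ :=
      (volForm n).toAlternatingMap.map_perm τ σ
    rw [h2]
    simp only [PiLp.smul_apply, smul_eq_mul]
    rw [Units.smul_def, zsmul_eq_mul, mul_assoc]
  rw [torusEval]
  simp only [h, ← mul_assoc (((Equiv.Perm.sign _ : ℤ) : ℝ)), ← Int.cast_mul, ← Units.val_mul,
    Int.units_mul_self]
  simp [Finset.card_univ, Fintype.card_perm]

/-- The invariant forms with initial values in `V₋₂` have linearly independent classes on a
lattice of translations. -/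
theorem eq_zero_of_homCochain_eq (hn : 1 ≤ n) {Δ : Subgroup (SOPlus n)}
    (τ : Module.Basis (Fin n) ℝ (EuclideanSpace ℝ (Fin n))) {e : Fin n → Δ}
    (he : ∀ j, (e j).1 = F.ν (τ j)) {y : EuclideanSpace ℝ (Fin n)} {b : (Fin n → Δ) → so n}
    (hb : ∀ j, tr (adRes Δ) (e j) b = b) (h : hd ℝ n b = F.homCochain Δ y) : y = 0 := by
  obtain ⟨m, rfl⟩ : ∃ m, n = m + 1 := ⟨n - 1, by omega⟩
  ext i
  have hcomm : ∀ i j, Commute (e i) (e j) := fun i j => Subtype.ext (by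
    rw [Subgroup.coe_mul, Subgroup.coe_mul, he, he, ← ν_add, ← ν_add, add_comm (τ i)])
  -- A coordinate of `coinv` turns the twisted cochain into one with trivial real coefficients, to
  -- which the fundamental cycle applies.
  let φ : so (m + 1) →ₗ[ℝ] ℝ := EuclideanSpace.projₗ i ∘ₗ F.coinv
  have h1 := torusEval_hd e hcomm (fun x => φ (b x)) fun j x => by
    conv_lhs => rw [← hb j, tr_apply]
    simp only [inv_mul_cancel_left]
    change F.coinv (Ad _ (e j).1 (b x)) i = F.coinv (b x) i
    rw [he, coinv_Ad_ν]
  rw [hd_comp, h] at h1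
  have h2 := (torusEval_coinv Δ τ he y i).symm.trans h1
  have h3 : MeasureTheory.volume.real (stdSimplexCorner (m + 1)) ≠ 0 :=
    (ENNReal.toReal_pos (volume_corner_pos _).ne' (volume_corner_lt_top _).ne).ne'
  simpa [volForm_basis_ne_zero, h3, Nat.factorial_ne_zero] using h2

end FundamentalClass

end Frame

end HypCusp

/-! ### Cusp groups of full rank are crystallographic -/

namespace Bieberbach

/-- Pigeonhole: the pairs of linear and translation parts lie in a compact set, so infinitely many
elements would include two whose quotient is close to the identity. -/
theorem finite_of_isolated {E : Type*} [NormedAddCommGroup E] [NormedSpace ℝ E]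
    [FiniteDimensional ℝ E] {G : Type*} [Group G] {A : G →* (E →L[ℝ] E)} {t : G → E}
    (hA : ∀ g x, ‖A g x‖ = ‖x‖) (ht : ∀ g h, t (g * h) = t g + A g (t h)) {ε : ℝ} (hε : 0 < ε)
    (hiso : ∀ g, ‖A g - 1‖ < ε → ‖t g‖ < ε → g = 1) (R : ℝ) : {g | ‖t g‖ ≤ R}.Finite := by
  by_contra hinf
  have : ProperSpace (E →L[ℝ] E) := FiniteDimensional.proper ℝ _
  have : ProperSpace E := FiniteDimensional.proper ℝ _
  have hnorm : ∀ g, ‖A g‖ ≤ 1 := fun g =>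
    (A g).opNorm_le_bound zero_le_one fun x => by rw [hA, one_mul]
  obtain ⟨g₀, hg₀⟩ := Set.Infinite.nonempty hinf
  have hR : 0 ≤ R := (norm_nonneg _).trans hg₀
  -- The quotient of two elements in one ball has linear part within `2 δ` of the identity and
  -- translation part below `2 δ (1 + R)`; both are less than `2 δ (R + 2) = ε`.
  set δ := ε / (2 * (R + 2)) with hδ
  have hδ0 : 0 < δ := by positivity
  obtain ⟨c, -, hc, hcov⟩ := ((isCompact_closedBall (0 : E →L[ℝ] E) 1).prod
    (isCompact_closedBall (0 : E) R)).finite_cover_balls hδ0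
  have hmem : ∀ g ∈ {g | ‖t g‖ ≤ R}, ∃ z ∈ c, (A g, t g) ∈ Metric.ball z δ := fun g hg => by
    have := hcov (show (A g, t g) ∈ _ from
      ⟨mem_closedBall_zero_iff.mpr (hnorm g), mem_closedBall_zero_iff.mpr hg⟩)
    simpa using this
  choose! z hz hzb using hmem
  obtain ⟨g, hg, h, hh, hne, hgh⟩ := Set.Infinite.exists_ne_map_eq_of_mapsTo hinf hz hc
  have hd : dist (A g, t g) (A h, t h) < 2 * δ := by
    have h1 := Metric.mem_ball.mp (hzb g hg)
    have h2 := Metric.mem_ball'.mp (hzb h hh)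
    rw [← hgh] at h2
    linarith [dist_triangle (A g, t g) (z g) (A h, t h)]
  rw [Prod.dist_eq, max_lt_iff, dist_eq_norm, dist_eq_norm] at hd
  obtain ⟨hdA, hdt⟩ := hd
  refine hne (mul_inv_eq_one.mp (hiso (g * h⁻¹) ?_ ?_))
  all_goals
    have h1 : A (g * h⁻¹) * A h = A g := by rw [← map_mul, inv_mul_cancel_right]
    have h2 : A (g * h⁻¹) - 1 = (A g - A h) * A h⁻¹ := by
      rw [sub_mul, ← map_mul, ← map_mul, mul_inv_cancel, map_one]
    have h3 : ‖A (g * h⁻¹) - 1‖ < 2 * δ := by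
      rw [h2]
      refine (norm_mul_le _ _).trans_lt ?_
      nlinarith [hnorm h⁻¹, norm_nonneg (A g - A h)]
    have h6 : 2 * δ * (R + 2) = ε := by
      rw [hδ]
      field_simp
  · nlinarith
  · have h4 : t (g * h⁻¹) = (t g - t h) - (A (g * h⁻¹) - 1) (t h) := by
      have h5 := ht (g * h⁻¹) h
      rw [inv_mul_cancel_right] at h5
      rw [h5, sub_apply, one_apply_eq_self]
      abel
    rw [h4]
    refine (norm_sub_le _ _).trans_lt ?_
    have h5 := (A (g * h⁻¹) - 1).le_opNorm (t h)
    have h7 : ‖A (g * h⁻¹) - 1‖ * ‖t h‖ ≤ 2 * δ * R :=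
      mul_le_mul h3.le hh (norm_nonneg _) (by positivity)
    nlinarith

end Bieberbach

namespace HypCusp

open Bieberbach Topology

theorem continuous_lor {X : Type*} [TopologicalSpace X] {n : ℕ} {f g : X → LSpace n}
    (hf : Continuous f) (hg : Continuous g) : Continuous fun x => lor n (f x) (g x) := by
  simp only [lor_apply]
  fun_prop

namespace Frame

variable {n : ℕ} {F : Frame n}

theorem eq_ν_of_rot {g : SOPlus n} (hg : g ∈ F.P1) (h : F.rot g = 1) : g = F.ν (F.trans g) :=
  eq_of_rot_trans hg (F.ν_mem_P1 _) (h.trans (F.rot_ν _).symm) (F.trans_ν _).symm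

theorem act_eq {g : SOPlus n} (hg : g ∈ F.P1) (x : LSpace n) :
    act g x = F.unip (F.trans g) (x + F.incl ((F.rot g - 1) (F.chart x))) := by
  obtain ⟨k, hk, hkt, hkr, hgk⟩ := exists_rotation hg 0
  rw [ν_zero, mul_one, map_zero, add_zero] at hgk
  conv_lhs => rw [hgk, act_mul, act_ν]
  congr 1
  conv_lhs => rw [F.expand x, map_add, map_sub, map_smul, map_smul, P1.act_ξ hk,
    act_O_of_trans hk hkt, act_incl_of_trans hk hkt, hkr]
  conv_rhs => rw [sub_apply, one_apply_eq_self, map_sub]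
  nth_rw 5 [F.expand x]
  abel

variable (F) in
/-- The linear map whose restriction to the horosphere has the given linear and translation
parts. -/
noncomputable def affineAct (a : EuclideanSpace ℝ (Fin n))
    (B : EuclideanSpace ℝ (Fin n) →L[ℝ] EuclideanSpace ℝ (Fin n)) : LSpace n →L[ℝ] LSpace n :=
  F.unip a ∘L (1 + LinearMap.toContinuousLinearMap F.incl ∘L
    (B - 1) ∘L LinearMap.toContinuousLinearMap F.chart)

variable (F) in
theorem affineAct_apply (a : EuclideanSpace ℝ (Fin n))
    (B : EuclideanSpace ℝ (Fin n) →L[ℝ] EuclideanSpace ℝ (Fin n)) (x : LSpace n) :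
    F.affineAct a B x = F.unip a (x + F.incl ((B - 1) (F.chart x))) := rfl

theorem affineAct_rot {g : SOPlus n} (hg : g ∈ F.P1) :
    F.affineAct (F.trans g) (F.rot g) = act g :=
  ContinuousLinearMap.ext fun x => (act_eq hg x).symm

variable (F) in
theorem continuous_affineAct : Continuous fun q : EuclideanSpace ℝ (Fin n) ×
    (EuclideanSpace ℝ (Fin n) →L[ℝ] EuclideanSpace ℝ (Fin n)) => F.affineAct q.1 q.2 := by
  rw [continuous_clm_apply]
  intro x
  have hB : Continuous fun q : EuclideanSpace ℝ (Fin n) ×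
      (EuclideanSpace ℝ (Fin n) →L[ℝ] EuclideanSpace ℝ (Fin n)) => (q.2 - 1) (F.chart x) := by
    fun_prop
  have hu : Continuous fun q : EuclideanSpace ℝ (Fin n) ×
      (EuclideanSpace ℝ (Fin n) →L[ℝ] EuclideanSpace ℝ (Fin n)) =>
      x + F.incl ((q.2 - 1) (F.chart x)) :=
    continuous_const.add (F.incl.continuous_of_finiteDimensional.comp hB)
  have hi : Continuous fun q : EuclideanSpace ℝ (Fin n) ×
      (EuclideanSpace ℝ (Fin n) →L[ℝ] EuclideanSpace ℝ (Fin n)) => F.incl q.1 :=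
    F.incl.continuous_of_finiteDimensional.comp continuous_fst
  have hξ := continuous_lor (continuous_const (y := F.ξ)) hu
  have hn : Continuous fun q : EuclideanSpace ℝ (Fin n) ×
      (EuclideanSpace ℝ (Fin n) →L[ℝ] EuclideanSpace ℝ (Fin n)) => ‖q.1‖ ^ 2 / 2 := by fun_prop
  have h := (hu.sub (hξ.smul hi)).add
    (((continuous_lor hi hu).sub (hn.mul hξ)).smul (continuous_const (y := F.ξ)))
  simp only [affineAct_apply, unip_apply]
  exact h

/-- The topology of the group is induced from the space of operators, so isolation of the identity
is visible there. -/
theorem exists_nhds_of_discrete {Γ : Subgroup (SOPlus n)} (hΓ : DiscreteTopology Γ) :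
    ∃ W ∈ 𝓝 (1 : LSpace n →L[ℝ] LSpace n), ∀ g ∈ Γ, act g ∈ W → g = 1 := by
  have hind : IsInducing fun g : Γ => act g.1 :=
    (Units.isOpenEmbedding_val.isInducing.comp IsInducing.subtypeVal).comp IsInducing.subtypeVal
  have h1 := hind.nhds_eq_comap 1
  rw [nhds_discrete] at h1
  obtain ⟨W, hW, hWsub⟩ : ({1} : Set Γ) ∈ Filter.comap (fun g : Γ => act g.1) (𝓝 (act (1 : Γ).1)) :=
    h1 ▸ Filter.mem_pure.mpr rfl
  exact ⟨W, hW, fun g hg hgW =>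
    congrArg Subtype.val (show (⟨g, hg⟩ : Γ) = 1 from hWsub hgW)⟩

variable (F) in
/-- The trivial element of a discrete group is isolated among the isometries of the horosphere. -/
theorem exists_isolated {Γ : Subgroup (SOPlus n)} (hΓ : DiscreteTopology Γ) :
    ∃ ε > 0, ∀ g ∈ Γ, g ∈ F.P1 → ‖F.rot g - 1‖ < ε → ‖F.trans g‖ < ε → g = 1 := by
  obtain ⟨W, hW, hWΓ⟩ := exists_nhds_of_discrete hΓ
  have h1 : F.affineAct 0 1 = 1 := ContinuousLinearMap.ext fun x => by
    rw [affineAct_apply, sub_self, zero_apply, map_zero, add_zero, unip_zero]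
    rfl
  have h2 := F.continuous_affineAct.tendsto (0, 1)
  rw [h1] at h2
  obtain ⟨ε, hε, hball⟩ := Metric.mem_nhds_iff.mp (h2 hW)
  refine ⟨ε, hε, fun g hgΓ hg hr ht => hWΓ g hgΓ ?_⟩
  rw [← affineAct_rot hg]
  refine hball (a := (F.trans g, F.rot g)) (Metric.mem_ball.mpr ?_)
  rw [Prod.dist_eq, max_lt_iff, dist_zero_right, dist_eq_norm]
  exact ⟨ht, hr⟩

/-- The linear parts of the isometries of the horosphere. -/
noncomputable def rotHom {Δ : Subgroup (SOPlus n)} (hΔ : Δ ≤ F.P1) :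
    Δ →* (EuclideanSpace ℝ (Fin n) →L[ℝ] EuclideanSpace ℝ (Fin n)) where
  toFun g := F.rot g.1
  map_one' := F.rot_one
  map_mul' g h := rot_mul (hΔ g.2) (hΔ h.2)

theorem rotHom_apply {Δ : Subgroup (SOPlus n)} (hΔ : Δ ≤ F.P1) (g : Δ) :
    rotHom hΔ g = F.rot g.1 := rfl

theorem mem_P1_of_lor {g : SOPlus n} (hg : g ∈ F.P) {x : LSpace n} (hx : lor n F.ξ x = -1)
    (hgx : lor n F.ξ (act g x) = -1) : g ∈ F.P1 := by
  obtain ⟨c, -, hc⟩ := hg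
  have h := lor_act g F.ξ x
  rw [hc, map_smul, LinearMap.smul_apply, hgx, hx, smul_eq_mul] at h
  have h1 : c = 1 := by linarith
  rw [h1, one_smul] at hc
  exact hc

/-- An element bringing the point with coordinate `x` into the compact set has an inverse whose
translation part lies within the radius of that set from `x`. -/
theorem exists_trans_close {Γ : Subgroup (SOPlus n)} (hfull : F.IsFullRank Γ) :
    ∃ R : ℝ, ∀ x, ∃ g ∈ Γ ⊓ F.P1, ‖F.trans g - x‖ ≤ R := by
  obtain ⟨C, hC, hCsub, hcov⟩ := hfull
  obtain ⟨R, hR⟩ := (hC.image F.chart.continuous_of_finiteDimensional).isBounded.exists_norm_le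
  refine ⟨R, fun x => ?_⟩
  have hx : act (F.ν x) F.O ∈ F.horosphere :=
    ⟨(F.ν x).2.2.2 _ F.O_mem, by rw [P1.lor_ξ_act (F.ν_mem_P1 x), F.ξ_O]⟩
  obtain ⟨γ, hγ, hγC⟩ := hcov _ hx
  have hγ1 : γ ∈ F.P1 := mem_P1_of_lor hγ.2 hx.2 (hCsub hγC).2
  refine ⟨γ⁻¹, inv_mem ⟨hγ.1, hγ1⟩, ?_⟩
  have h1 : ‖F.trans (γ * F.ν x)‖ ≤ R := hR _ (Set.mem_image_of_mem _ hγC)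
  have h2 := trans_mul (F.P1.inv_mem hγ1) (F.P1.mul_mem hγ1 (F.ν_mem_P1 x))
  rw [inv_mul_cancel_left, trans_ν] at h2
  rwa [h2, sub_add_cancel_left, norm_neg, norm_rot (F.P1.inv_mem hγ1)]

theorem norm_rotHom {Δ : Subgroup (SOPlus n)} (hΔ : Δ ≤ F.P1) (g : Δ)
    (x : EuclideanSpace ℝ (Fin n)) : ‖rotHom hΔ g x‖ = ‖x‖ := by
  rw [rotHom_apply, norm_rot (hΔ g.2)]

theorem trans_mul_rotHom {Δ : Subgroup (SOPlus n)} (hΔ : Δ ≤ F.P1) (g h : Δ) :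
    F.trans (g * h : Δ).1 = F.trans g.1 + rotHom hΔ g (F.trans h.1) := by
  rw [rotHom_apply, Subgroup.coe_mul, trans_mul (hΔ g.2) (hΔ h.2)]

theorem finite_trans_le {Γ Δ : Subgroup (SOPlus n)} (hΓ : DiscreteTopology Γ)
    (hΔΓ : Δ ≤ Γ) (hΔ : Δ ≤ F.P1) (R : ℝ) : {g : Δ | ‖F.trans g.1‖ ≤ R}.Finite := by
  obtain ⟨ε, hε, hiso⟩ := F.exists_isolated hΓ
  exact finite_of_isolated (t := fun g : Δ => F.trans g.1) (norm_rotHom hΔ) (trans_mul_rotHom hΔ) hε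
    (fun g h1 h2 => Subtype.ext (hiso g.1 (hΔΓ g.2) (hΔ g.2) h1 h2)) R

theorem crystallographic {Γ Δ : Subgroup (SOPlus n)} (hΓ : DiscreteTopology Γ)
    (hfull : F.IsFullRank Γ) (hΔΓ : Δ ≤ Γ) (hΔ : Δ ≤ F.P1) (hΓΔ : Γ ⊓ F.P1 ≤ Δ) :
    Crystallographic (rotHom hΔ) fun g => F.trans g.1 where
  isometry := norm_rotHom hΔ
  t_mul := trans_mul_rotHom hΔ
  finite := finite_trans_le hΓ hΔΓ hΔ
  dense := by
    obtain ⟨R, hR⟩ := exists_trans_close hfull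
    refine ⟨R, fun x => ?_⟩
    obtain ⟨g, hg, hgx⟩ := hR x
    exact ⟨⟨g, hΓΔ hg⟩, hgx⟩

theorem lor_ν_sub (a : EuclideanSpace ℝ (Fin n)) (x : LSpace n) :
    lor n (act (F.ν a) x - x) (act (F.ν a) x - x) = (lor n F.ξ x * ‖a‖) ^ 2 := by
  rw [act_ν, unip_apply]
  set d := lor n (F.incl a) x - ‖a‖ ^ 2 / 2 * lor n F.ξ x
  have h : x - lor n F.ξ x • F.incl a + d • F.ξ - x = d • F.ξ - lor n F.ξ x • F.incl a := by
    module
  rw [h]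
  simp only [map_sub, map_smul, LinearMap.sub_apply, LinearMap.smul_apply, smul_eq_mul, F.ξ_null,
    lor_ξ_incl, lor_comm _ F.ξ, lor_incl, real_inner_self_eq_norm_sq]
  ring

/-- `N_ξ` is normal in `P_ξ`. The length is read off from the Lorentzian square of the displacement
of a point, which scales with the square of its pairing with `ξ`. -/
theorem exists_conj_ν {g : SOPlus n} {c : ℝ} (hc : 0 < c) (hg : act g F.ξ = c • F.ξ)
    (a : EuclideanSpace ℝ (Fin n)) :
    ∃ a', g * F.ν a * g⁻¹ = F.ν a' ∧ ‖a'‖ = c * ‖a‖ := by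
  have hinv : act g⁻¹ F.ξ = c⁻¹ • F.ξ := by
    have h := act_inv_act g F.ξ
    rw [hg, map_smul] at h
    rw [← h, smul_smul, inv_mul_cancel₀ hc.ne', one_smul, h]
  have hlor : ∀ x, lor n F.ξ (act g⁻¹ x) = c * lor n F.ξ x := fun x => by
    rw [← lor_act g, hg, act_act_inv, map_smul, LinearMap.smul_apply, smul_eq_mul]
  have happ : ∀ x, act (g * F.ν a * g⁻¹) x = act g (act (F.ν a) (act g⁻¹ x)) := fun x => by
    rw [act_mul, act_mul]
  have hN : g * F.ν a * g⁻¹ ∈ F.N := by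
    refine ⟨?_, fun x hx => ?_⟩
    · rw [happ, hinv, map_smul, P1.act_ξ (F.ν_mem_P1 a), map_smul, hg, smul_smul,
        inv_mul_cancel₀ hc.ne', one_smul]
    · obtain ⟨d, hd⟩ := (F.ν_mem_N a).2 (act g⁻¹ x) (by rw [hlor, hx, mul_zero])
      exact ⟨d * c, by rw [happ, hd, map_add, map_smul, hg, act_act_inv, smul_smul]⟩
  have h1 := eq_ν_of_rot (F := F) hN.1 (F.rot_of_mem_N hN)
  refine ⟨_, h1, ?_⟩
  have h2 := lor_ν_sub (F := F) (F.trans (g * F.ν a * g⁻¹)) F.O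
  rw [← h1, happ] at h2
  have h3 : act g (act (F.ν a) (act g⁻¹ F.O)) - F.O =
      act g (act (F.ν a) (act g⁻¹ F.O) - act g⁻¹ F.O) := by rw [map_sub, act_act_inv]
  rw [h3, lor_act, lor_ν_sub, hlor, F.ξ_O] at h2
  have h4 : (c * ‖a‖) ^ 2 = ‖F.trans (g * F.ν a * g⁻¹)‖ ^ 2 := by linarith
  exact ((pow_left_inj₀ (by positivity) (norm_nonneg _) two_ne_zero).mp h4).symm

/-- The stabilizer of a cusp of full rank of a discrete group preserves the horospheres. -/
theorem stab_le_P1 (hn : 1 ≤ n) {Γ : Subgroup (SOPlus n)} (hΓ : DiscreteTopology Γ)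
    (hfull : F.IsFullRank Γ) : F.stab Γ ≤ F.P1 := by
  obtain ⟨ε, hε, hiso⟩ := F.exists_isolated hΓ
  -- The part of `Γ` preserving the horosphere is already cocompact on it, so Bieberbach's theorem
  -- applies to it first and produces a nontrivial translation.
  obtain ⟨a, ha, haΓ⟩ : ∃ a ≠ 0, F.ν a ∈ Γ := by
    have H := crystallographic hΓ hfull inf_le_left inf_le_right (le_refl (Γ ⊓ F.P1))
    by_contra! hcon
    have h1 : Submodule.span ℝ {x | ∃ g, rotHom (F := F) (Δ := Γ ⊓ F.P1) inf_le_right g = 1 ∧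
        F.trans g.1 = x} ≤ ⊥ := by
      rw [Submodule.span_le]
      rintro x ⟨g, hg, rfl⟩
      by_contra h2
      refine hcon (F.trans g.1) h2 ?_
      rw [← eq_ν_of_rot g.2.2 hg]
      exact g.2.1
    rw [H.span_translations, top_le_iff] at h1
    have : Nonempty (Fin n) := ⟨⟨0, hn⟩⟩
    exact bot_ne_top h1
  -- An element contracting `ξ` would conjugate this translation to arbitrarily short nontrivial
  -- ones, against discreteness. Applied to `γ` and `γ⁻¹`, this forces `c = 1`.
  have key : ∀ γ ∈ Γ, ∀ c : ℝ, 0 < c → act γ F.ξ = c • F.ξ → ¬c < 1 := fun γ hγ c hc hγξ hc1 => by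
    have h1 : ∀ k : ℕ, ∃ b, F.ν b ∈ Γ ∧ ‖b‖ = c ^ k * ‖a‖ := fun k => by
      induction k with
      | zero => exact ⟨a, haΓ, by rw [pow_zero, one_mul]⟩
      | succ k ih =>
        obtain ⟨b, hb, hbn⟩ := ih
        obtain ⟨b', hb', hbn'⟩ := exists_conj_ν hc hγξ b
        refine ⟨b', hb' ▸ Γ.mul_mem (Γ.mul_mem hγ hb) (Γ.inv_mem hγ), ?_⟩
        rw [hbn', hbn, pow_succ']
        ring
    have ha' := norm_pos_iff.mpr ha
    obtain ⟨k, hk⟩ := exists_pow_lt_of_lt_one (div_pos hε ha') hc1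
    obtain ⟨b, hb, hbn⟩ := h1 k
    have h2 : F.ν b = 1 := hiso _ hb (F.ν_mem_P1 b) (by rwa [rot_ν, sub_self, norm_zero])
      (by rwa [trans_ν, hbn, ← lt_div_iff₀ ha'])
    have h3 := congrArg F.trans h2
    rw [trans_ν, trans_one] at h3
    rw [h3, norm_zero] at hbn
    exact (mul_pos (pow_pos hc k) ha').ne hbn
  rintro γ ⟨hγ, c, hc, hγξ⟩
  have h1 := key γ hγ c hc hγξ
  have h2 := key γ⁻¹ (Γ.inv_mem hγ) c⁻¹ (inv_pos.mpr hc) (by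
    have h := act_inv_act γ F.ξ
    rw [hγξ, map_smul] at h
    rw [← h, smul_smul, inv_mul_cancel₀ hc.ne', one_smul, h])
  have h3 : c = 1 := le_antisymm (by
    by_contra h
    exact h2 (inv_lt_one_of_one_lt₀ (not_le.mp h))) (not_lt.mp h1)
  change act γ F.ξ = F.ξ
  rw [hγξ, h3, one_smul]

end Frame

end HypCusp

/-! ### Group cohomology by homogeneous cochains -/

namespace HomCochain

open CategoryTheory groupCohomology

variable {G : Type} [Group G] {A : Rep.{0} ℝ G}

theorem d_iCocycles {q : ℕ} (c : cocycles A q) :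
    inhomogeneousCochains.d A q (iCocycles A q c) = 0 := by
  have h := (groupCohomology.inhomogeneousCochains A).iCycles_d q (q + 1)
  rw [groupCohomology.inhomogeneousCochains.d_def] at h
  exact ConcreteCategory.congr_hom h c

theorem hd_homogenize_eq_zero {q : ℕ} {f : (Fin q → G) → A}
    (hf : inhomogeneousCochains.d A q f = 0) : hd ℝ (q + 1) (homogenize A f) = 0 := by
  refine eq_of_partialProd (fun g => ?_) (fun g => map_zero _) fun g => ?_
  · rw [← hd_tr, tr_homogenize]
  · rw [← congrFun (d_partialProd fun g => tr_homogenize f g) g]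
    simp only [homogenize_partialProd]
    exact congrFun hf g

theorem d_eq_zero {q : ℕ} {C : (Fin (q + 1) → G) → A} (hC : ∀ g, tr A.ρ g C = C)
    (h : hd ℝ (q + 1) C = 0) :
    inhomogeneousCochains.d A q (fun g => C (Fin.partialProd g)) = 0 := by
  rw [d_partialProd hC, h]
  rfl

/-- The abstract class map is unpacked through its description as a cokernel, which makes
coboundaries explicit functions. -/
theorem π_eq_zero_iff {q : ℕ} (c : cocycles A (q + 1)) :
    π A (q + 1) c = 0 ↔ ∃ f : (Fin q → G) → A,
      inhomogeneousCochains.d A q f = iCocycles A (q + 1) c := by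
  have hi : ∀ f : (Fin q → G) → A, iCocycles A (q + 1) (toCocycles A q (q + 1) f) =
      inhomogeneousCochains.d A q f := fun f => by
    have h := (groupCohomology.inhomogeneousCochains A).toCycles_i q (q + 1)
    rw [groupCohomology.inhomogeneousCochains.d_def] at h
    exact ConcreteCategory.congr_hom h f
  have hinj : Function.Injective (iCocycles A (q + 1)) :=
    (ModuleCat.mono_iff_injective _).mp inferInstance
  let S := ShortComplex.mk _ _
    ((groupCohomology.inhomogeneousCochains A).toCycles_comp_homologyπ q (q + 1))
  have hS : S.Exact := S.exact_of_g_is_cokernel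
    ((groupCohomology.inhomogeneousCochains A).homologyIsCokernel q (q + 1) (by simp))
  constructor
  · intro h
    obtain ⟨f, hf⟩ := (ShortComplex.moduleCat_exact_iff S).mp hS c h
    exact ⟨f, (hi f).symm.trans (congrArg _ hf)⟩
  · rintro ⟨f, hf⟩
    rw [← hi] at hf
    rw [← hinj hf]
    exact ConcreteCategory.congr_hom S.zero f

/-- Two invariant homogeneous cocycles have the same class when they differ by the differential of
an invariant cochain. -/
theorem π_eq_iff {q : ℕ} {c c' : cocycles A (q + 1)} {C C' : (Fin (q + 2) → G) → A}
    (hC : ∀ g, tr A.ρ g C = C) (hC' : ∀ g, tr A.ρ g C' = C')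
    (hc : iCocycles A (q + 1) c = fun g => C (Fin.partialProd g))
    (hc' : iCocycles A (q + 1) c' = fun g => C' (Fin.partialProd g)) :
    π A (q + 1) c = π A (q + 1) c' ↔
      ∃ b : (Fin (q + 1) → G) → A, (∀ g, tr A.ρ g b = b) ∧ hd ℝ (q + 1) b = C - C' := by
  rw [← sub_eq_zero, ← map_sub, π_eq_zero_iff, map_sub, hc, hc']
  constructor
  · rintro ⟨f, hf⟩
    refine ⟨homogenize A f, tr_homogenize f, ?_⟩
    refine eq_of_partialProd (fun g => ?_) (fun g => by rw [map_sub, hC, hC']) fun g => ?_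
    · rw [← hd_tr, tr_homogenize]
    · rw [← congrFun (d_partialProd fun g => tr_homogenize f g) g]
      simp only [homogenize_partialProd]
      exact congrFun hf g
  · rintro ⟨b, hb, hbC⟩
    refine ⟨fun g => b (Fin.partialProd g), ?_⟩
    rw [d_partialProd hb, hbC]
    rfl

end HomCochain

/-! ### The cohomology of a cusp group of full rank in top degree -/

namespace HypCusp

open CornerSimplex HomCochain groupCohomology
open scoped ContDiff

namespace Frame

variable {n : ℕ} {F : Frame n} {Γ : Subgroup (SOPlus n)}

/-- A cusp group of full rank contains a lattice of translations with finite index. -/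
theorem exists_translations (hn : 1 ≤ n) (hΓ : DiscreteTopology Γ) (hfull : F.IsFullRank Γ) :
    ∃ (τ : Module.Basis (Fin n) ℝ (EuclideanSpace ℝ (Fin n))) (e : Fin n → F.stab Γ)
      (m : Fin n → F.stab Γ → ℤ), (∀ j, (e j).1 = F.ν (τ j)) ∧ (∀ i j, Commute (e i) (e j)) ∧
      IsExponent e m ∧ (Subgroup.closure (Set.range e)).FiniteIndex := by
  have hΔ := stab_le_P1 hn hΓ hfull
  have H := crystallographic (Δ := F.stab Γ) hΓ hfull inf_le_left hΔ
    (le_inf inf_le_left fun g hg => ⟨1, one_pos, by rw [one_smul]; exact hg.2⟩)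
  obtain ⟨τ, e, m, h1, h2, h3, h4, h5⟩ := H.exists_generators
    (fun g h hA ht => Subtype.ext (eq_of_rot_trans (hΔ g.2) (hΔ h.2) hA ht))
    finrank_euclideanSpace_fin
  refine ⟨τ, e, m, fun j => ?_, h3, h4, h5⟩
  rw [eq_ν_of_rot (hΔ (e j).2) (h1 j), h2]

/-- Every invariant homogeneous cocycle of top degree differs by a coboundary from the cocycle of
an invariant form. -/
theorem exists_eq_homCochain_add (hn : 1 ≤ n) (hΓ : DiscreteTopology Γ) (hfull : F.IsFullRank Γ)
    {c : (Fin (n + 1) → F.stab Γ) → so n} (hc : ∀ g, tr (adRes (F.stab Γ)) g c = c)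
    (hdc : hd ℝ (n + 1) c = 0) :
    ∃ y, ∃ b : (Fin n → F.stab Γ) → so n, (∀ g ∈ F.stab Γ, F.rot g y = y) ∧
      (∀ g, tr (adRes (F.stab Γ)) g b = b) ∧ c = F.homCochain (F.stab Γ) y + hd ℝ n b := by
  have hΔ := stab_le_P1 hn hΓ hfull
  obtain ⟨τ, e, m, he, hcomm, hm, hfin⟩ := exists_translations hn hΓ hfull
  have hinj : ∀ y, ∀ b ∈ fixedBy (adRes (F.stab Γ)) e n n,
      hd ℝ n b = F.homCochain (F.stab Γ) y → y = 0 := fun y b hb h =>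
    eq_zero_of_homCochain_eq hn τ he (fun j => hb j j.2) h
  have hl : LinearMap.ker F.coinv ≤
      Submodule.span ℝ {w | ∃ j u, adRes (F.stab Γ) (e j) u - u = w} := fun X hX =>
    mem_of_coinv_eq_zero hn τ
      (fun j Y => (Submodule.subset_span ⟨j, Y, by rw [← he j]; rfl⟩ :
        _ ∈ Submodule.span ℝ {w | ∃ j u, adRes (F.stab Γ) (e j) u - u = w})) (LinearMap.mem_ker.mp hX)
  have hfix : ∀ y, F.homCochain (F.stab Γ) y ∈ fixedBy (adRes (F.stab Γ)) e n (n + 1) :=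
    fun y j _ => by
      rw [tr_homCochain hΔ, he, rot_ν]
      rfl
  obtain ⟨y, b, hy, hb, hcb⟩ := exists_invariant_eq_add_hd hcomm hm rfl F.coinv hl
    (F.homCochain (F.stab Γ)) hfix (fun g y => ⟨_, (tr_homCochain hΔ g y).symm⟩)
    (F.hd_homCochain _) hinj hc hdc
  refine ⟨y, b, fun g hg => ?_, hb, hcb⟩
  have h := hy ⟨g, hg⟩
  -- Invariance of the cochain becomes invariance of its parameter, because `y ↦ homCochain y` is
  -- injective.
  rw [tr_homCochain hΔ, ← sub_eq_zero, ← map_sub] at h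
  exact sub_eq_zero.mp (hinj _ 0 (Submodule.zero_mem _) (by rw [map_zero, h]))

theorem tr_homCochain_eq_self (hΔ : F.stab Γ ≤ F.P1) {y : EuclideanSpace ℝ (Fin n)}
    (hy : ∀ g ∈ F.stab Γ, F.rot g y = y) (g : F.stab Γ) :
    tr (adRes (F.stab Γ)) g (F.homCochain (F.stab Γ) y) = F.homCochain (F.stab Γ) y := by
  rw [tr_homCochain hΔ, hy g.1 g.2]

/-- Initial value and `N_ξ`-invariance determine the form; `Γ_ξ`-invariance at the identity then
says that the rotation parts fix `y`. -/
theorem IsInvariantRepresentative.exists_eq_topForm {α : groupCohomology (AdRep (F.stab Γ)) n}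
    {η : Form n n} (h : F.IsInvariantRepresentative Γ α η) (hΔ : F.stab Γ ≤ F.P1) :
    ∃ y, η = F.topForm y ∧ ∀ g ∈ F.stab Γ, F.rot g y = y := by
  obtain ⟨v, hv, hv1⟩ := h.initial
  obtain ⟨y, rfl⟩ := exists_root hv
  have hη := F.eq_topForm h.N_invariant hv1
  subst hη
  refine ⟨y, rfl, fun g hg => F.rot_eq_of_lift y ⟨g, hΔ hg⟩ ?_⟩
  have h1 := h.Γ_invariant ⟨g, hΔ hg⟩ hg 1
  rwa [mul_one] at h1

theorem exists_isInvariantRepresentative (hn : 1 ≤ n) (hΓ : DiscreteTopology Γ)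
    (hfull : F.IsFullRank Γ) (α : groupCohomology (AdRep (F.stab Γ)) n) :
    ∃ η, F.IsInvariantRepresentative Γ α η := by
  have hΔ := stab_le_P1 hn hΓ hfull
  obtain ⟨q, rfl⟩ : ∃ q, n = q + 1 := ⟨n - 1, by omega⟩
  induction α using groupCohomology_induction_on with
  | h c =>
    obtain ⟨y, b, hy, hb, hcb⟩ := exists_eq_homCochain_add hn hΓ hfull
      (fun g => tr_homogenize (iCocycles _ _ c) g) (hd_homogenize_eq_zero (d_iCocycles c))
    have htr := tr_homCochain_eq_self hΔ hy
    have hd0 := d_eq_zero (A := AdRep (F.stab Γ)) htr (F.hd_homCochain _ y)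
    refine ⟨F.topForm y, F.contDiff_topForm y, extDeriv_top _, fun ν hν p => ?_, fun γ hγ p => ?_,
      ⟨cocyclesMk _ hd0, iCocycles_mk _ hd0, ?_⟩, _, F.root_mem y, F.lift_topForm_one y⟩
    · exact F.lift_topForm_mul y ν p (by rw [F.rot_of_mem_N hν]; rfl)
    · exact F.lift_topForm_mul y γ p (hy _ hγ)
    · refine ((π_eq_iff (fun g => tr_homogenize (iCocycles _ _ c) g) htr ?_
        (iCocycles_mk _ hd0)).mpr ⟨b, hb, ?_⟩).symm
      · simp only [homogenize_partialProd]
      · rw [hcb]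
        exact (add_sub_cancel_left _ _).symm

theorem IsInvariantRepresentative.unique (hn : 1 ≤ n) (hΓ : DiscreteTopology Γ)
    (hfull : F.IsFullRank Γ) {α : groupCohomology (AdRep (F.stab Γ)) n} {η η' : Form n n}
    (h : F.IsInvariantRepresentative Γ α η) (h' : F.IsInvariantRepresentative Γ α η') : η = η' := by
  have hΔ := stab_le_P1 hn hΓ hfull
  obtain ⟨q, rfl⟩ : ∃ q, n = q + 1 := ⟨n - 1, by omega⟩
  obtain ⟨y, rfl, hy⟩ := h.exists_eq_topForm hΔ
  obtain ⟨y', rfl, hy'⟩ := h'.exists_eq_topForm hΔ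
  obtain ⟨c, hc, hcα⟩ := h.represents
  obtain ⟨c', hc', hcα'⟩ := h'.represents
  obtain ⟨b, hb, hbC⟩ := (π_eq_iff (tr_homCochain_eq_self hΔ hy) (tr_homCochain_eq_self hΔ hy')
    hc hc').mp (hcα.trans hcα'.symm)
  obtain ⟨τ, e, -, he, -⟩ := exists_translations hn hΓ hfull
  rw [← map_sub] at hbC
  rw [sub_eq_zero.mp (eq_zero_of_homCochain_eq hn τ he (fun j => hb (e j)) hbC)]

end Frame

end HypCusp

/-! ### Existence, uniqueness and the Cartan involution -/

open HypCusp

theorem proposition3p3 (n : ℕ) (hn : 1 ≤ n) (F : Frame n)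
    (Γ : Subgroup (SOPlus n)) (hdisc : DiscreteTopology Γ)
    (htf : ∀ γ ∈ Γ, IsOfFinOrder γ → γ = 1) (hfull : F.IsFullRank Γ)
    (α : groupCohomology (Frame.AdRep (F.stab Γ)) n) :
    (∃! η : Frame.Form n n, F.IsInvariantRepresentative Γ α η) ∧
      ∀ η : Frame.Form n n, F.IsInvariantRepresentative Γ α η →
        ∀ v ∈ F.V (-2), F.lift η 1 = F.volTensor v →
          ∀ γ ∈ F.stab Γ, Ad n γ (F.Θ v) = F.Θ v := by
  refine ⟨?_, fun η hη v hv hv1 γ hγ => ?_⟩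
  · obtain ⟨η, hη⟩ := Frame.exists_isInvariantRepresentative hn hdisc hfull α
    exact ⟨η, hη, fun η' hη' => hη'.unique hn hdisc hfull hη⟩
  · have hΔ := Frame.stab_le_P1 hn hdisc hfull
    obtain ⟨y, rfl, hy⟩ := hη.exists_eq_topForm hΔ
    rw [F.lift_topForm_one] at hv1
    rw [← F.volTensor_injective hv1]
    exact Frame.Ad_Θ_root (hΔ hγ) (hy γ hγ)
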